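/- A graph $G=(V,E)$ is a finite set $V$ with $E\subseteq V\times V$ without loops; the edge $u-v$ is undirected if $(u,v),(v,u)\in E$, and directed, $u\to v$, if $(u,v)\in E$ and $(v,u)\notin E$. An MPDAG is a graph without cycles of directed edges to which none of the four Meek orientation rules applies. A bucket of an MPDAG $G$ is the subgraph of $G$ induced by the vertex set of a connected component of the undirected part of $G$ (it may contain directed edges). An AMO (acyclic moral orientation) of a bucket $B$ is a DAG with the same skeleton as $B$ that contains all directed edges of $B$ and has no v-structure, that is, no $u\to c\leftarrow v$ with $u\neq v$ nonadjacent. Theorem. There is an algorithm that enumerates all AMOs of a given bucket $B$ with worst-case delay $O(n+m)$, where $n$ is the number of vertices and $m$ the number of edges of $B$. Precisely: there are a program for a unit-cost RAM with words of $O(\log(n+m))$ bits and a constant $C$ such that for every bucket $B$, given by its vertex number $n$ and a list of its edge pairs in any order, the program outputs every AMO of $B$ exactly once (each written out as a list of its edges), outputs nothing else, and halts; and the number of steps before the first output, between any two consecutive outputs, and from the last output (or from the start, if there is none) to the halt is at most $C(n+m)$. -/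

import Mathlib

/-! ## Partially directed graphs, MPDAGs, buckets, AMOs

A graph is a set of ordered pairs of vertices (`Digraph`): `u - v` is undirected if both `(u, v)` and
`(v, u)` are edges, and directed `u → v` if only `(u, v)` is. -/

namespace Digraph

variable {V : Type*}

/-- `u → v` -/
def Arc (G : Digraph V) (u v : V) : Prop := G.Adj u v ∧ ¬ G.Adj v u

/-- `u - v` -/
def Undir (G : Digraph V) (u v : V) : Prop := G.Adj u v ∧ G.Adj v u

/-- `u` and `v` are adjacent (linked by an edge of any type). -/
def Linked (G : Digraph V) (u v : V) : Prop := G.Adj u v ∨ G.Adj v u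

/-- Partially directed acyclic graph: no loops, and no cycle of directed edges. -/
def IsPDAG (G : Digraph V) : Prop :=
  (∀ v, ¬ G.Adj v v) ∧ ∀ v, ¬ Relation.TransGen G.Arc v v

/-- None of the four Meek rules applies. -/
structure MeekClosed (G : Digraph V) : Prop where
  r1 : ∀ a b c, G.Arc a b → G.Undir b c → G.Linked a c
  r2 : ∀ a b c, G.Arc a b → G.Arc b c → ¬ G.Undir a c
  r3 : ∀ a b c d, b ≠ d → G.Undir a b → G.Undir a c → G.Undir a d → G.Arc b c → G.Arc d c →
    G.Linked b d
  r4 : ∀ a b c d, b ≠ d → G.Undir a b → G.Undir a c → G.Undir a d → G.Arc d c → G.Arc c b →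
    G.Linked b d

/-- Maximally oriented PDAG. -/
def IsMPDAG (G : Digraph V) : Prop := G.IsPDAG ∧ G.MeekClosed

/-- `B` is (up to a renaming of vertices) a bucket of a finite MPDAG: the graph induced by the vertex
set of a connected component of the undirected part of the MPDAG. It keeps all edges of the
MPDAG between these vertices, directed ones included. -/
def IsBucket (B : Digraph V) : Prop :=
  ∃ (U : Type) (_ : Finite U) (G : Digraph U), G.IsMPDAG ∧
    ∃ (K : G.toSimpleGraphStrict.ConnectedComponent) (e : V ≃ K.supp),
      ∀ x y, B.Adj x y ↔ G.Adj (e x) (e y)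

/-- `D` is an AMO of `B`: an acyclic orientation of the skeleton of `B` that contains the directed
edges of `B` and has no v-structure. Acyclicity of `D.Adj` excludes loops and undirected edges. -/
structure IsAMO (B D : Digraph V) : Prop where
  skeleton : ∀ u v, D.Linked u v ↔ B.Linked u v
  arcs : ∀ u v, B.Arc u v → D.Adj u v
  acyclic : ∀ v, ¬ Relation.TransGen D.Adj v v
  moral : ∀ u c v, D.Adj u c → D.Adj v c → u ≠ v → D.Linked u v

/-- The number of edges, an undirected edge being counted once. -/
noncomputable def numEdges (G : Digraph V) : ℕ := G.toSimpleGraphInclusive.edgeSet.ncard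

/-- `L` lists the pairs in the edge set of `G`, each once, in some order. -/
def IsEdgeList {n : ℕ} (L : List (Fin n × Fin n)) (G : Digraph (Fin n)) : Prop :=
  L.Nodup ∧ ∀ u v, (u, v) ∈ L ↔ G.Adj u v

/-- The words `u₁, v₁, u₂, v₂, …` of a list of pairs of vertices. -/
def edgeWords {n : ℕ} (L : List (Fin n × Fin n)) : List ℕ :=
  L.flatMap fun e => [(e.1 : ℕ), (e.2 : ℕ)]

end Digraph

/-! ## A word RAM with an output log

Registers and arrays of natural numbers, with addition and truncated subtraction as the only
arithmetic. A program mentions finitely many registers and arrays. Every constant, register access,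
array access, operator, assignment, test and output instruction costs one step. -/

namespace RAM

inductive Expr where
  | const (k : ℕ)
  | reg (x : ℕ)
  /-- cell `i` of array `a` -/
  | get (a : ℕ) (i : Expr)
  | add (e f : Expr)
  | sub (e f : Expr)
  /-- `1` if `e < f`, else `0` -/
  | lt (e f : Expr)
  /-- `1` if `e = f`, else `0` -/
  | eq (e f : Expr)

inductive Prog where
  | skip
  /-- register `x := e` -/
  | set (x : ℕ) (e : Expr)
  /-- cell `i` of array `a := e` -/
  | store (a : ℕ) (i e : Expr)
  /-- append the word `e` to the object that is being output -/
  | write (e : Expr)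
  /-- the object that is being output is complete -/
  | emit
  | seq (p q : Prog)
  /-- `p` if `e ≠ 0`, else `q` -/
  | ite (e : Expr) (p q : Prog)
  /-- repeat `p` as long as `e ≠ 0` -/
  | while (e : Expr) (p : Prog)

structure State where
  reg : ℕ → ℕ
  arr : ℕ → ℕ → ℕ
  /-- the words written since the last completed output -/
  cur : List ℕ
  /-- the number of steps since the last completed output (or since the start) -/
  clock : ℕ
  /-- the completed outputs in order, each with its delay: the number of steps since the
  previous output (or since the start) -/
  log : List (List ℕ × ℕ)

/-- The input is in array `0`, its length in register `0`; everything else is `0`. -/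
def State.init (input : List ℕ) : State where
  reg x := if x = 0 then input.length else 0
  arr a i := if a = 0 then input.getD i 0 else 0
  cur := []
  clock := 0
  log := []

def Expr.eval (s : State) : Expr → ℕ
  | .const k => k
  | .reg x => s.reg x
  | .get a i => s.arr a (i.eval s)
  | .add e f => e.eval s + f.eval s
  | .sub e f => e.eval s - f.eval s
  | .lt e f => if e.eval s < f.eval s then 1 else 0
  | .eq e f => if e.eval s = f.eval s then 1 else 0

def Expr.cost : Expr → ℕ
  | .const _ => 1
  | .reg _ => 1
  | .get _ i => i.cost + 1
  | .add e f => e.cost + f.cost + 1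
  | .sub e f => e.cost + f.cost + 1
  | .lt e f => e.cost + f.cost + 1
  | .eq e f => e.cost + f.cost + 1

def State.tick (s : State) (k : ℕ) : State := { s with clock := s.clock + k }

def State.setReg (s : State) (x v : ℕ) : State := { s with reg := Function.update s.reg x v }

def State.setArr (s : State) (a i v : ℕ) : State :=
  { s with arr := Function.update s.arr a (Function.update (s.arr a) i v) }

def State.write (s : State) (v : ℕ) : State := { s with cur := s.cur ++ [v] }

def State.emit (s : State) : State :=
  { s with cur := [], clock := 0, log := s.log ++ [(s.cur, s.clock)] }

/-- `Exec W p s t`: started in state `s`, the program `p` halts in state `t`, and never stores a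
word larger than `W` nor writes to an address larger than `W` (it is stuck if it tries). -/
inductive Exec (W : ℕ) : Prog → State → State → Prop
  | skip (s : State) : Exec W .skip s (s.tick 1)
  | set (s : State) (x : ℕ) (e : Expr) (he : e.eval s ≤ W) :
      Exec W (.set x e) s ((s.setReg x (e.eval s)).tick (e.cost + 1))
  | store (s : State) (a : ℕ) (i e : Expr) (hi : i.eval s ≤ W) (he : e.eval s ≤ W) :
      Exec W (.store a i e) s
        ((s.setArr a (i.eval s) (e.eval s)).tick (i.cost + e.cost + 1))
  | write (s : State) (e : Expr) (he : e.eval s ≤ W) :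
      Exec W (.write e) s ((s.write (e.eval s)).tick (e.cost + 1))
  | emit (s : State) : Exec W .emit s (s.tick 1).emit
  | seq {p q : Prog} {s t u : State} (hp : Exec W p s t) (hq : Exec W q t u) :
      Exec W (.seq p q) s u
  | ite_true {e : Expr} {p q : Prog} {s t : State} (he : e.eval s ≠ 0)
      (hp : Exec W p (s.tick (e.cost + 1)) t) : Exec W (.ite e p q) s t
  | ite_false {e : Expr} {p q : Prog} {s t : State} (he : e.eval s = 0)
      (hq : Exec W q (s.tick (e.cost + 1)) t) : Exec W (.ite e p q) s t
  | while_true {e : Expr} {p : Prog} {s t u : State} (he : e.eval s ≠ 0)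
      (hp : Exec W p (s.tick (e.cost + 1)) t) (hw : Exec W (.while e p) t u) :
      Exec W (.while e p) s u
  | while_false {e : Expr} {p : Prog} {s : State} (he : e.eval s = 0) :
      Exec W (.while e p) s (s.tick (e.cost + 1))

/-- On every edge list of `B`, the program `p`, run with words bounded by `W`, outputs all AMOs of
`B`, each exactly once and as an edge list, and halts. At most `d` steps pass before the first
output, between two consecutive outputs, and between the last output and the halt. -/
def EnumeratesAMOs (p : Prog) (W d : ℕ) {n : ℕ} (B : Digraph (Fin n)) : Prop :=
  ∀ L : List (Fin n × Fin n), B.IsEdgeList L →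
    ∃ t : State, Exec W p (State.init (n :: Digraph.edgeWords L)) t ∧
      t.cur = [] ∧ t.clock ≤ d ∧ (∀ o ∈ t.log, o.2 ≤ d) ∧
      ∃ Ds : List (Digraph (Fin n)), Ds.Nodup ∧ (∀ D, D ∈ Ds ↔ B.IsAMO D) ∧
        List.Forall₂ (fun o D => ∃ M : List (Fin n × Fin n),
          D.IsEdgeList M ∧ o.1 = Digraph.edgeWords M) t.log Ds

end RAM

set_option linter.unusedSimpArgs false

open Digraph Relation

open Relation

namespace Digraph

/-! An AMO is built by choosing its vertices one after the other in topological order. A maximum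
cardinality search visits next an unvisited vertex with as many visited neighbors as possible (its
label). Here the vertex must also be ready, that is, have no unvisited directed in-neighbor. Two
facts turn this into an enumeration.

Branching. Let the visited vertices be an initial segment of an AMO `D`, let `x` be ready of maximum
label, and let `K` be the component of `x` among the unvisited vertices of maximum label. By
morality a parent in `D` of a vertex of `K` is visited or lies in `K` (`maxLabel_of_parent`,
`comp_closed`), so a source of `K` in `D` can be visited next (`exists_ext_snoc`). A connected set
has only one source in a moral acyclic digraph (`source_unique`), so `D` determines this vertex.
Branching over the ready vertices of `K` therefore loses no AMO and produces none twice.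

No dead ends. A source among the vertices of maximum label is ready, so a search never gets stuck.
If there is any AMO, then every complete search order orients `B` to an AMO (`isAMO_orient`),
because the visited neighbors of a connected set of unvisited vertices always form a clique
(`cliqueBoundary`). Indeed, in an AMO such a clique lies in the neighborhood of a single vertex of
the component (`exists_linked_clique`), so a vertex of maximum label in that component must see all
of it (`linked_of_connected`). Hence only the first orientation has to be tested for morality, and
if the test fails there is no AMO at all.

Delay. The tree of choices is traversed depth first. After each output the search is restarted,
replayed up to the last level with an unexplored alternative, continued there with this alternative
and then completed arbitrarily; each of these stages is linear. The alternatives of a level are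
computed only when it becomes the branching level. Until then one bit suffices: whether the visited
vertex has an undirected edge to an unvisited vertex of the same label. Without such an edge the
level offers no choice (`ext_snoc_of_no_undir`); with one there is a ready alternative
(`exists_ready_of_undir`), so that every round outputs a new AMO. The bookkeeping of explored and
unexplored branches is `remaining_step`, and the loop invariant of the program is `Enumerated`. -/

/-- The consequences of being a bucket, on the vertices `0, …, n - 1`, that the enumeration uses. -/
structure IsBucketOn (n : ℕ) (B : Digraph ℕ) : Prop where
  lt : ∀ u v, B.Adj u v → u < n ∧ v < n
  loopless : ∀ v, ¬ B.Adj v v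
  acyclic : ∀ v, ¬ TransGen B.Arc v v
  r1 : ∀ a b c, B.Arc a b → B.Undir b c → B.Linked a c
  r2 : ∀ a b c, B.Arc a b → B.Arc b c → ¬ B.Undir a c
  moral : ∀ a b c, B.Arc a c → B.Arc b c → a ≠ b → B.Linked a b

/-! ### Sources and sinks of finite acyclic relations. -/

theorem exists_source_of_acyclic {r : ℕ → ℕ → Prop} (h : ∀ v, ¬ TransGen r v v) {A : Set ℕ}
    (hf : A.Finite) (hA : A.Nonempty) : ∃ m ∈ A, ∀ a ∈ A, ¬ r a m := by
  have := hf.to_subtype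
  let R : A → A → Prop := fun a b => TransGen r a b
  have : IsTrans A R := ⟨fun _ _ _ h1 h2 => TransGen.trans h1 h2⟩
  have : Std.Irrefl R := ⟨fun a => h a⟩
  obtain ⟨m, -, hm⟩ := (Finite.wellFounded_of_trans_of_irrefl R).has_min Set.univ
    ⟨⟨_, hA.some_mem⟩, trivial⟩
  exact ⟨m, m.2, fun a ha hr => hm ⟨a, ha⟩ trivial (TransGen.single hr)⟩

theorem exists_sink_of_acyclic {r : ℕ → ℕ → Prop} (h : ∀ v, ¬ TransGen r v v) {A : Set ℕ}
    (hf : A.Finite) (hA : A.Nonempty) : ∃ m ∈ A, ∀ a ∈ A, ¬ r m a :=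
  exists_source_of_acyclic (r := Function.swap r)
    (fun v hv => h v (by rwa [← transGen_swap])) hf hA

theorem Linked.symm {V : Type*} {B : Digraph V} {u v : V} (h : B.Linked u v) : B.Linked v u :=
  Or.symm h

/-! ### Sources of connected vertex sets of moral digraphs -/

section Source

variable {D : Digraph ℕ} {R : Set ℕ} {s : ℕ}

/-- Walk back along the path to `y`: if `u → c ← b`, then `u` is `b` or, by morality, linked to `b`,
which is one step closer to `s`. At `s` itself the edge can only point away from `s`. -/
theorem reach_of_linked (hm : ∀ u c v, D.Adj u c → D.Adj v c → u ≠ v → D.Linked u v)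
    (hsR : s ∈ R) (hs : ∀ u ∈ R, ¬ D.Adj u s) {y : ℕ}
    (h : ReflTransGen (fun a b => D.Adj a b ∧ a ∈ R ∧ b ∈ R) s y) :
    ∀ u ∈ R, D.Linked u y → ReflTransGen (fun a b => D.Adj a b ∧ a ∈ R ∧ b ∈ R) s u := by
  induction h with
  | refl =>
    intro u hu hl
    exact .single ⟨hl.resolve_left (hs u hu), hsR, hu⟩
  | @tail b c hb hbc ih =>
    intro u hu hl
    rcases hl with h1 | h1
    · rcases eq_or_ne u b with rfl | hne
      · exact hb
      · exact ih u hu (hm _ _ _ h1 hbc.1 hne)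
    · exact (hb.tail hbc).tail ⟨h1, hbc.2.2, hu⟩

theorem reach_of_source (hm : ∀ u c v, D.Adj u c → D.Adj v c → u ≠ v → D.Linked u v)
    (hsR : s ∈ R) (hs : ∀ u ∈ R, ¬ D.Adj u s) {y : ℕ}
    (h : ReflTransGen (fun a b => D.Linked a b ∧ a ∈ R ∧ b ∈ R) s y) :
    ReflTransGen (fun a b => D.Adj a b ∧ a ∈ R ∧ b ∈ R) s y := by
  induction h with
  | refl => exact .refl
  | tail _ hbc ih => exact reach_of_linked hm hsR hs ih _ hbc.2.2 hbc.1.symm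

theorem linkedWithin_symm {x y : ℕ}
    (h : ReflTransGen (fun a b => D.Linked a b ∧ a ∈ R ∧ b ∈ R) x y) :
    ReflTransGen (fun a b => D.Linked a b ∧ a ∈ R ∧ b ∈ R) y x := by
  induction h with
  | refl => exact .refl
  | tail _ hbc ih => exact .head ⟨hbc.1.symm, hbc.2.2, hbc.2.1⟩ ih

/-- Everything in a connected set is reached from one source, so an edge from the set enters every
other vertex. -/
theorem source_unique (hm : ∀ u c v, D.Adj u c → D.Adj v c → u ≠ v → D.Linked u v)
    (hsR : s ∈ R) (hs : ∀ u ∈ R, ¬ D.Adj u s) {y : ℕ} (hy : ∀ u ∈ R, ¬ D.Adj u y)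
    (h : ReflTransGen (fun a b => D.Linked a b ∧ a ∈ R ∧ b ∈ R) s y) : s = y := by
  rcases (reach_of_source hm hsR hs h).cases_tail with h1 | ⟨c, -, hc⟩
  · exact h1.symm
  · exact absurd hc.1 (hy c hc.2.1)

/-- In a moral acyclic digraph a clique in the neighborhood of a connected set lies in the
neighborhood of a vertex of the set. -/
theorem exists_linked_clique (hm : ∀ u c v, D.Adj u c → D.Adj v c → u ≠ v → D.Linked u v)
    (hac : ∀ v, ¬ TransGen D.Adj v v) {C : Set ℕ} (hR : R.Finite) (hC : C.Finite)
    (hRC : ∀ c ∈ C, c ∉ R) {x : ℕ} (hx : x ∈ R)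
    (hconn : ∀ y ∈ R, ReflTransGen (fun a b => D.Linked a b ∧ a ∈ R ∧ b ∈ R) x y)
    (hclique : ∀ c ∈ C, ∀ d ∈ C, c ≠ d → D.Linked c d)
    (hnb : ∀ c ∈ C, ∃ w ∈ R, D.Linked c w) : ∃ q ∈ R, ∀ c ∈ C, D.Linked c q := by
  obtain ⟨s, hsR, hs⟩ := exists_source_of_acyclic hac hR ⟨x, hx⟩
  have hdesc : ∀ y ∈ R, ReflTransGen (fun a b => D.Adj a b ∧ a ∈ R ∧ b ∈ R) s y := fun y hy =>
    reach_of_source hm hsR hs ((linkedWithin_symm (hconn s hsR)).trans (hconn y hy))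
  -- A vertex `c` of the clique without parents in `R` is a parent of the source: from `c → w`,
  -- morality moves the head backwards along the path from `s` to `w`.
  have hup : ∀ c ∈ C, (∀ w ∈ R, ¬ D.Adj w c) → D.Adj c s := by
    intro c hc hw
    obtain ⟨w, hwR, hl⟩ := hnb c hc
    have h1 : D.Adj c w := hl.resolve_right (hw w hwR)
    have key : ∀ y, ReflTransGen (fun a b => D.Adj a b ∧ a ∈ R ∧ b ∈ R) s y →
        D.Adj c y → D.Adj c s := by
      intro y hy
      induction hy with
      | refl => exact id
      | tail _ hbc ih =>
        intro h2
        refine ih ((hm _ _ _ h2 hbc.1 ?_).resolve_right (hw _ hbc.2.1))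
        rintro rfl
        exact hRC _ hc hbc.2.1
    exact key w (hdesc w hwR) h1
  -- Let `d` be a last clique vertex with a parent `w` in `R`. A clique vertex `c → d` is linked to
  -- `w` by morality. If instead `d → c`, then `c` has no parent in `R`, so `c → s`, and the path
  -- from `s` to `w` closes a cycle through `w → d → c`.
  by_cases hne : {c ∈ C | ∃ w ∈ R, D.Adj w c}.Nonempty
  · obtain ⟨d, ⟨hd, w, hw, hwd⟩, hmax⟩ :=
      exists_sink_of_acyclic hac (hC.subset (Set.sep_subset _ _)) hne
    refine ⟨w, hw, fun c hc => ?_⟩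
    rcases eq_or_ne c d with rfl | hcd
    · exact Or.inr hwd
    · rcases hclique c hc d hd hcd with h1 | h1
      · refine hm _ _ _ h1 hwd ?_
        rintro rfl
        exact hRC _ hc hw
      · exfalso
        have h2 : D.Adj c s := hup c hc fun w hw hwc => hmax c ⟨hc, w, hw, hwc⟩ h1
        have h3 : ReflTransGen D.Adj s w :=
          ReflTransGen.mono (fun _ _ h => h.1) _ _ (hdesc w hw)
        exact hac d (TransGen.tail' ((ReflTransGen.single h1).trans
          ((ReflTransGen.single h2).trans h3)) hwd)
  · refine ⟨s, hsR, fun c hc => Or.inl (hup c hc fun w hw h => hne ⟨c, hc, w, hw, h⟩)⟩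

end Source

/-! ### Maximum cardinality search -/

open Classical in
/-- The number of vertices in `π` that are linked to the vertex `w` outside `π`. -/
noncomputable def label (B : Digraph ℕ) (π : List ℕ) (w : ℕ) : ℕ := π.countP fun p => B.Adj p w

/-- `x` is an unvisited vertex of maximum label. -/
structure MaxLabel (n : ℕ) (B : Digraph ℕ) (π : List ℕ) (x : ℕ) : Prop where
  lt : x < n
  notMem : x ∉ π
  le : ∀ u < n, u ∉ π → B.label π u ≤ B.label π x

/-- No directed edge leads from an unvisited vertex to `x`. -/
def Ready (B : Digraph ℕ) (π : List ℕ) (x : ℕ) : Prop := ∀ u, B.Arc u x → u ∈ π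

/-- The visiting orders of maximum cardinality searches that respect directed edges. -/
inductive MCS (n : ℕ) (B : Digraph ℕ) : List ℕ → Prop
  | nil : MCS n B []
  | snoc {π : List ℕ} {x : ℕ} (h : MCS n B π) (hx : MaxLabel n B π x) (hr : B.Ready π x) :
      MCS n B (π ++ [x])

/-- `D` is an AMO of `B` for which `π` is an initial segment of a topological order. -/
structure Ext (B : Digraph ℕ) (π : List ℕ) (D : Digraph ℕ) : Prop where
  amo : B.IsAMO D
  parents : ∀ i, ∀ h : i < π.length, ∀ u, D.Adj u π[i] → u ∈ π.take i

/-- The connected component of `x` among the unvisited vertices of maximum label. -/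
def comp (n : ℕ) (B : Digraph ℕ) (π : List ℕ) (x : ℕ) : Set ℕ :=
  {y | ReflTransGen (fun a b => B.Adj a b ∧ MaxLabel n B π b) x y}

variable {n : ℕ} {B D : Digraph ℕ} {π : List ℕ} {x y z : ℕ}

theorem ext_nil : B.Ext [] D ↔ B.IsAMO D :=
  ⟨fun h => h.amo, fun h => ⟨h, fun i hi => absurd hi (by simp)⟩⟩

theorem ext_snoc : B.Ext (π ++ [x]) D ↔ B.Ext π D ∧ ∀ u, D.Adj u x → u ∈ π := by
  constructor
  · intro h
    refine ⟨⟨h.amo, fun i hi u hu => ?_⟩, fun u hu => ?_⟩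
    · have := h.parents i (by simp; omega) u (by rwa [List.getElem_append_left hi])
      rwa [List.take_append_of_le_length hi.le] at this
    · have := h.parents π.length (by simp) u (by simpa using hu)
      simpa using this
  · rintro ⟨h, hx⟩
    refine ⟨h.amo, fun i hi u hu => ?_⟩
    rcases lt_or_ge i π.length with h1 | h1
    · rw [List.getElem_append_left h1] at hu
      rw [List.take_append_of_le_length h1.le]
      exact h.parents i h1 u hu
    · obtain rfl : i = π.length := by simp at hi; omega
      simpa using hx u (by simpa using hu)

theorem Ext.take (h : B.Ext π D) (k : ℕ) : B.Ext (π.take k) D := by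
  refine ⟨h.amo, fun i hi u hu => ?_⟩
  simp only [List.length_take, lt_min_iff] at hi
  rw [List.getElem_take] at hu
  rw [List.take_take, min_eq_left hi.1.le]
  exact h.parents i hi.2 u hu

theorem Ext.of_append {ρ : List ℕ} (h : B.Ext (π ++ ρ) D) : B.Ext π D := by
  simpa using h.take π.length

theorem Ext.mem_of_adj (h : B.Ext π D) (hx : x ∈ π) {u : ℕ} (hu : D.Adj u x) : u ∈ π := by
  obtain ⟨i, hi, rfl⟩ := List.getElem_of_mem hx
  exact List.mem_of_mem_take (h.parents i hi u hu)

/-- Visited sets contain the tails of all directed edges into them. This is why `label`, which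
counts only edges out of visited vertices, counts all visited neighbors of an unvisited vertex. -/
theorem adj_of_linked (hcl : ∀ p ∈ π, ∀ u, B.Arc u p → u ∈ π) {p u : ℕ} (hp : p ∈ π) (hu : u ∉ π)
    (h : B.Linked p u) : B.Adj p u := by
  rcases h with h | h
  · exact h
  · by_contra h1
    exact hu (hcl p hp u ⟨h, h1⟩)

theorem MCS.closed (h : MCS n B π) : ∀ p ∈ π, ∀ u, B.Arc u p → u ∈ π := by
  induction h with
  | nil => simp
  | snoc h hx hr ih =>
    intro p hp u hu
    rcases List.mem_append.1 hp with h1 | h1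
    · exact List.mem_append_left _ (ih p h1 u hu)
    · rw [List.mem_singleton] at h1
      subst h1
      exact List.mem_append_left _ (hr u hu)

theorem MCS.nodup (h : MCS n B π) : π.Nodup := by
  induction h with
  | nil => simp
  | snoc h hx hr ih =>
    exact List.nodup_append.2 ⟨ih, List.nodup_singleton _, fun a ha b hb hab =>
      hx.notMem (List.mem_singleton.1 hb ▸ hab ▸ ha)⟩

theorem MCS.lt (h : MCS n B π) : ∀ p ∈ π, p < n := by
  induction h with
  | nil => simp
  | snoc h hx hr ih =>
    intro p hp
    rcases List.mem_append.1 hp with h1 | h1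
    · exact ih p h1
    · rw [List.mem_singleton] at h1
      exact h1 ▸ hx.lt

theorem MCS.of_append {ρ : List ℕ} (h : MCS n B (π ++ ρ)) : MCS n B π := by
  induction ρ using List.reverseRecOn with
  | nil => simpa using h
  | append_singleton l a ih =>
    rw [← List.append_assoc] at h
    generalize hq : π ++ l ++ [a] = q at h
    cases h with
    | nil => simp at hq
    | snoc h hx hr =>
      obtain ⟨h1, -⟩ := List.append_inj' hq rfl
      exact ih (h1 ▸ h)

theorem MCS.snoc_inv (h : MCS n B (π ++ [x])) : MCS n B π ∧ MaxLabel n B π x ∧ B.Ready π x := by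
  generalize hq : π ++ [x] = q at h
  cases h with
  | nil => simp at hq
  | snoc h hx hr =>
    obtain ⟨rfl, h2⟩ := List.append_inj' hq rfl
    obtain rfl : x = _ := by simpa using h2
    exact ⟨h, hx, hr⟩

theorem MCS.take (h : MCS n B π) (i : ℕ) : MCS n B (π.take i) :=
  MCS.of_append (ρ := π.drop i) (by simpa using h)

theorem MCS.getElem (h : MCS n B π) {i : ℕ} (hi : i < π.length) :
    MaxLabel n B (π.take i) π[i] ∧ B.Ready (π.take i) π[i] := by
  have h1 := h.take (i + 1)
  rw [← List.take_concat_get' _ _ hi] at h1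
  exact h1.snoc_inv.2

theorem MCS.length_le (h : MCS n B π) : π.length ≤ n := by
  have h1 : π.toFinset ⊆ Finset.range n := fun a ha => by
    simpa using h.lt a (by simpa using ha)
  have h2 := Finset.card_le_card h1
  rwa [List.toFinset_card_of_nodup h.nodup, Finset.card_range] at h2

theorem MCS.mem_of_length (h : MCS n B π) (hn : π.length = n) {w : ℕ} (hw : w < n) : w ∈ π := by
  have h1 : π.toFinset ⊆ Finset.range n := fun a ha => by
    simpa using h.lt a (by simpa using ha)
  have h2 : π.toFinset = Finset.range n := Finset.eq_of_subset_of_card_le h1 (by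
    rw [List.toFinset_card_of_nodup h.nodup, Finset.card_range, hn])
  have : w ∈ π.toFinset := by rw [h2]; simpa using hw
  simpa using this

theorem MCS.exists_notMem (h : MCS n B π) (hn : π.length < n) : ∃ w < n, w ∉ π := by
  by_contra! hc
  have h1 : Finset.range n ⊆ π.toFinset := fun a ha => by
    simpa using hc a (by simpa using ha)
  have h2 := Finset.card_le_card h1
  rw [List.toFinset_card_of_nodup h.nodup, Finset.card_range] at h2
  omega

theorem label_le_label (h : ∀ p ∈ π, B.Adj p x → B.Adj p y) : B.label π x ≤ B.label π y :=
  List.countP_mono_left fun p hp => by simpa using h p hp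

theorem label_lt_label (h : ∀ p ∈ π, B.Adj p x → B.Adj p y) {q : ℕ} (hq : q ∈ π)
    (hx : ¬ B.Adj q x) (hy : B.Adj q y) : B.label π x < B.label π y := by
  obtain ⟨l, r, rfl⟩ := List.append_of_mem hq
  have h1 : B.label l x ≤ B.label l y := label_le_label fun p hp => h p (by simp [hp])
  have h2 : B.label r x ≤ B.label r y := label_le_label fun p hp => h p (by simp [hp])
  unfold label at *
  simp only [List.countP_append, List.countP_cons, hx, hy, decide_true, decide_false]
  simp
  omega

open Classical in
theorem label_snoc : B.label (π ++ [x]) y = B.label π y + if B.Adj x y then 1 else 0 := by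
  simp [label, List.countP_append, List.countP_singleton]

theorem label_le_length : B.label π x ≤ π.length := List.countP_le_length

theorem maxLabel_of_label_eq (hx : MaxLabel n B π x) (hy : y < n) (hn : y ∉ π)
    (h : B.label π y = B.label π x) : MaxLabel n B π y :=
  ⟨hy, hn, fun u hu hun => h ▸ hx.le u hu hun⟩

theorem MaxLabel.label_eq (hx : MaxLabel n B π x) (hy : MaxLabel n B π y) :
    B.label π y = B.label π x :=
  le_antisymm (hx.le y hy.lt hy.notMem) (hy.le x hx.lt hx.notMem)

namespace IsBucketOn

variable (hB : B.IsBucketOn n)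
include hB

theorem linked_lt (h : B.Linked x y) : x < n ∧ y < n :=
  h.elim (hB.lt _ _) fun h => (hB.lt _ _ h).symm

/-- Meek rule 1 if the second edge is undirected, the absence of directed v-structures otherwise. -/
theorem linked_of_arc_adj {a b c : ℕ} (h1 : B.Arc a b) (h2 : B.Adj c b) (hne : a ≠ c) :
    B.Linked a c := by
  by_cases h : B.Adj b c
  · exact hB.r1 _ _ _ h1 ⟨h, h2⟩
  · exact hB.moral _ _ _ h1 ⟨h2, h⟩ hne

/-- Each visited neighbor of `x` is also a neighbor of the tail `y` by `linked_of_arc_adj`, so the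
label of `y` is no smaller. -/
theorem maxLabel_of_arc (hcl : ∀ p ∈ π, ∀ u, B.Arc u p → u ∈ π) (h : B.Arc y x)
    (hx : MaxLabel n B π x) (hy : y ∉ π) : MaxLabel n B π y := by
  refine ⟨(hB.lt _ _ h.1).1, hy, fun u hu hun => (hx.le u hu hun).trans ?_⟩
  refine label_le_label fun p hp hpx => adj_of_linked hcl hp hy (hB.linked_of_arc_adj h hpx ?_).symm
  rintro rfl
  exact hy hp

/-- An unvisited directed in-neighbor of a vertex of maximum label has maximum label too; so a
source among these vertices is ready. -/
theorem exists_ready_maxLabel (hπ : MCS n B π) (hn : π.length < n) :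
    ∃ x, MaxLabel n B π x ∧ B.Ready π x := by
  obtain ⟨w, hw, hwπ⟩ := hπ.exists_notMem hn
  have hf : {w | w < n ∧ w ∉ π}.Finite := (Set.finite_lt_nat n).subset fun w h => h.1
  obtain ⟨m, hm, hmax⟩ := Set.exists_max_image _ (B.label π) hf ⟨w, hw, hwπ⟩
  have hm' : MaxLabel n B π m := ⟨hm.1, hm.2, fun u hu hun => hmax u ⟨hu, hun⟩⟩
  have hf' : {w | MaxLabel n B π w}.Finite := (Set.finite_lt_nat n).subset fun w h => h.lt
  obtain ⟨x, hx, hmin⟩ := exists_source_of_acyclic hB.acyclic hf' ⟨m, hm'⟩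
  refine ⟨x, hx, fun u hu => ?_⟩
  by_contra hc
  exact hmin u (hB.maxLabel_of_arc hπ.closed hu hx hc) hu

/-- `comp` follows edges only forwards, but this already yields the undirected component: for an
edge directed from `z` into a reached vertex, `z` is linked to the predecessor of that vertex on the
path, and so on back to `x`, which is ready and so has no such in-edge. Hence a search along
out-neighbor lists finds the component. -/
theorem comp_closed (hr : B.Ready π x) (hy : y ∈ comp n B π x) (hz : MaxLabel n B π z)
    (h : B.Linked z y) : z ∈ comp n B π x := by
  unfold comp at *
  induction hy generalizing z with
  | refl =>
    refine .single ⟨?_, hz⟩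
    by_contra hc
    exact hz.notMem (hr z ⟨h.resolve_right hc, hc⟩)
  | @tail c d hc hcd ih =>
    by_cases h1 : B.Adj d z
    · exact (hc.tail hcd).tail ⟨h1, hz⟩
    · rcases eq_or_ne z c with rfl | hne
      · exact hc
      · exact ih hz (hB.linked_of_arc_adj ⟨h.resolve_right h1, h1⟩ hcd.1 hne)

omit hB in
theorem _root_.Digraph.comp_maxLabel (hx : MaxLabel n B π x) (hy : y ∈ comp n B π x) :
    MaxLabel n B π y := by
  rcases ReflTransGen.cases_tail hy with h | ⟨c, -, hc⟩
  · exact h ▸ hx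
  · exact hc.2

omit hB in
theorem _root_.Digraph.comp_connected (hy : y ∈ comp n B π x) :
    ReflTransGen (fun a b => B.Linked a b ∧ a ∈ comp n B π x ∧ b ∈ comp n B π x) x y := by
  have hy' := hy
  unfold comp at hy
  induction hy with
  | refl => exact .refl
  | tail hc hcd ih => exact (ih hc).tail ⟨Or.inl hcd.1, hc, hy'⟩

/-- The visited neighbors of `z` are parents of `z` in `D`, because `π` is closed under parents. By
morality they are linked to the other parent `y`. -/
theorem maxLabel_of_parent (hD : B.Ext π D) (h : D.Adj y z) (hz : MaxLabel n B π z) (hy : y ∉ π) :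
    MaxLabel n B π y := by
  have hcl : ∀ p ∈ π, ∀ u, B.Arc u p → u ∈ π := fun p hp u hu =>
    hD.mem_of_adj hp (hD.amo.arcs u p hu)
  refine ⟨(hB.linked_lt ((hD.amo.skeleton _ _).1 (Or.inl h))).1, hy,
    fun u hu hun => (hz.le u hu hun).trans ?_⟩
  refine label_le_label fun p hp hpz => adj_of_linked hcl hp hy ?_
  have h1 : D.Adj p z := by
    rcases (hD.amo.skeleton p z).2 (Or.inl hpz) with h1 | h1
    · exact h1
    · exact absurd (hD.mem_of_adj hp h1) hz.notMem
  refine (hD.amo.skeleton _ _).1 (hD.amo.moral _ _ _ h1 h ?_)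
  rintro rfl
  exact hy hp

/-- Take a source of the component in `D`: an unvisited parent would have maximum label and hence
lie in the component. -/
theorem exists_ext_snoc (hD : B.Ext π D) (hx : MaxLabel n B π x) (hr : B.Ready π x) :
    ∃ z ∈ comp n B π x, B.Ready π z ∧ B.Ext (π ++ [z]) D := by
  have hf : (comp n B π x).Finite :=
    (Set.finite_lt_nat n).subset fun w h => (comp_maxLabel hx h).lt
  obtain ⟨z, hz, hmin⟩ := exists_source_of_acyclic hD.amo.acyclic hf ⟨x, .refl⟩
  have hz' := comp_maxLabel hx hz
  have key : ∀ u, D.Adj u z → u ∈ π := by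
    intro u hu
    by_contra hc
    refine hmin u (hB.comp_closed hr hz (hB.maxLabel_of_parent hD hu hz' hc) ?_) hu
    exact (hD.amo.skeleton _ _).1 (Or.inl hu)
  exact ⟨z, hz, fun u hu => key u (hD.amo.arcs _ _ hu), ext_snoc.2 ⟨hD, key⟩⟩

-- A vertex that can come next in `D` is a source of the component in `D`, and sources are unique.
omit hB in
theorem _root_.Digraph.ext_snoc_unique (hx : MaxLabel n B π x) (hy : y ∈ comp n B π x)
    (hz : z ∈ comp n B π x) (h1 : B.Ext (π ++ [y]) D) (h2 : B.Ext (π ++ [z]) D) : y = z := by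
  have hsrc : ∀ w, B.Ext (π ++ [w]) D → ∀ u ∈ comp n B π x, ¬ D.Adj u w := fun w hw u hu h =>
    (comp_maxLabel hx hu).notMem ((ext_snoc.1 hw).2 u h)
  refine source_unique h1.amo.moral hy (hsrc y h1) (hsrc z h2) ?_
  have h3 := (linkedWithin_symm (comp_connected hy)).trans (comp_connected hz)
  exact ReflTransGen.mono (fun a b h => ⟨(h1.amo.skeleton a b).2 h.1, h.2⟩) _ _ h3

/-- An unvisited parent `u` of `x` in `D` would have maximum label. As `x` is ready and no
undirected edge is available, `B` has `x → u`, which makes a cycle in `D`. -/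
theorem ext_snoc_of_no_undir (hD : B.Ext π D) (hx : MaxLabel n B π x) (hr : B.Ready π x)
    (h : ∀ w, MaxLabel n B π w → ¬ B.Undir x w) : B.Ext (π ++ [x]) D := by
  refine ext_snoc.2 ⟨hD, fun u hu => ?_⟩
  by_contra hc
  have h1 := hB.maxLabel_of_parent hD hu hx hc
  have h2 : B.Linked u x := (hD.amo.skeleton _ _).1 (Or.inl hu)
  have h3 : ¬ B.Arc u x := fun h3 => hc (hr u h3)
  have h4 : B.Adj x u := by
    by_contra h4
    exact h3 ⟨h2.resolve_right h4, h4⟩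
  have h5 : ¬ B.Adj u x := fun h5 => h u h1 ⟨h4, h5⟩
  exact hD.amo.acyclic x (.tail (.single (hD.amo.arcs _ _ ⟨h4, h5⟩)) hu)

/-- Take a source `z` among the vertices of maximum label joined to `x` by undirected edges. An
unvisited `u → z` is linked to `x` by rule 1; it is not directed into the ready `x`, rule 2 excludes
`x → u`, and so `x - u` contradicts the choice of `z`. -/
theorem exists_ready_of_undir (hcl : ∀ p ∈ π, ∀ u, B.Arc u p → u ∈ π)
    (hr : B.Ready π x) {w : ℕ} (hw : MaxLabel n B π w)
    (h : B.Undir x w) : ∃ z ∈ comp n B π x, z ≠ x ∧ B.Ready π z := by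
  have hf : {w | MaxLabel n B π w ∧ B.Undir x w}.Finite :=
    (Set.finite_lt_nat n).subset fun w h => h.1.lt
  obtain ⟨z, ⟨hz, hxz⟩, hmin⟩ := exists_source_of_acyclic hB.acyclic hf ⟨w, hw, h⟩
  refine ⟨z, .single ⟨hxz.1, hz⟩, ?_, fun u hu => ?_⟩
  · rintro rfl
    exact hB.loopless _ hxz.1
  · by_contra hc
    refine hmin u ⟨hB.maxLabel_of_arc hcl hu hz hc, ?_⟩ hu
    have h1 : ¬ B.Arc u x := fun h => hc (hr u h)
    have h2 : B.Linked u x := hB.r1 _ _ _ hu ⟨hxz.2, hxz.1⟩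
    have h3 : B.Adj x u := by
      by_contra h3
      exact h1 ⟨h2.resolve_right h3, h3⟩
    refine ⟨h3, ?_⟩
    by_contra h4
    exact hB.r2 _ _ _ ⟨h3, h4⟩ hu hxz

end IsBucketOn

/-! ### Orienting along a search order -/

/-- The orientation of `B` along the order `π`. -/
def orient (B : Digraph ℕ) (π : List ℕ) : Digraph ℕ where
  Adj u v := B.Adj u v ∧ π.idxOf u < π.idxOf v

/-- The visited vertices that are connected via unvisited vertices are linked. -/
def CliqueBoundary (B : Digraph ℕ) (π : List ℕ) : Prop :=
  ∀ p ∈ π, ∀ q ∈ π, p ≠ q → ∀ c d, c ∉ π → d ∉ π → B.Linked p c →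
    ReflTransGen (fun a b => B.Linked a b ∧ a ∉ π ∧ b ∉ π) c d → B.Linked d q → B.Linked p q

/-- Let `K` be the unvisited component of `x` and `C` its visited neighbors, a clique by `hI`. Some
vertex of `K` is linked to all of `C` and so has label at least that of `x`, strictly larger if `x`
misses `p ∈ C`. -/
theorem IsBucketOn.linked_of_connected (hB : B.IsBucketOn n) (hD : B.IsAMO D) (hπ : MCS n B π)
    (hx : MaxLabel n B π x) (hI : CliqueBoundary B π) {p c : ℕ} (hp : p ∈ π)
    (hpc : B.Linked p c) (h : ReflTransGen (fun a b => B.Linked a b ∧ a ∉ π ∧ b ∉ π) x c) :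
    B.Linked p x := by
  by_contra hpx
  set r : ℕ → ℕ → Prop := fun a b => B.Linked a b ∧ a ∉ π ∧ b ∉ π with hr
  have hsymm : ∀ a b, ReflTransGen r a b → ReflTransGen r b a := by
    intro a b h
    induction h with
    | refl => exact .refl
    | tail _ hbc ih => exact .head ⟨hbc.1.symm, hbc.2.2, hbc.2.1⟩ ih
  let K : Set ℕ := {y | ReflTransGen r x y}
  have hK : ∀ y ∈ K, y < n ∧ y ∉ π := by
    intro y hy
    rcases ReflTransGen.cases_tail hy with h | ⟨c, -, hc⟩
    · exact h ▸ ⟨hx.lt, hx.notMem⟩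
    · exact ⟨(hB.linked_lt hc.1).2, hc.2.2⟩
  let C : Set ℕ := {p | p ∈ π ∧ ∃ w ∈ K, B.Linked p w}
  have hlink : ∀ u v, D.Linked u v ↔ B.Linked u v := hD.skeleton
  obtain ⟨q, hqK, hq⟩ := exists_linked_clique (D := D) (R := K) (C := C) (x := x) hD.moral
    hD.acyclic ((Set.finite_lt_nat n).subset fun y hy => (hK y hy).1)
    ((List.finite_toSet π).subset fun c hc => hc.1) (fun c hc hcK => (hK c hcK).2 hc.1) .refl
    (by
      intro y hy
      have : ReflTransGen r x y := hy
      induction this with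
      | refl => exact .refl
      | tail hc hcd ih => exact (ih hc).tail ⟨(hlink _ _).2 hcd.1, hc, hy⟩)
    (by
      rintro a ⟨ha, w, hw, haw⟩ b ⟨hb, w', hw', hbw⟩ hab
      exact (hlink _ _).2 (hI a ha b hb hab w w' (hK w hw).2 (hK w' hw').2 haw
        ((hsymm _ _ hw).trans hw') hbw.symm))
    (fun c ⟨_, w, hw, hcw⟩ => ⟨w, hw, (hlink _ _).2 hcw⟩)
  have hadj : ∀ a ∈ C, B.Adj a q := fun a ha =>
    adj_of_linked hπ.closed ha.1 (hK q hqK).2 ((hlink _ _).1 (hq a ha))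
  have hlt : B.label π x < B.label π q :=
    label_lt_label (fun a ha hax => hadj a ⟨ha, x, .refl, Or.inl hax⟩) hp
      (fun h => hpx (Or.inl h)) (hadj p ⟨hp, c, h, hpc⟩)
  exact absurd (hx.le q (hK q hqK).1 (hK q hqK).2) (not_le.2 hlt)

theorem IsBucketOn.cliqueBoundary (hB : B.IsBucketOn n) (hD : B.IsAMO D) (hπ : MCS n B π) :
    CliqueBoundary B π := by
  induction hπ with
  | nil => intro p hp; simp at hp
  | @snoc π x hπ hx hr ih =>
    have hsub : ∀ c d, ReflTransGen (fun a b => B.Linked a b ∧ a ∉ π ++ [x] ∧ b ∉ π ++ [x]) c d →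
        ReflTransGen (fun a b => B.Linked a b ∧ a ∉ π ∧ b ∉ π) c d := fun c d h =>
      ReflTransGen.mono (fun a b hab => ⟨hab.1, fun h => hab.2.1 (List.mem_append_left _ h),
        fun h => hab.2.2 (List.mem_append_left _ h)⟩) _ _ h
    have hsymm : ∀ a b, ReflTransGen (fun a b => B.Linked a b ∧ a ∉ π ∧ b ∉ π) a b →
        ReflTransGen (fun a b => B.Linked a b ∧ a ∉ π ∧ b ∉ π) b a := by
      intro a b h
      induction h with
      | refl => exact .refl
      | tail _ hbc ih => exact .head ⟨hbc.1.symm, hbc.2.2, hbc.2.1⟩ ih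
    intro p hp q hq hpq c d hc hd hpc hcd hdq
    have hc' : c ∉ π := fun h => hc (List.mem_append_left _ h)
    have hd' : d ∉ π := fun h => hd (List.mem_append_left _ h)
    simp only [List.mem_append, List.mem_singleton] at hp hq
    rcases hp with hp | rfl
    · rcases hq with hq | rfl
      · exact ih p hp q hq hpq c d hc' hd' hpc (hsub _ _ hcd) hdq
      · exact hB.linked_of_connected hD hπ hx ih hp hpc
          (.head ⟨hdq.symm, hx.notMem, hd'⟩ (hsymm _ _ (hsub _ _ hcd)))
    · rcases hq with hq | rfl
      · exact (hB.linked_of_connected hD hπ hx ih hq hdq.symm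
          (.head ⟨hpc, hx.notMem, hc'⟩ (hsub _ _ hcd))).symm
      · exact absurd rfl hpq

theorem MCS.idxOf_lt_of_arc (hπ : MCS n B π) {u v : ℕ} (hv : v ∈ π) (h : B.Arc u v) :
    π.idxOf u < π.idxOf v := by
  have h1 := List.idxOf_lt_length_iff.2 hv
  have h2 := (hπ.getElem h1).2 u (by simpa using h)
  obtain ⟨j, hj, hju⟩ := List.getElem_of_mem h2
  rw [List.getElem_take] at hju
  simp only [List.length_take, lt_min_iff] at hj
  rw [← hju, hπ.nodup.idxOf_getElem]
  exact hj.1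

theorem MCS.adj_of_linked (hπ : MCS n B π) {u v : ℕ} (hu : u ∈ π)
    (hlt : π.idxOf u < π.idxOf v) (h : B.Linked u v) : B.Adj u v := by
  by_contra hc
  have := hπ.idxOf_lt_of_arc hu ⟨h.resolve_left hc, hc⟩
  omega

section Full

variable (hB : B.IsBucketOn n) (hπ : MCS n B π) (hn : π.length = n)
include hB hπ hn

theorem orient_adj_of_ext (hD : B.Ext π D) : D = B.orient π := by
  ext u v
  have hmem : ∀ w, w < n → w ∈ π := fun w hw => hπ.mem_of_length hn hw
  have key : ∀ a b, D.Adj a b → π.idxOf a < π.idxOf b := by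
    intro a b hab
    have hl := hB.linked_lt ((hD.amo.skeleton _ _).1 (Or.inl hab))
    have h1 := List.idxOf_lt_length_iff.2 (hmem b hl.2)
    have h2 := hD.parents _ h1 a (by simpa using hab)
    obtain ⟨j, hj, hju⟩ := List.getElem_of_mem h2
    rw [List.getElem_take] at hju
    simp only [List.length_take, lt_min_iff] at hj
    rw [← hju, hπ.nodup.idxOf_getElem]
    exact hj.1
  constructor
  · intro h
    have hl := (hD.amo.skeleton _ _).1 (Or.inl h)
    exact ⟨hπ.adj_of_linked (hmem u (hB.linked_lt hl).1) (key u v h) hl, key u v h⟩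
  · rintro ⟨h, hlt⟩
    rcases (hD.amo.skeleton u v).2 (Or.inl h) with h1 | h1
    · exact h1
    · have := key v u h1
      omega

theorem isAMO_orient_of_moral
    (hm : ∀ u c v, (B.orient π).Adj u c → (B.orient π).Adj v c → u ≠ v → B.Linked u v) :
    B.Ext π (B.orient π) := by
  have hmem : ∀ w, w < n → w ∈ π := fun w hw => hπ.mem_of_length hn hw
  have hsk : ∀ u v, (B.orient π).Linked u v ↔ B.Linked u v := by
    intro u v
    refine ⟨fun h => h.imp And.left And.left, fun h => ?_⟩
    have hl := hB.linked_lt h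
    rcases lt_trichotomy (π.idxOf u) (π.idxOf v) with h1 | h1 | h1
    · exact Or.inl ⟨hπ.adj_of_linked (hmem u hl.1) h1 h, h1⟩
    · have : u = v := (List.idxOf_inj (hmem u hl.1)).1 h1
      subst this
      exact absurd (or_self_iff.1 h) (hB.loopless u)
    · exact Or.inr ⟨hπ.adj_of_linked (hmem v hl.2) h1 h.symm, h1⟩
  refine ⟨⟨hsk, fun u v h => ⟨h.1, hπ.idxOf_lt_of_arc (hmem v (hB.lt _ _ h.1).2) h⟩, ?_,
    fun u c v hu hv hne => (hsk _ _).2 (hm u c v hu hv hne)⟩, ?_⟩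
  · have key : ∀ a b, TransGen (B.orient π).Adj a b → π.idxOf a < π.idxOf b := by
      intro a b h
      induction h with
      | single h => exact h.2
      | tail _ h ih => exact ih.trans h.2
    exact fun v hv => lt_irrefl _ (key v v hv)
  · intro i hi u hu
    have h1 := hu.2
    rw [hπ.nodup.idxOf_getElem] at h1
    rw [List.mem_take_iff_getElem]
    have h2 : π.idxOf u < π.length := by omega
    exact ⟨π.idxOf u, by omega, by simp⟩

/-- At the moment when `c` is visited, its in-neighbors are visited vertices linked to the unvisited
`c`, so `CliqueBoundary` applies with the trivial path at `c`. -/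
theorem isAMO_orient (hD : B.IsAMO D) : B.Ext π (B.orient π) := by
  refine isAMO_orient_of_moral hB hπ hn fun u c v hu hv hne => ?_
  have hmem : ∀ w, w < n → w ∈ π := fun w hw => hπ.mem_of_length hn hw
  have h1 := List.idxOf_lt_length_iff.2 (hmem c (hB.lt _ _ hu.1).2)
  have hmc := hπ.getElem h1
  have htake : ∀ w, (B.orient π).Adj w c → w ∈ π.take (π.idxOf c) := by
    intro w hw
    rw [List.mem_take_iff_getElem]
    have h2 : π.idxOf w < π.length := hw.2.trans h1
    exact ⟨π.idxOf w, by have := hw.2; omega, by simp⟩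
  have hc : c ∉ π.take (π.idxOf c) := by simpa using hmc.1.notMem
  exact hB.cliqueBoundary hD (hπ.take (π.idxOf c)) u (htake u hu) v (htake v hv) hne c c hc hc
    (Or.inl hu.1) .refl (Or.inr hv.1)

/-- It suffices to compare the in-neighbors of `c` with the latest one, `p`: two others are
in-neighbors of `p` too, and induction on the position applies at `p`. This makes the morality test
linear, with one matrix lookup per edge. -/
theorem orient_moral_of_latest
    (h : ∀ c p, (B.orient π).Adj p c →
      (∀ w, (B.orient π).Adj w c → π.idxOf w ≤ π.idxOf p) →
      ∀ w, (B.orient π).Adj w c → w ≠ p → B.Adj w p) :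
    ∀ u c v, (B.orient π).Adj u c → (B.orient π).Adj v c → u ≠ v → B.Linked u v := by
  have hmem : ∀ w, w < n → w ∈ π := fun w hw => hπ.mem_of_length hn hw
  have key : ∀ k c, π.idxOf c = k → ∀ u v, (B.orient π).Adj u c → (B.orient π).Adj v c → u ≠ v →
      B.Linked u v := by
    intro k
    induction k using Nat.strong_induction_on with
    | _ k ih =>
      intro c hc u v hu hv hne
      have hf : {w | (B.orient π).Adj w c}.Finite :=
        (Set.finite_lt_nat n).subset fun w h => (hB.lt _ _ h.1).1
      obtain ⟨p, hp, hmax⟩ := Set.exists_max_image _ π.idxOf hf ⟨u, hu⟩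
      have hlt : ∀ w, (B.orient π).Adj w c → w ≠ p → (B.orient π).Adj w p := by
        intro w hw hwp
        refine ⟨h c p hp hmax w hw hwp, lt_of_le_of_ne (hmax w hw) fun he => hwp ?_⟩
        exact (List.idxOf_inj (hmem w (hB.lt _ _ hw.1).1)).1 he
      by_cases hup : u = p
      · subst hup
        exact Or.inr (hlt v hv hne.symm).1
      · by_cases hvp : v = p
        · subst hvp
          exact Or.inl (hlt u hu hne).1
        · exact ih (π.idxOf p) (hc ▸ hp.2) p rfl u v (hlt u hu hup) (hlt v hv hvp) hne
  exact fun u c v => key _ c rfl u v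

omit hB hπ hn in
theorem latest_of_orient_moral (hπ : MCS n B π) (hB : B.IsBucketOn n)
    (hn : π.length = n)
    (hm : ∀ u c v, (B.orient π).Adj u c → (B.orient π).Adj v c → u ≠ v → B.Linked u v)
    {c p w : ℕ} (hp : (B.orient π).Adj p c)
    (hmax : ∀ w, (B.orient π).Adj w c → π.idxOf w ≤ π.idxOf p)
    (hw : (B.orient π).Adj w c) (hwp : w ≠ p) : B.Adj w p := by
  have hwπ := hπ.mem_of_length hn (hB.lt _ _ hw.1).1
  refine hπ.adj_of_linked hwπ (lt_of_le_of_ne (hmax w hw) fun he => hwp ?_) (hm w c p hw hp hwp)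
  exact (List.idxOf_inj hwπ).1 he

end Full

end Digraph

namespace RAM

infixr:60 " ;; " => Prog.seq

/-! ### What a program leaves unchanged -/

/-- `p` contains no assignment to register `x`. -/
def Prog.keepsReg (x : ℕ) : Prog → Bool
  | .set y _ => y != x
  | .seq p q => p.keepsReg x && q.keepsReg x
  | .ite _ p q => p.keepsReg x && q.keepsReg x
  | .while _ p => p.keepsReg x
  | _ => true

/-- `p` contains no assignment to array `a`. -/
def Prog.keepsArr (a : ℕ) : Prog → Bool
  | .store b _ _ => b != a
  | .seq p q => p.keepsArr a && q.keepsArr a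
  | .ite _ p q => p.keepsArr a && q.keepsArr a
  | .while _ p => p.keepsArr a
  | _ => true

/-- `p` contains no output instruction. -/
def Prog.silent : Prog → Bool
  | .write _ => false
  | .emit => false
  | .seq p q => p.silent && q.silent
  | .ite _ p q => p.silent && q.silent
  | .while _ p => p.silent
  | _ => true

/-- `p` does not complete an output. -/
def Prog.noEmit : Prog → Bool
  | .emit => false
  | .seq p q => p.noEmit && q.noEmit
  | .ite _ p q => p.noEmit && q.noEmit
  | .while _ p => p.noEmit
  | _ => true

variable {W : ℕ} {p q : Prog} {e : Expr} {s t : State}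

/-- Frame rule with a computable syntactic side condition, so that for concrete programs it is
discharged by `rfl`. -/
theorem Exec.reg_eq {x : ℕ} (h : Exec W p s t) (hp : p.keepsReg x = true) :
    t.reg x = s.reg x := by
  induction h with
  | skip | store | write | emit | while_false => rfl
  | set s y e he =>
    have : x ≠ y := by rintro rfl; simp [Prog.keepsReg] at hp
    exact Function.update_of_ne this _ _
  | seq _ _ ih1 ih2 =>
    simp only [Prog.keepsReg, Bool.and_eq_true] at hp
    rw [ih2 hp.2, ih1 hp.1]
  | ite_true _ _ ih =>
    simp only [Prog.keepsReg, Bool.and_eq_true] at hp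
    exact ih hp.1
  | ite_false _ _ ih =>
    simp only [Prog.keepsReg, Bool.and_eq_true] at hp
    exact ih hp.2
  | while_true _ _ _ ih1 ih2 => exact (ih2 hp).trans (ih1 hp)

theorem Exec.arr_eq {a : ℕ} (h : Exec W p s t) (hp : p.keepsArr a = true) :
    t.arr a = s.arr a := by
  induction h with
  | skip | set | write | emit | while_false => rfl
  | store s b i e he =>
    have : a ≠ b := by rintro rfl; simp [Prog.keepsArr] at hp
    exact Function.update_of_ne this _ _
  | seq _ _ ih1 ih2 =>
    simp only [Prog.keepsArr, Bool.and_eq_true] at hp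
    rw [ih2 hp.2, ih1 hp.1]
  | ite_true _ _ ih =>
    simp only [Prog.keepsArr, Bool.and_eq_true] at hp
    exact ih hp.1
  | ite_false _ _ ih =>
    simp only [Prog.keepsArr, Bool.and_eq_true] at hp
    exact ih hp.2
  | while_true _ _ _ ih1 ih2 => exact (ih2 hp).trans (ih1 hp)

theorem Exec.log_eq (h : Exec W p s t) (hp : p.noEmit = true) : t.log = s.log := by
  induction h with
  | skip | set | store | write | while_false => rfl
  | emit => simp [Prog.noEmit] at hp
  | seq _ _ ih1 ih2 =>
    simp only [Prog.noEmit, Bool.and_eq_true] at hp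
    rw [ih2 hp.2, ih1 hp.1]
  | ite_true _ _ ih =>
    simp only [Prog.noEmit, Bool.and_eq_true] at hp
    exact ih hp.1
  | ite_false _ _ ih =>
    simp only [Prog.noEmit, Bool.and_eq_true] at hp
    exact ih hp.2
  | while_true _ _ _ ih1 ih2 => exact (ih2 hp).trans (ih1 hp)

theorem Exec.cur_eq (h : Exec W p s t) (hp : p.silent = true) : t.cur = s.cur := by
  induction h with
  | skip | set | store | while_false => rfl
  | emit => simp [Prog.silent] at hp
  | write => simp [Prog.silent] at hp
  | seq _ _ ih1 ih2 =>
    simp only [Prog.silent, Bool.and_eq_true] at hp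
    rw [ih2 hp.2, ih1 hp.1]
  | ite_true _ _ ih =>
    simp only [Prog.silent, Bool.and_eq_true] at hp
    exact ih hp.1
  | ite_false _ _ ih =>
    simp only [Prog.silent, Bool.and_eq_true] at hp
    exact ih hp.2
  | while_true _ _ _ ih1 ih2 => exact (ih2 hp).trans (ih1 hp)

/-! ### Total correctness -/

/-- Started in `s`, the program `p` halts in a state that satisfies `Q`. -/
def Runs (W : ℕ) (p : Prog) (s : State) (Q : State → Prop) : Prop := ∃ t, Exec W p s t ∧ Q t

variable {Q R : State → Prop}

theorem Runs.mono (h : Runs W p s Q) (hQ : ∀ t, Exec W p s t → Q t → R t) : Runs W p s R := by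
  obtain ⟨t, ht, hq⟩ := h
  exact ⟨t, ht, hQ t ht hq⟩

/-- This and the following rules are equivalences so that, as simp rules, they compute weakest
preconditions of straight-line programs. -/
theorem runs_skip : Runs W .skip s Q ↔ Q (s.tick 1) :=
  ⟨fun ⟨_, h, hq⟩ => by cases h; exact hq, fun h => ⟨_, .skip s, h⟩⟩

theorem runs_set {x : ℕ} :
    Runs W (.set x e) s Q ↔ e.eval s ≤ W ∧ Q ((s.setReg x (e.eval s)).tick (e.cost + 1)) :=
  ⟨fun ⟨_, h, hq⟩ => by cases h; exact ⟨by assumption, hq⟩, fun h => ⟨_, .set s x e h.1, h.2⟩⟩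

theorem runs_store {a : ℕ} {i : Expr} : Runs W (.store a i e) s Q ↔
    i.eval s ≤ W ∧ e.eval s ≤ W ∧
      Q ((s.setArr a (i.eval s) (e.eval s)).tick (i.cost + e.cost + 1)) :=
  ⟨fun ⟨_, h, hq⟩ => by cases h; exact ⟨by assumption, by assumption, hq⟩,
    fun h => ⟨_, .store s a i e h.1 h.2.1, h.2.2⟩⟩

theorem runs_write :
    Runs W (.write e) s Q ↔ e.eval s ≤ W ∧ Q ((s.write (e.eval s)).tick (e.cost + 1)) :=
  ⟨fun ⟨_, h, hq⟩ => by cases h; exact ⟨by assumption, hq⟩, fun h => ⟨_, .write s e h.1, h.2⟩⟩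

theorem runs_emit : Runs W .emit s Q ↔ Q (s.tick 1).emit :=
  ⟨fun ⟨_, h, hq⟩ => by cases h; exact hq, fun h => ⟨_, .emit s, h⟩⟩

theorem runs_seq : Runs W (p ;; q) s Q ↔ Runs W p s fun t => Runs W q t Q := by
  constructor
  · rintro ⟨_, h, hq⟩
    cases h with
    | seq h1 h2 => exact ⟨_, h1, _, h2, hq⟩
  · rintro ⟨t, h1, u, h2, hq⟩
    exact ⟨u, .seq h1 h2, hq⟩

theorem runs_ite : Runs W (.ite e p q) s Q ↔
    (e.eval s ≠ 0 → Runs W p (s.tick (e.cost + 1)) Q) ∧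
    (e.eval s = 0 → Runs W q (s.tick (e.cost + 1)) Q) := by
  constructor
  · rintro ⟨_, h, hq⟩
    cases h with
    | ite_true he h => exact ⟨fun _ => ⟨_, h, hq⟩, fun h' => absurd h' he⟩
    | ite_false he h => exact ⟨fun h' => absurd he h', fun _ => ⟨_, h, hq⟩⟩
  · rintro ⟨h1, h2⟩
    by_cases he : e.eval s = 0
    · obtain ⟨t, h, hq⟩ := h2 he
      exact ⟨t, .ite_false he h, hq⟩
    · obtain ⟨t, h, hq⟩ := h1 he
      exact ⟨t, .ite_true he h, hq⟩

theorem Runs.seq {Q' : State → Prop} (h1 : Runs W p s Q')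
    (h2 : ∀ t, Exec W p s t → Q' t → Runs W q t Q) : Runs W (p ;; q) s Q :=
  runs_seq.2 (h1.mono h2)

/-- Rule for loops with a measure `k` that decreases. -/
theorem Runs.while_measure {I : ℕ → State → Prop} {k : ℕ} (h0 : I k s)
    (hI : ∀ k s, I k s → (e.eval s = 0 ∧ Q (s.tick (e.cost + 1))) ∨
      (e.eval s ≠ 0 ∧ Runs W p (s.tick (e.cost + 1)) fun t => ∃ k' < k, I k' t)) :
    Runs W (.while e p) s Q := by
  induction k using Nat.strong_induction_on generalizing s with
  | _ k ih =>
    rcases hI k s h0 with ⟨he, hQ⟩ | ⟨he, t, ht, k', hk', h⟩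
    · exact ⟨_, .while_false he, hQ⟩
    · obtain ⟨u, hu, hQ⟩ := ih k' hk' h
      exact ⟨u, .while_true he ht hu, hQ⟩

/-- Rule for loops that run `N` times. -/
theorem Runs.while_count {I : ℕ → State → Prop} (N : ℕ) (h0 : I 0 s)
    (hI : ∀ i < N, ∀ s, I i s → e.eval s ≠ 0 ∧ Runs W p (s.tick (e.cost + 1)) (I (i + 1)))
    (hN : ∀ s, I N s → e.eval s = 0 ∧ Q (s.tick (e.cost + 1))) :
    Runs W (.while e p) s Q := by
  refine Runs.while_measure (I := fun k s => ∃ i, i + k = N ∧ I i s) (k := N) ⟨0, by simp, h0⟩ ?_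
  rintro k s ⟨i, hik, h⟩
  rcases Nat.eq_zero_or_pos k with rfl | hk
  · obtain rfl : i = N := by omega
    exact Or.inl (hN s h)
  · obtain ⟨he, hr⟩ := hI i (by omega) s h
    exact Or.inr ⟨he, hr.mono fun t _ ht => ⟨k - 1, by omega, i + 1, by omega, ht⟩⟩

/-- `for x in 0, …, b - 1 do p` -/
def rangeLoop (x : ℕ) (b : Expr) (p : Prog) : Prog :=
  .set x (.const 0) ;; .while (.lt (.reg x) b) (p ;; .set x (.add (.reg x) (.const 1)))

/-- The invariant `A` does not see the clock, since time is added up separately through `K`. Because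
`A` may depend on registers, `hA` asks that it tolerates changes of the loop counter. A pass costs
`b.cost + 3` for the test and `4` for the increment. -/
theorem Runs.range_loop {A : ℕ → (ℕ → ℕ) → (ℕ → ℕ → ℕ) → List ℕ → Prop} {x : ℕ} {b : Expr}
    (N : ℕ) (K : ℕ → ℕ) (hp : p.keepsReg x = true) (hN : N ≤ W)
    (hA : ∀ i r a c v, A i r a c → A i (Function.update r x v) a c)
    (hb : ∀ i s, A i s.reg s.arr s.cur → b.eval s = N)
    (h0 : A 0 s.reg s.arr s.cur)
    (hI : ∀ i < N, ∀ s, s.reg x = i → A i s.reg s.arr s.cur → Runs W p s fun t =>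
      t.clock ≤ s.clock + K i ∧ A (i + 1) t.reg t.arr t.cur) :
    Runs W (rangeLoop x b p) s fun t =>
      t.clock ≤ s.clock + (∑ i ∈ Finset.range N, K i) + N * (b.cost + 7) + b.cost + 5 ∧
      A N t.reg t.arr t.cur := by
  refine runs_seq.2 (runs_set.2 ⟨Nat.zero_le _, ?_⟩)
  refine Runs.while_count (I := fun i t => t.reg x = i ∧ A i t.reg t.arr t.cur ∧
    t.clock ≤ s.clock + (∑ j ∈ Finset.range i, K j) + i * (b.cost + 7) + 2) N ?_ ?_ ?_
  · exact ⟨by simp [State.setReg, State.tick, Expr.eval], hA _ _ _ _ _ h0,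
      by simp [State.setReg, State.tick, Expr.cost]⟩
  · rintro i hi t ⟨hx, hAi, hc⟩
    have hbt : b.eval t = N := hb i t hAi
    refine ⟨by simp [Expr.eval, hx, hbt, hi], runs_seq.2 ?_⟩
    refine (hI i hi (t.tick _) hx hAi).mono ?_
    rintro u hu ⟨hcu, hAu⟩
    have hxu : u.reg x = i := (hu.reg_eq hp).trans hx
    refine runs_set.2 ⟨by simp only [Expr.eval, hxu]; omega, ?_, hA _ _ _ _ _ hAu, ?_⟩
    · simp [State.setReg, State.tick, Expr.eval, hxu]
    · simp only [State.setReg, State.tick, Expr.cost] at hcu ⊢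
      rw [Finset.sum_range_succ]
      ring_nf at hcu hc ⊢
      omega
  · rintro t ⟨hx, hAN, hc⟩
    have hbt : b.eval t = N := hb N t hAN
    refine ⟨by simp [Expr.eval, hx, hbt], ?_, hAN⟩
    simp only [State.tick, Expr.cost]
    ring_nf at hc ⊢
    omega

theorem Runs.range_loop_const {A : ℕ → (ℕ → ℕ) → (ℕ → ℕ → ℕ) → List ℕ → Prop} {x : ℕ} {b : Expr}
    (N K : ℕ) (hp : p.keepsReg x = true) (hN : N ≤ W)
    (hA : ∀ i r a c v, A i r a c → A i (Function.update r x v) a c)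
    (hb : ∀ i s, A i s.reg s.arr s.cur → b.eval s = N)
    (h0 : A 0 s.reg s.arr s.cur)
    (hI : ∀ i < N, ∀ s, s.reg x = i → A i s.reg s.arr s.cur → Runs W p s fun t =>
      t.clock ≤ s.clock + K ∧ A (i + 1) t.reg t.arr t.cur) :
    Runs W (rangeLoop x b p) s fun t =>
      t.clock ≤ s.clock + N * (K + b.cost + 7) + b.cost + 5 ∧ A N t.reg t.arr t.cur := by
  refine (Runs.range_loop N (fun _ => K) hp hN hA hb h0 hI).mono ?_
  rintro t - ⟨h, hAt⟩
  refine ⟨h.trans (le_of_eq ?_), hAt⟩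
  simp only [Finset.sum_const, Finset.card_range, smul_eq_mul]
  ring

/-- For every pair of words of the input behind its first word, run `p` with the pair in the
registers `2` and `3`. -/
def pairLoop (p : Prog) : Prog :=
  .set 1 (.const 1) ;; .while (.lt (.reg 1) (.reg 0))
    (.set 2 (.get 0 (.reg 1)) ;; .set 3 (.get 0 (.add (.reg 1) (.const 1))) ;; p ;;
      .set 1 (.add (.reg 1) (.const 2)))

/-- The array `a` holds the list of pairs `L` behind its first word. -/
def HoldsPairs (L : List (ℕ × ℕ)) (a : ℕ → ℕ) : Prop :=
  ∀ i, ∀ h : i < L.length, a (1 + 2 * i) = L[i].1 ∧ a (1 + 2 * i + 1) = L[i].2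

/-- The summand `16` pays for the test, the loading of a pair and the advance of the input position
in one pass. -/
theorem Runs.pair_loop {A : ℕ → (ℕ → ℕ) → (ℕ → ℕ → ℕ) → List ℕ → Prop} {L : List (ℕ × ℕ)}
    (K : ℕ) (hp : p.keepsReg 0 = true) (hp1 : p.keepsReg 1 = true) (hp0 : p.keepsArr 0 = true)
    (hlen : s.reg 0 = 1 + 2 * L.length) (hL : HoldsPairs L (s.arr 0))
    (hW : 1 + 2 * L.length ≤ W) (hLW : ∀ e ∈ L, e.1 ≤ W ∧ e.2 ≤ W)
    (hA : ∀ i r a c x v, x = 1 ∨ x = 2 ∨ x = 3 → A i r a c → A i (Function.update r x v) a c)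
    (h0 : A 0 s.reg s.arr s.cur)
    (hI : ∀ i, ∀ h : i < L.length, ∀ s, s.reg 2 = L[i].1 → s.reg 3 = L[i].2 →
      A i s.reg s.arr s.cur → Runs W p s fun t =>
        t.clock ≤ s.clock + K ∧ A (i + 1) t.reg t.arr t.cur) :
    Runs W (pairLoop p) s fun t =>
      t.clock ≤ s.clock + L.length * (K + 16) + 10 ∧ A L.length t.reg t.arr t.cur := by
  refine runs_seq.2 (runs_set.2 ⟨by simp only [Expr.eval]; omega, ?_⟩)
  refine Runs.while_count (I := fun i t => t.reg 1 = 1 + 2 * i ∧ t.reg 0 = s.reg 0 ∧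
    t.arr 0 = s.arr 0 ∧ A i t.reg t.arr t.cur ∧ t.clock ≤ s.clock + i * (K + 16) + 2) L.length
    ?_ ?_ ?_
  · exact ⟨by simp [State.setReg, State.tick, Expr.eval],
      by simp [State.setReg, State.tick], rfl, hA _ _ _ _ _ _ (Or.inl rfl) h0,
      by simp [State.setReg, State.tick, Expr.cost]⟩
  · rintro i hi t ⟨h1, hr0, ha0, hAi, hc⟩
    have hLi := hLW _ (List.getElem_mem hi)
    have hi1 : t.arr 0 (1 + 2 * i) = L[i].1 := by rw [ha0]; exact (hL i hi).1
    have hi2 : t.arr 0 (1 + 2 * i + 1) = L[i].2 := by rw [ha0]; exact (hL i hi).2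
    refine ⟨by simp [Expr.eval, h1, hr0, hlen, hi], ?_⟩
    rw [runs_seq, runs_set]
    refine ⟨by simp [Expr.eval, State.tick, h1, hi1, hLi.1], ?_⟩
    rw [runs_seq, runs_set]
    refine ⟨by simp [Expr.eval, State.tick, State.setReg, h1, hi2, hLi.2], ?_⟩
    rw [runs_seq]
    refine (hI i hi _ ?_ ?_ ?_).mono ?_
    · simp [Expr.eval, State.tick, State.setReg, h1, hi1]
    · simp [Expr.eval, State.tick, State.setReg, h1, hi2]
    · exact hA _ _ _ _ _ _ (by simp) (hA _ _ _ _ _ _ (by simp) hAi)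
    rintro u hu ⟨hcu, hAu⟩
    have hu1 := (hu.reg_eq hp1)
    have hu0 := (hu.reg_eq hp)
    simp [State.tick, State.setReg] at hu1 hu0
    refine runs_set.2 ⟨?_, ?_, ?_, ?_, hA _ _ _ _ _ _ (Or.inl rfl) hAu, ?_⟩
    · simp only [Expr.eval, hu1, h1]; omega
    · simp only [State.setReg, State.tick, Expr.eval, hu1, h1, Function.update_self]; omega
    · simpa [State.setReg, State.tick, hr0] using hu0
    · exact (hu.arr_eq hp0).trans ha0
    · simp only [State.setReg, State.tick, Expr.cost] at hcu ⊢
      ring_nf at hcu hc ⊢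
      omega
  · rintro t ⟨h1, hr0, ha0, hAN, hc⟩
    refine ⟨by simp [Expr.eval, h1, hr0, hlen], ?_, hAN⟩
    simp only [State.tick, Expr.cost]
    ring_nf at hc ⊢
    omega

end RAM

namespace RAM

attribute [simp] Expr.eval Expr.cost runs_skip runs_set runs_store runs_write runs_emit runs_seq
  runs_ite

section Projections

variable (s : State) (k x v a i : ℕ)

@[simp] theorem tick_reg : (s.tick k).reg = s.reg := rfl
@[simp] theorem tick_arr : (s.tick k).arr = s.arr := rfl
@[simp] theorem tick_cur : (s.tick k).cur = s.cur := rfl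
@[simp] theorem tick_log : (s.tick k).log = s.log := rfl
@[simp] theorem tick_clock : (s.tick k).clock = s.clock + k := rfl
@[simp] theorem setReg_reg : (s.setReg x v).reg = Function.update s.reg x v := rfl
@[simp] theorem setReg_arr : (s.setReg x v).arr = s.arr := rfl
@[simp] theorem setReg_clock : (s.setReg x v).clock = s.clock := rfl
@[simp] theorem setArr_reg : (s.setArr a i v).reg = s.reg := rfl
@[simp] theorem setArr_arr :
    (s.setArr a i v).arr = Function.update s.arr a (Function.update (s.arr a) i v) := rfl
@[simp] theorem setArr_clock : (s.setArr a i v).clock = s.clock := rfl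
@[simp] theorem write_reg : (s.write v).reg = s.reg := rfl
@[simp] theorem write_arr : (s.write v).arr = s.arr := rfl
@[simp] theorem write_cur : (s.write v).cur = s.cur ++ [v] := rfl
@[simp] theorem write_clock : (s.write v).clock = s.clock := rfl
@[simp] theorem emit_log : s.emit.log = s.log ++ [(s.cur, s.clock)] := rfl

end Projections

/-! ### The enumeration program

Registers: `0` length of the input, `1` input position, `2`, `3` the current input pair, `4` number
of vertices, `5` loop counter, `6` current vertex, `7` number of visited vertices, `8` whether the
current vertex has an undirected edge to an unvisited vertex of the same label, `9` position in a
neighbor list, `10` current neighbor, `11` upper bound on the labels, `12` branching level, `13`,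
`17` temporary, `14`, `15` ends of the queue, `16` whether the first orientation is not moral.

Arrays: `0` input, `1` row offsets `u * n`, `2` adjacency matrix, `3`, `4` lists of out-neighbors and
their lengths, `5` numbers of directed in-neighbors, `6` numbers of unvisited directed in-neighbors,
`7` labels, `8` positions in the order (plus `1`) of the visited vertices, `9` the order, `10`, `11`
stacks of ready vertices by label and their sizes, `12` whether the alternatives of a level are still
to be collected, `13`, `14` stacks of alternatives by level and their sizes, `15`, `16` marks and
queue of a graph search, `17` the position of the last neighbor that comes before a vertex. -/

/-- For all out-neighbors of the vertex in register `6`, run `p` with the neighbor in register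
`10`. -/
def neighborLoop (p : Prog) : Prog :=
  rangeLoop 9 (.get 4 (.reg 6)) (.set 10 (.get 3 (.add (.get 1 (.reg 6)) (.reg 9))) ;; p)

/-- There is no multiplication, so `u * n` is accumulated in register 17. The same offsets later
serve as row starts for labels and for levels. -/
def setOffsets : Prog :=
  .set 4 (.get 0 (.const 0)) ;; .set 17 (.const 0) ;;
  rangeLoop 5 (.reg 4)
    (.store 1 (.reg 5) (.reg 17) ;; .set 17 (.add (.reg 17) (.reg 4)))

def insertPair : Prog :=
  .store 3 (.add (.get 1 (.reg 2)) (.get 4 (.reg 2))) (.reg 3) ;;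
  .store 4 (.reg 2) (.add (.get 4 (.reg 2)) (.const 1)) ;;
  .store 2 (.add (.get 1 (.reg 2)) (.reg 3)) (.const 1)

def countArc : Prog :=
  .ite (.get 2 (.add (.get 1 (.reg 3)) (.reg 2))) .skip
    (.store 5 (.reg 3) (.add (.get 5 (.reg 3)) (.const 1)))

/-- Build the representation of the graph. -/
def setup : Prog := setOffsets ;; pairLoop insertPair ;; pairLoop countArc

/-- The order (array 9) and the alternatives of the levels (arrays 12 to 14) must survive a restart.
Old contents of the stacks and the queue are harmless because their sizes or ends are reset. -/
def clearVertex : Prog :=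
  .store 6 (.reg 5) (.get 5 (.reg 5)) ;; .store 7 (.reg 5) (.const 0) ;;
  .store 8 (.reg 5) (.const 0) ;; .store 11 (.reg 5) (.const 0) ;;
  .store 15 (.reg 5) (.const 0) ;; .store 17 (.reg 5) (.const 0)

def pushInitial : Prog :=
  .ite (.get 6 (.reg 5)) .skip
    (.store 10 (.get 11 (.const 0)) (.reg 5) ;;
     .store 11 (.const 0) (.add (.get 11 (.const 0)) (.const 1)))

/-- Start a search. -/
def reset : Prog :=
  rangeLoop 5 (.reg 4) clearVertex ;; rangeLoop 5 (.reg 4) pushInitial ;;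
  .set 7 (.const 0) ;; .set 11 (.const 0)

/-- Labels are compared before the increment, and the label of the current vertex stays fixed
because that vertex is already marked as visited. A ready vertex is pushed anew whenever its label
rises; the old copies stay behind as stale entries. -/
def updateNeighbor : Prog :=
  .ite (.get 8 (.reg 10)) .skip
    ((.ite (.get 2 (.add (.get 1 (.reg 10)) (.reg 6)))
      (.ite (.eq (.get 7 (.reg 10)) (.get 7 (.reg 6))) (.set 8 (.const 1)) .skip)
      (.store 6 (.reg 10) (.sub (.get 6 (.reg 10)) (.const 1)))) ;;
    .store 7 (.reg 10) (.add (.get 7 (.reg 10)) (.const 1)) ;;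
    .ite (.get 6 (.reg 10)) .skip
      (.store 10 (.add (.get 1 (.get 7 (.reg 10))) (.get 11 (.get 7 (.reg 10)))) (.reg 10) ;;
       .store 11 (.get 7 (.reg 10)) (.add (.get 11 (.get 7 (.reg 10))) (.const 1))))

/-- Visit the vertex in register `6`. -/
def visit : Prog :=
  .store 9 (.reg 7) (.reg 6) ;; .set 7 (.add (.reg 7) (.const 1)) ;;
  .store 8 (.reg 6) (.reg 7) ;; .set 8 (.const 0) ;; neighborLoop updateNeighbor ;;
  .set 11 (.add (.reg 11) (.const 1))

def popTop : Prog :=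
  .store 11 (.reg 11) (.sub (.get 11 (.reg 11)) (.const 1)) ;;
  .set 6 (.get 10 (.add (.get 1 (.reg 11)) (.get 11 (.reg 11))))

/-- Only freely chosen vertices initialize the data of their level. Plain `visit`, used in `replay`
and `branch`, leaves the data of the earlier levels alone. -/
def visitFree : Prog :=
  visit ;; .store 12 (.sub (.reg 7) (.const 1)) (.reg 8) ;;
  .store 14 (.sub (.reg 7) (.const 1)) (.const 0)

/-- Complete the search. -/
def descend : Prog :=
  .while (.lt (.reg 7) (.reg 4))
    (.ite (.get 11 (.reg 11))
      (popTop ;;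
       .ite (.get 8 (.reg 6)) .skip (.ite (.eq (.get 7 (.reg 6)) (.reg 11)) visitFree .skip))
      (.set 11 (.sub (.reg 11) (.const 1))))

/-- Repeat the search up to the branching level. -/
def replay : Prog :=
  .while (.lt (.reg 7) (.reg 12)) (.set 6 (.get 9 (.reg 7)) ;; visit)

def enqueueNeighbor : Prog :=
  .ite (.get 8 (.reg 10)) .skip
    (.ite (.eq (.get 7 (.reg 10)) (.get 7 (.reg 13)))
      (.ite (.get 15 (.reg 10)) .skip
        (.store 15 (.reg 10) (.const 1) ;; .store 16 (.reg 15) (.reg 10) ;;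
         .set 15 (.add (.reg 15) (.const 1))))
      .skip)

def pushAlternative : Prog :=
  .ite (.get 6 (.reg 6)) .skip
    (.ite (.eq (.reg 6) (.reg 13)) .skip
      (.store 13 (.add (.get 1 (.reg 12)) (.get 14 (.reg 12))) (.reg 6) ;;
       .store 14 (.reg 12) (.add (.get 14 (.reg 12)) (.const 1))))

/-- Collect the alternatives at the branching level. -/
def collect : Prog :=
  .set 13 (.get 9 (.reg 12)) ;; .store 16 (.const 0) (.reg 13) ;;
  .store 15 (.reg 13) (.const 1) ;; .set 14 (.const 0) ;; .set 15 (.const 1) ;;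
  .store 14 (.reg 12) (.const 0) ;; .store 12 (.reg 12) (.const 0) ;;
  .while (.lt (.reg 14) (.reg 15))
    (.set 6 (.get 16 (.reg 14)) ;; .set 14 (.add (.reg 14) (.const 1)) ;; pushAlternative ;;
     neighborLoop enqueueNeighbor)

/-- Take the next alternative at the branching level. -/
def branch : Prog :=
  .ite (.get 12 (.reg 12)) collect .skip ;;
  .store 14 (.reg 12) (.sub (.get 14 (.reg 12)) (.const 1)) ;;
  .set 6 (.get 13 (.add (.get 1 (.reg 12)) (.get 14 (.reg 12)))) ;; visit

/-- Find the last level with alternatives, if there is one. -/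
def findLevel : Prog :=
  .set 12 (.reg 4) ;; .set 13 (.const 0) ;;
  -- As comparisons have the values 0 and 1, this says that register 13 is 0 and register 12 is
  -- positive.
  .while (.lt (.reg 13) (.lt (.const 0) (.reg 12)))
    (.set 12 (.sub (.reg 12) (.const 1)) ;;
     .ite (.get 12 (.reg 12)) (.set 13 (.const 1))
       (.ite (.get 14 (.reg 12)) (.set 13 (.const 1)) .skip))

def writePair : Prog :=
  .ite (.lt (.get 8 (.reg 2)) (.get 8 (.reg 3))) (.write (.reg 2) ;; .write (.reg 3)) .skip

/-- Output the orientation along the order. -/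
def output : Prog := pairLoop writePair ;; .emit

def updateLatest : Prog :=
  .ite (.lt (.get 8 (.reg 2)) (.get 8 (.reg 3)))
    (.ite (.lt (.get 17 (.reg 3)) (.get 8 (.reg 2))) (.store 17 (.reg 3) (.get 8 (.reg 2))) .skip)
    .skip

def testPair : Prog :=
  .ite (.lt (.get 8 (.reg 2)) (.get 8 (.reg 3)))
    (.ite (.eq (.get 17 (.reg 3)) (.get 8 (.reg 2))) .skip
      -- Positions are stored increased by 1, with 0 meaning "none"; hence the subtraction before
      -- the order is read.
      (.ite (.get 2 (.add (.get 1 (.reg 2)) (.get 9 (.sub (.get 17 (.reg 3)) (.const 1))))) .skip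
        (.set 16 (.const 1))))
    .skip

/-- Test whether the orientation along the order is moral. -/
def testMoral : Prog := .set 16 (.const 0) ;; pairLoop updateLatest ;; pairLoop testPair

/-- The program that enumerates the AMOs of a bucket. -/
def enumerate : Prog :=
  setup ;; reset ;; descend ;; testMoral ;;
  .ite (.reg 16) .skip
    (output ;; findLevel ;;
     .while (.reg 13) (reset ;; replay ;; branch ;; descend ;; output ;; findLevel))

/-! ### The representation of the graph -/

/-- The out-neighbors of `u` in the graph with the list of edges `L`. -/
def neighbors (L : List (ℕ × ℕ)) (u : ℕ) : List ℕ :=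
  (L.filter fun e => e.1 = u).map Prod.snd

section Lists

variable {n : ℕ} {L : List (ℕ × ℕ)} {u v : ℕ}

theorem mem_neighbors : v ∈ neighbors L u ↔ (u, v) ∈ L := by
  simp [neighbors]

theorem nodup_neighbors (hL : L.Nodup) (u : ℕ) : (neighbors L u).Nodup := by
  refine (hL.filter _).map_on ?_
  rintro ⟨a, b⟩ hx ⟨c, d⟩ hy h
  simp at hx hy h
  simp [hx.2, hy.2, h]

theorem neighbors_append {L' : List (ℕ × ℕ)} :
    neighbors (L ++ L') u = neighbors L u ++ neighbors L' u := by
  simp [neighbors]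

theorem length_le_of_nodup_of_lt {l : List ℕ} (h : l.Nodup) (hl : ∀ a ∈ l, a < n) :
    l.length ≤ n := by
  rw [← List.toFinset_card_of_nodup h, ← Finset.card_range n]
  exact Finset.card_le_card fun a ha => by simpa using hl a (by simpa using ha)

theorem length_neighbors_le (hL : L.Nodup) (hlt : ∀ e ∈ L, e.1 < n ∧ e.2 < n) :
    (neighbors L u).length ≤ n :=
  length_le_of_nodup_of_lt (nodup_neighbors hL u) fun _ hv => (hlt _ (mem_neighbors.1 hv)).2

theorem sum_length_neighbors (hlt : ∀ e ∈ L, e.1 < n ∧ e.2 < n) :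
    ∑ u ∈ Finset.range n, (neighbors L u).length = L.length := by
  induction L with
  | nil => simp [neighbors]
  | cons e L ih =>
    have h1 : ∀ u, (neighbors (e :: L) u).length =
        (neighbors L u).length + if e.1 = u then 1 else 0 := by
      intro u
      by_cases h : e.1 = u <;> simp [neighbors, h]
    simp only [h1, Finset.sum_add_distrib, ih fun e he => hlt e (List.mem_cons_of_mem _ he)]
    simp [hlt e]

/-- Rows of length `n` do not overlap, so a two-dimensional table can be kept in one array. -/
theorem add_mul_inj {k l t t' : ℕ} (ht : t < n) (ht' : t' < n) (h : k * n + t = l * n + t') :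
    k = l ∧ t = t' := by
  have hn : 0 < n := by omega
  have h1 : (k * n + t) / n = k := by
    rw [add_comm, Nat.add_mul_div_right _ _ hn, Nat.div_eq_of_lt ht, zero_add]
  have h2 : (l * n + t') / n = l := by
    rw [add_comm, Nat.add_mul_div_right _ _ hn, Nat.div_eq_of_lt ht', zero_add]
  have h3 : k = l := by rw [← h1, h, h2]
  subst h3
  exact ⟨rfl, by omega⟩

theorem mul_add_lt {k t : ℕ} (hk : k < n) (ht : t < n) : k * n + t < n * n := by
  have : (k + 1) * n ≤ n * n := Nat.mul_le_mul_right _ hk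
  rw [add_mul] at this
  omega

theorem mul_add_le {k t : ℕ} (hk : k < n) (ht : t ≤ n) : k * n + t ≤ n * n := by
  have : (k + 1) * n ≤ n * n := Nat.mul_le_mul_right _ hk
  rw [add_mul] at this
  omega

end Lists

open Classical in
/-- The number of directed edges from unvisited vertices to `w`. -/
noncomputable def indegree (B : Digraph ℕ) (L : List (ℕ × ℕ)) (π : List ℕ) (w : ℕ) : ℕ :=
  L.countP fun e => e.2 = w ∧ B.Arc e.1 w ∧ e.1 ∉ π

/-- `L` lists the edges of `B`. -/
structure Lists (n : ℕ) (B : Digraph ℕ) (L : List (ℕ × ℕ)) : Prop where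
  nodup : L.Nodup
  adj : ∀ u v, B.Adj u v ↔ (u, v) ∈ L
  lt : ∀ e ∈ L, e.1 < n ∧ e.2 < n

section

variable {n : ℕ} {B : Digraph ℕ} {L : List (ℕ × ℕ)} {π : List ℕ} {u v w x : ℕ}

open Classical in
theorem countP_eq_add_of_nodup {α : Type*} {l : List α} (h : l.Nodup) (a : α)
    (p q : α → Bool) (hpq : ∀ b, q b = true ↔ p b = true ∧ b ≠ a) :
    l.countP p = l.countP q + if a ∈ l ∧ p a = true then 1 else 0 := by
  induction l with
  | nil => simp
  | cons b l ih =>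
    rw [List.nodup_cons] at h
    rw [List.countP_cons, List.countP_cons, ih h.2]
    by_cases hb : b = a
    · subst hb
      have : q b = false := by
        rw [Bool.eq_false_iff]
        intro hq
        exact ((hpq b).1 hq).2 rfl
      simp [this, h.1]
    · have hqb : q b = p b := by
        rw [Bool.eq_iff_iff, hpq]
        simp [hb]
      have hba : a ≠ b := fun h => hb h.symm
      simp only [List.mem_cons, hba, false_or, hqb]
      omega

namespace Lists

variable (hL : Lists n B L)
include hL

open Classical in
theorem indegree_snoc (hx : x ∉ π) (w : ℕ) :
    indegree B L π w = indegree B L (π ++ [x]) w + if B.Arc x w then 1 else 0 := by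
  unfold indegree
  rw [countP_eq_add_of_nodup hL.nodup (x, w) _
    (fun e => decide (e.2 = w ∧ B.Arc e.1 w ∧ e.1 ∉ π ++ [x]))]
  · congr 1
    by_cases hA : B.Arc x w
    · simp [hA, hx, (hL.adj _ _).1 hA.1]
    · simp [hA]
  · rintro ⟨a, b⟩
    simp
    grind

theorem indegree_eq_zero : indegree B L π w = 0 ↔ B.Ready π w := by
  unfold indegree
  rw [List.countP_eq_zero]
  simp only [decide_eq_true_eq]
  constructor
  · intro h u hu
    by_contra hc
    exact h (u, w) ((hL.adj _ _).1 hu.1) ⟨rfl, hu, hc⟩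
  · rintro h ⟨a, b⟩ he ⟨rfl, h1, h2⟩
    exact h2 (h a h1)

omit hL in
theorem _root_.RAM.indegree_le : indegree B L π w ≤ L.length := List.countP_le_length

theorem mem_neighbors : v ∈ neighbors L u ↔ B.Adj u v := by
  rw [RAM.mem_neighbors, hL.adj]

theorem length_neighbors_le : (neighbors L u).length ≤ n :=
  RAM.length_neighbors_le hL.nodup hL.lt

theorem lt_of_adj (h : B.Adj u v) : u < n ∧ v < n := hL.lt _ ((hL.adj _ _).1 h)

end Lists

/-- The arrays hold the representation of the graph. -/
structure GraphMem (n : ℕ) (B : Digraph ℕ) (L : List (ℕ × ℕ)) (a : ℕ → ℕ → ℕ) : Prop where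
  input : HoldsPairs L (a 0)
  offset : ∀ u < n, a 1 u = u * n
  matrix : ∀ u < n, ∀ v < n, a 2 (u * n + v) ≠ 0 ↔ B.Adj u v
  length : ∀ u < n, a 4 u = (neighbors L u).length
  neighbor : ∀ u < n, ∀ k, ∀ h : k < (neighbors L u).length, a 3 (u * n + k) = (neighbors L u)[k]
  indegree : ∀ u < n, a 5 u = indegree B L [] u

theorem GraphMem.congr {a a' : ℕ → ℕ → ℕ} (h : GraphMem n B L a) (h' : ∀ i < 6, a' i = a i) :
    GraphMem n B L a' := by
  constructor
  · rw [h' 0 (by norm_num)]; exact h.input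
  · rw [h' 1 (by norm_num)]; exact h.offset
  · rw [h' 2 (by norm_num)]; exact h.matrix
  · rw [h' 4 (by norm_num)]; exact h.length
  · rw [h' 3 (by norm_num)]; exact h.neighbor
  · rw [h' 5 (by norm_num)]; exact h.indegree

theorem Exec.graphMem {W : ℕ} {p : Prog} {s t : State} (h : Exec W p s t)
    (hs : GraphMem n B L s.arr)
    (hp : (p.keepsArr 0 && p.keepsArr 1 && p.keepsArr 2 && p.keepsArr 3 && p.keepsArr 4 &&
      p.keepsArr 5) = true) : GraphMem n B L t.arr := by
  simp only [Bool.and_eq_true] at hp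
  obtain ⟨⟨⟨⟨⟨h0, h1⟩, h2⟩, h3⟩, h4⟩, h5⟩ := hp
  refine hs.congr fun i hi => ?_
  interval_cases i
  · exact h.arr_eq h0
  · exact h.arr_eq h1
  · exact h.arr_eq h2
  · exact h.arr_eq h3
  · exact h.arr_eq h4
  · exact h.arr_eq h5

/-! ### Stacks of vertices by label -/

/-- The stacks hold ready vertices of at least the label of the stack, and every unvisited ready
vertex is in the stack of its label. -/
structure Buckets (n : ℕ) (lab ind vis stk siz : ℕ → ℕ) : Prop where
  lt : ∀ k < n, ∀ t < siz k, stk (k * n + t) < n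
  le : ∀ k < n, ∀ t < siz k, k ≤ lab (stk (k * n + t))
  ready : ∀ k < n, ∀ t < siz k, vis (stk (k * n + t)) = 0 → ind (stk (k * n + t)) = 0
  inj : ∀ k < n, ∀ t < siz k, ∀ t' < siz k, stk (k * n + t) = stk (k * n + t') → t = t'
  mem : ∀ w < n, vis w = 0 → ind w = 0 → ∃ t < siz (lab w), stk (lab w * n + t) = w

namespace Buckets

variable {lab ind vis stk siz : ℕ → ℕ} (h : Buckets n lab ind vis stk siz)
include h

/-- No vertex occurs twice in a stack, stale or not; so a stack fits into a row of length `n`. -/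
theorem size_le {k : ℕ} (hk : k < n) : siz k ≤ n := by
  have := Finset.card_le_card_of_injOn (s := Finset.range (siz k)) (t := Finset.range n)
    (fun t => stk (k * n + t)) (fun t ht => by simpa using h.lt k hk t (by simpa using ht))
    (fun t ht t' ht' he => h.inj k hk t (by simpa using ht) t' (by simpa using ht') he)
  simpa using this

theorem size_lt {k w : ℕ} (hk : k < n) (hw : w < n) (hne : ∀ t < siz k, stk (k * n + t) ≠ w) :
    siz k < n := by
  have := Finset.card_le_card_of_injOn (s := Finset.range (siz k)) (t := (Finset.range n).erase w)
    (fun t => stk (k * n + t))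
    (fun t ht => by
      have ht' : t < siz k := by simpa using ht
      exact Finset.mem_coe.2 (Finset.mem_erase.2 ⟨hne t ht', Finset.mem_range.2 (h.lt k hk t ht')⟩))
    (fun t ht t' ht' he => h.inj k hk t (by simpa using ht) t' (by simpa using ht') he)
  rw [Finset.card_range, Finset.card_erase_of_mem (by simpa using hw), Finset.card_range] at this
  omega

theorem mono_vis {vis' : ℕ → ℕ} (hv : ∀ w, vis' w = 0 → vis w = 0) :
    Buckets n lab ind vis' stk siz :=
  ⟨h.lt, h.le, fun k hk t ht hv' => h.ready k hk t ht (hv _ hv'), h.inj,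
    fun w hw hv' => h.mem w hw (hv w hv')⟩

/-- Remove the top of the stack `j`, if it is visited or has a higher label. -/
theorem pop {vis' : ℕ → ℕ} {j : ℕ} (hj : 0 < siz j)
    (hv : ∀ w, vis' w = 0 → vis w = 0 ∧ (lab w = j → stk (j * n + (siz j - 1)) ≠ w)) :
    Buckets n lab ind vis' stk (Function.update siz j (siz j - 1)) := by
  have hs : ∀ k t, t < Function.update siz j (siz j - 1) k → t < siz k := by
    intro k t ht
    rw [Function.update_apply] at ht
    split_ifs at ht with hk
    · subst hk; omega
    · exact ht
  refine ⟨fun k hk t ht => h.lt k hk t (hs k t ht), fun k hk t ht => h.le k hk t (hs k t ht),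
    fun k hk t ht hv' => h.ready k hk t (hs k t ht) (hv _ hv').1,
    fun k hk t ht t' ht' => h.inj k hk t (hs k t ht) t' (hs k t' ht'), fun w hw hv' hi => ?_⟩
  obtain ⟨t, ht, htw⟩ := h.mem w hw (hv w hv').1 hi
  refine ⟨t, ?_, htw⟩
  rw [Function.update_apply]
  split_ifs with hk
  · have h1 := (hv w hv').2 hk
    rw [hk] at ht htw
    have : t ≠ siz j - 1 := by
      rintro rfl
      exact h1 htw
    omega
  · exact ht

/-- Raise the label of `w`. -/
theorem raise {w d : ℕ} (hd : d ≤ ind w) (hd0 : d ≠ 0) :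
    Buckets n (Function.update lab w (lab w + 1)) (Function.update ind w d) vis stk siz := by
  refine ⟨h.lt, fun k hk t ht => (h.le k hk t ht).trans ?_, fun k hk t ht hv => ?_, h.inj,
    fun u hu hv hi => ?_⟩
  · rw [Function.update_apply]
    split_ifs with he
    · rw [he]; omega
    · exact le_rfl
  · have h1 := h.ready k hk t ht hv
    rw [Function.update_apply]
    split_ifs with he
    · rw [he] at h1; omega
    · exact h1
  · have hne : u ≠ w := by
      rintro rfl
      rw [Function.update_self] at hi
      exact hd0 hi
    rw [Function.update_of_ne hne] at hi ⊢
    exact h.mem u hu hv hi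

/-- The entries of stack `k` have label at least `k`, so stack `lab w + 1` does not contain `w` and
has room for it. -/
theorem size_raise_lt {w : ℕ} (hw : w < n) (hlw : lab w + 1 < n) : siz (lab w + 1) < n :=
  h.size_lt hlw hw fun t ht he => by
    have := h.le _ hlw t ht
    rw [he] at this
    omega

/-- Raise the label of `w` and push it. -/
theorem raise_push {w : ℕ} (hw : w < n) (hlw : lab w + 1 < n) (hlab : ∀ u < n, vis u = 0 → lab u < n) :
    Buckets n (Function.update lab w (lab w + 1)) (Function.update ind w 0) vis
      (Function.update stk ((lab w + 1) * n + siz (lab w + 1)) w)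
      (Function.update siz (lab w + 1) (siz (lab w + 1) + 1)) := by
  set l := lab w + 1 with hl
  have hsz := h.size_raise_lt hw hlw
  rw [← hl] at hsz
  have hcase : ∀ k < n, ∀ t < Function.update siz l (siz l + 1) k,
      (t < siz k ∧ Function.update stk (l * n + siz l) w (k * n + t) = stk (k * n + t)) ∨
      (k = l ∧ t = siz l ∧ Function.update stk (l * n + siz l) w (k * n + t) = w) := by
    intro k hk t ht
    by_cases hnew : k = l ∧ t = siz l
    · obtain ⟨rfl, rfl⟩ := hnew
      exact Or.inr ⟨rfl, rfl, Function.update_self ..⟩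
    · have ht' : t < siz k := by
        rw [Function.update_apply] at ht
        split_ifs at ht with hkl
        · have : t ≠ siz l := fun h => hnew ⟨hkl, h⟩
          rw [hkl]
          omega
        · exact ht
      refine Or.inl ⟨ht', Function.update_of_ne (fun he => hnew ?_) _ _⟩
      exact add_mul_inj (ht'.trans_le (h.size_le hk)) hsz he
  have hnot : ∀ t < siz l, stk (l * n + t) ≠ w := fun t ht he => by
    have := h.le _ hlw t ht
    rw [he] at this
    omega
  refine ⟨fun k hk t ht => ?_, fun k hk t ht => ?_, fun k hk t ht hv => ?_,
    fun k hk t ht t' ht' he => ?_, fun u hu hv hi => ?_⟩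
  · rcases hcase k hk t ht with ⟨h1, h2⟩ | ⟨-, -, h2⟩
    · rw [h2]; exact h.lt k hk t h1
    · rw [h2]; exact hw
  · rcases hcase k hk t ht with ⟨h1, h2⟩ | ⟨h1, -, h2⟩
    · rw [h2]
      refine (h.le k hk t h1).trans ?_
      rw [Function.update_apply]
      split_ifs with he
      · rw [he]; omega
      · exact le_rfl
    · rw [h2, h1, Function.update_self]
  · rcases hcase k hk t ht with ⟨h1, h2⟩ | ⟨h1, -, h2⟩
    · rw [h2] at hv ⊢
      rw [Function.update_apply]
      split_ifs
      · rfl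
      · exact h.ready k hk t h1 hv
    · rw [h2, Function.update_self]
  · rcases hcase k hk t ht with ⟨h1, h2⟩ | ⟨h1, h1', h2⟩ <;>
    rcases hcase k hk t' ht' with ⟨h3, h4⟩ | ⟨h3, h3', h4⟩ <;> rw [h2, h4] at he
    · exact h.inj k hk t h1 t' h3 he
    · subst h3
      exact absurd he (hnot t h1)
    · subst h1
      exact absurd he.symm (hnot t' h3)
    · rw [h1', h3']
  · rcases eq_or_ne u w with rfl | hne
    · rw [Function.update_self]
      exact ⟨siz l, by rw [Function.update_self]; omega, Function.update_self ..⟩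
    · rw [Function.update_of_ne hne] at hi ⊢
      obtain ⟨t, ht, htu⟩ := h.mem u hu hv hi
      have hlu := hlab u hu hv
      refine ⟨t, ?_, ?_⟩
      · rw [Function.update_apply]
        split_ifs with he
        · rw [he] at ht; omega
        · exact ht
      · rw [Function.update_of_ne, htu]
        intro he
        obtain ⟨h1, h2⟩ := add_mul_inj (ht.trans_le (h.size_le hlu)) hsz he
        rw [h1] at ht
        omega

end Buckets

end

end RAM

/-! ### Visiting a vertex. -/

namespace RAM

theorem runs_updateNeighbor {W w x : ℕ} {s : State} (h10 : s.reg 10 = w) (h6 : s.reg 6 = x)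
    (hw : w ≤ W) (h1 : 1 ≤ W) (hi : s.arr 6 w ≤ W) (hl : s.arr 7 w + 1 ≤ W)
    (ha : s.arr 1 (s.arr 7 w + 1) + s.arr 11 (s.arr 7 w + 1) ≤ W)
    (hs : s.arr 11 (s.arr 7 w + 1) + 1 ≤ W) (hv : s.arr 8 w = 0) :
    Runs W updateNeighbor s fun t => t.clock ≤ s.clock + 64 ∧ ∃ d,
      d = (if s.arr 2 (s.arr 1 w + x) ≠ 0 then s.arr 6 w else s.arr 6 w - 1) ∧
      t.reg 8 = (if s.arr 2 (s.arr 1 w + x) ≠ 0 ∧ s.arr 7 w = s.arr 7 x then 1 else s.reg 8) ∧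
      t.arr 6 = Function.update (s.arr 6) w d ∧
      t.arr 7 = Function.update (s.arr 7) w (s.arr 7 w + 1) ∧
      (d ≠ 0 → t.arr 10 = s.arr 10 ∧ t.arr 11 = s.arr 11) ∧
      (d = 0 → t.arr 10 = Function.update (s.arr 10)
          (s.arr 1 (s.arr 7 w + 1) + s.arr 11 (s.arr 7 w + 1)) w ∧
        t.arr 11 = Function.update (s.arr 11) (s.arr 7 w + 1)
          (s.arr 11 (s.arr 7 w + 1) + 1)) := by
  by_cases hm : s.arr 2 (s.arr 1 w + x) = 0
  · by_cases hd : s.arr 6 w - 1 = 0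
    · simp [updateNeighbor, h10, h6, hv, hm, hd, hw, ha, add_assoc]
      omega
    · simp [updateNeighbor, h10, h6, hv, hm, hd, hw, add_assoc]
      omega
  · by_cases he : s.arr 7 w = s.arr 7 x
    · rw [he] at hl ha hs ⊢
      by_cases hd : s.arr 6 w = 0
      · simp [updateNeighbor, h10, h6, hv, hm, hd, hw, h1, he, ha, add_assoc]
        omega
      · simp [updateNeighbor, h10, h6, hv, hm, hd, hw, h1, he, add_assoc]
        omega
    · by_cases hd : s.arr 6 w = 0
      · simp [updateNeighbor, h10, h6, hv, hm, hd, hw, he, ha, add_assoc]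
        omega
      · simp [updateNeighbor, h10, h6, hv, hm, hd, hw, he, add_assoc]
        omega

variable {n W : ℕ} {B : Digraph ℕ} {L : List (ℕ × ℕ)} {π : List ℕ} {x : ℕ}

/-- The arrays describe a search that has visited `π`. -/
structure SearchMem (n : ℕ) (B : Digraph ℕ) (L : List (ℕ × ℕ)) (π : List ℕ) (a : ℕ → ℕ → ℕ) :
    Prop where
  visited : ∀ w < n, a 8 w = if w ∈ π then π.idxOf w + 1 else 0
  label : ∀ w < n, w ∉ π → a 7 w = B.label π w
  indegree : ∀ w < n, w ∉ π → a 6 w = indegree B L π w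
  order : ∀ i, ∀ h : i < π.length, a 9 i = π[i]

/-- The arrays while `x` is being visited after `π` and `i` neighbors of `x` are updated. -/
structure VisitMem (n : ℕ) (B : Digraph ℕ) (L : List (ℕ × ℕ)) (π : List ℕ) (x : ℕ) (V : ℕ → ℕ)
    (S i f : ℕ) (a : ℕ → ℕ → ℕ) : Prop where
  graph : GraphMem n B L a
  visited : a 8 = V
  label : ∀ w < n, w ∉ π ++ [x] →
    a 7 w = B.label (if w ∈ (neighbors L x).take i then π ++ [x] else π) w
  label_self : a 7 x = B.label π x
  indegree : ∀ w < n, w ∉ π ++ [x] →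
    a 6 w = RAM.indegree B L (if w ∈ (neighbors L x).take i then π ++ [x] else π) w
  buckets : Buckets n (a 7) (a 6) (a 8) (a 10) (a 11)
  flag_le : f ≤ 1
  flag : f ≠ 0 ↔ ∃ w ∈ (neighbors L x).take i, w ∉ π ++ [x] ∧ B.Undir x w ∧
    B.label π w = B.label π x
  size : ∑ k ∈ Finset.range n, a 11 k ≤ S + i

theorem sum_update_succ {siz : ℕ → ℕ} {l : ℕ} (hl : l < n) :
    ∑ k ∈ Finset.range n, Function.update siz l (siz l + 1) k =
      (∑ k ∈ Finset.range n, siz k) + 1 := by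
  rw [Finset.sum_update_of_mem (by simpa using hl),
    ← Finset.sum_sdiff (s₁ := {l}) (s₂ := Finset.range n) (f := siz) (by simpa using hl)]
  simp
  ring

theorem sum_update_pred {siz : ℕ → ℕ} {l : ℕ} (hl : l < n) (h : 0 < siz l) :
    (∑ k ∈ Finset.range n, Function.update siz l (siz l - 1) k) + 1 =
      ∑ k ∈ Finset.range n, siz k := by
  rw [Finset.sum_update_of_mem (by simpa using hl),
    ← Finset.sum_sdiff (s₁ := {l}) (s₂ := Finset.range n) (f := siz) (by simpa using hl)]
  simp
  omega

/-- Labels and in-degrees refer to `π ++ [x]` for the neighbors already treated and to `π` for all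
other vertices. Each pass pushes at most one entry, which is what `size` records for the amortized
bound of the whole search. -/
theorem runs_updateNeighbor_visitMem (hL : Lists n B L) (hB : B.IsBucketOn n)
    (hW : n * n + 2 * L.length + n + 2 ≤ W) (hπ : MCS n B (π ++ [x])) {V : ℕ → ℕ}
    (hV : ∀ w < n, V w = 0 ↔ w ∉ π ++ [x]) {S i : ℕ} (hi : i < (neighbors L x).length) {s : State}
    (h6 : s.reg 6 = x) (h10 : s.reg 10 = (neighbors L x)[i])
    (h : VisitMem n B L π x V S i (s.reg 8) s.arr) :
    Runs W updateNeighbor s fun t => t.clock ≤ s.clock + 64 ∧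
      VisitMem n B L π x V S (i + 1) (t.reg 8) t.arr := by
  obtain ⟨hmcs, hxm, -⟩ := hπ.snoc_inv
  set w := (neighbors L x)[i] with hwdef
  have hxw : B.Adj x w := hL.mem_neighbors.1 (List.getElem_mem hi)
  have hx : x < n := hxm.lt
  have hw : w < n := (hL.lt_of_adj hxw).2
  have htake : ∀ u, u ∈ (neighbors L x).take (i + 1) ↔ u ∈ (neighbors L x).take i ∨ u = w := by
    intro u
    rw [← List.take_concat_get' _ _ hi, List.mem_append, List.mem_singleton]
  -- The neighbor list has no repetitions, so `w` has not been updated yet.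
  have hwt : w ∉ (neighbors L x).take i := by
    intro hc
    obtain ⟨j, hj, hjw⟩ := List.getElem_of_mem hc
    rw [List.getElem_take] at hjw
    simp only [List.length_take, lt_min_iff] at hj
    have := (nodup_neighbors hL.nodup x).getElem_inj_iff.1 (hjw.trans hwdef)
    omega
  have hvw : s.arr 8 w = 0 ↔ w ∉ π ++ [x] := by rw [h.visited]; exact hV w hw
  -- An unvisited vertex and the vertices of `π ++ [x]` are distinct, so even after the pending
  -- increment the label is below `n` and names an existing row.
  have hlabn : ∀ u < n, u ∉ π ++ [x] → s.arr 7 u + (if u ∈ (neighbors L x).take i then 0 else 1) < n := by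
    intro u hu hun
    have h1 : (u :: (π ++ [x])).length ≤ n :=
      length_le_of_nodup_of_lt (List.nodup_cons.2 ⟨hun, hπ.nodup⟩) (by
        intro a ha
        rcases List.mem_cons.1 ha with rfl | ha
        · exact hu
        · exact hπ.lt a ha)
    simp at h1
    rw [h.label u hu hun]
    split_ifs
    · have := label_le_length (B := B) (π := π ++ [x]) (x := u)
      simp at this
      omega
    · have := label_le_length (B := B) (π := π) (x := u)
      omega
  by_cases hwπ : w ∈ π ++ [x]
  · have hv : s.arr 8 w ≠ 0 := fun hc => hvw.1 hc hwπ
    have hstep : VisitMem n B L π x V S (i + 1) (s.reg 8) s.arr := by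
      refine ⟨h.graph, h.visited, fun u hu hun => ?_, h.label_self, fun u hu hun => ?_, h.buckets,
        h.flag_le, ?_, h.size.trans (by omega)⟩
      · rw [h.label u hu hun, if_congr (htake u) rfl rfl]
        have : u ≠ w := fun he => hun (he ▸ hwπ)
        simp [this]
      · rw [h.indegree u hu hun, if_congr (htake u) rfl rfl]
        have : u ≠ w := fun he => hun (he ▸ hwπ)
        simp [this]
      · rw [h.flag]
        constructor
        · rintro ⟨u, hu, h1⟩
          exact ⟨u, (htake u).2 (Or.inl hu), h1⟩
        · rintro ⟨u, hu, h1⟩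
          rcases (htake u).1 hu with h2 | rfl
          · exact ⟨u, h2, h1⟩
          · exact absurd hwπ h1.1
    have hr : Runs W updateNeighbor s fun t =>
        t.clock ≤ s.clock + 64 ∧ t.reg = s.reg ∧ t.arr = s.arr := by
      simp [updateNeighbor, h10, hv, add_assoc]
    refine hr.mono fun t _ ⟨hc, h1, h2⟩ => ⟨hc, ?_⟩
    rw [h1, h2]
    exact hstep
  · have hv := hvw.2 hwπ
    have hlw := hlabn w hw hwπ
    rw [if_neg hwt] at hlw
    have hsz := h.buckets.size_raise_lt hw hlw
    have hoff : s.arr 1 (s.arr 7 w + 1) = (s.arr 7 w + 1) * n := h.graph.offset _ hlw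
    have haddr := mul_add_lt hlw hsz
    have hwt' := h.label w hw hwπ
    have hit' := h.indegree w hw hwπ
    rw [if_neg hwt] at hwt' hit'
    have hile : s.arr 6 w ≤ L.length := by rw [hit']; exact indegree_le
    have hxw' : x ≠ w := by
      rintro he
      exact hB.loopless _ (he ▸ hxw)
    have hoffw : s.arr 1 w = w * n := h.graph.offset w hw
    have hmat := h.graph.matrix w hw x hx
    refine (runs_updateNeighbor h10 h6 (by omega) (by omega) (by omega) (by omega)
      (by omega) (by omega) hv).mono ?_
    rintro t ht ⟨hc, d, hd, h8, ha6, ha7, hd1, hd2⟩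
    rw [hoffw] at hd h8
    have hdind : d = RAM.indegree B L (π ++ [x]) w := by
      have h1 := hL.indegree_snoc hxm.notMem w
      rw [← hit'] at h1
      rw [hd]
      by_cases hA : B.Adj w x
      · rw [if_pos (hmat.2 hA), h1, if_neg fun h : B.Arc x w => h.2 hA]
        rfl
      · rw [if_neg (not_not.2 (by_contra fun hc => hA (hmat.1 hc))), h1, if_pos ⟨hxw, hA⟩]
        rfl
    have ha8 : t.arr 8 = s.arr 8 := ht.arr_eq rfl
    have hg : GraphMem n B L t.arr := ht.graphMem h.graph rfl
    refine ⟨hc, hg, ha8.trans h.visited, fun u hu hun => ?_, ?_, fun u hu hun => ?_, ?_, ?_, ?_, ?_⟩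
    · rw [ha7, if_congr (htake u) rfl rfl]
      rcases eq_or_ne u w with rfl | hne
      · simp [hwt', label_snoc, hxw]
      · rw [Function.update_of_ne hne, h.label u hu hun]
        simp [hne]
    · rw [ha7, Function.update_of_ne hxw', h.label_self]
    · rw [ha6, if_congr (htake u) rfl rfl]
      rcases eq_or_ne u w with rfl | hne
      · simp [hdind]
      · rw [Function.update_of_ne hne, h.indegree u hu hun]
        simp [hne]
    · rw [ha6, ha7, ha8]
      by_cases hd0 : d = 0
      · obtain ⟨h1, h2⟩ := hd2 hd0
        rw [h1, h2, hoff, hd0]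
        refine h.buckets.raise_push hw hlw fun u hu hvu => ?_
        have := hlabn u hu ((hV u hu).1 (by rwa [h.visited] at hvu))
        omega
      · obtain ⟨h1, h2⟩ := hd1 hd0
        rw [h1, h2]
        refine h.buckets.raise ?_ hd0
        rw [hd]
        split_ifs <;> omega
    · rw [h8]
      have := h.flag_le
      split_ifs <;> omega
    · have hcond : (s.arr 2 (w * n + x) ≠ 0 ∧ s.arr 7 w = s.arr 7 x) ↔
          (B.Undir x w ∧ B.label π w = B.label π x) := by
        rw [hmat, hwt', h.label_self]
        exact ⟨fun h => ⟨⟨hxw, h.1⟩, h.2⟩, fun h => ⟨h.1.2, h.2⟩⟩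
      rw [h8]
      split_ifs with hif
      · refine ⟨fun _ => ⟨w, (htake w).2 (Or.inr rfl), hwπ, hcond.1 hif⟩, fun _ => one_ne_zero⟩
      · rw [h.flag]
        constructor
        · rintro ⟨u, hu, h1⟩
          exact ⟨u, (htake u).2 (Or.inl hu), h1⟩
        · rintro ⟨u, hu, h1⟩
          rcases (htake u).1 hu with h2 | rfl
          · exact ⟨u, h2, h1⟩
          · exact absurd (hcond.2 h1.2) hif
    · by_cases hd0 : d = 0
      · rw [(hd2 hd0).2, sum_update_succ hlw]
        have := h.size
        omega
      · rw [(hd1 hd0).2]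
        have := h.size
        omega

/-- Rule for loops over the out-neighbors of a vertex. -/
theorem Runs.neighbor_loop {A : ℕ → (ℕ → ℕ) → (ℕ → ℕ → ℕ) → List ℕ → Prop} {p : Prog} {s : State}
    (K : ℕ) (hL : Lists n B L) (hW : n * n + 2 * L.length + n + 2 ≤ W) (hx : x < n)
    (hp : p.keepsReg 9 = true)
    (hA : ∀ i r a c k v, k = 9 ∨ k = 10 → A i r a c → A i (Function.update r k v) a c)
    (hA' : ∀ i r a c, A i r a c → r 6 = x ∧ GraphMem n B L a)
    (h0 : A 0 s.reg s.arr s.cur)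
    (hI : ∀ i, ∀ hi : i < (neighbors L x).length, ∀ s, s.reg 10 = (neighbors L x)[i] →
      A i s.reg s.arr s.cur → Runs W p s fun t =>
        t.clock ≤ s.clock + K ∧ A (i + 1) t.reg t.arr t.cur) :
    Runs W (neighborLoop p) s fun t =>
      t.clock ≤ s.clock + (neighbors L x).length * (K + 16) + 7 ∧
      A (neighbors L x).length t.reg t.arr t.cur := by
  have hdeg := hL.length_neighbors_le (u := x)
  refine (Runs.range_loop_const (A := A) (neighbors L x).length (K + 7) (by simpa [Prog.keepsReg] using hp) (by omega)
    (fun i r a c v => hA i r a c 9 v (Or.inl rfl)) ?_ h0 ?_).mono ?_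
  · intro i s h
    obtain ⟨h6, hg⟩ := hA' _ _ _ _ h
    simp [h6, hg.length x hx]
  · intro i hi s h9 h
    obtain ⟨h6, hg⟩ := hA' _ _ _ _ h
    have hnb := hg.neighbor x hx i hi
    have hlt : (neighbors L x)[i] < n :=
      (hL.lt_of_adj (hL.mem_neighbors.1 (List.getElem_mem hi))).2
    refine runs_seq.2 (runs_set.2 ⟨?_, ?_⟩)
    · simp [h6, h9, hg.offset x hx, hnb]
      omega
    · refine (hI i hi _ ?_ ?_).mono ?_
      · simp [h6, h9, hg.offset x hx, hnb]
      · exact hA _ _ _ _ _ _ (Or.inr rfl) h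
      · rintro t - ⟨h1, h2⟩
        simp at h1
        exact ⟨by omega, h2⟩
  · rintro t - ⟨h1, h2⟩
    simp at h1
    ring_nf at h1 ⊢
    exact ⟨by omega, h2⟩

/-- The search has visited `π`. -/
structure Searching (n : ℕ) (B : Digraph ℕ) (L : List (ℕ × ℕ)) (π : List ℕ) (r : ℕ → ℕ)
    (a : ℕ → ℕ → ℕ) : Prop where
  graph : GraphMem n B L a
  search : SearchMem n B L π a
  mcs : MCS n B π
  vertices : r 4 = n
  count : r 7 = π.length
  top_le : r 11 ≤ π.length
  le_top : ∀ w < n, w ∉ π → B.label π w ≤ r 11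

/-- The stack invariant is assumed with `x` already marked as visited, so that it does not matter
whether the caller has popped `x` (as in `descend`) or leaves it behind as a stale entry (as in
`replay` and `branch`). -/
theorem runs_visit (hL : Lists n B L) (hB : B.IsBucketOn n)
    (hW : n * n + 2 * L.length + n + 2 ≤ W) {s : State} (hs : Searching n B L π s.reg s.arr)
    (hx : MaxLabel n B π x) (hr : B.Ready π x) (h6 : s.reg 6 = x)
    (hb : Buckets n (s.arr 7) (s.arr 6) (Function.update (s.arr 8) x (π.length + 1)) (s.arr 10)
      (s.arr 11)) :
    Runs W visit s fun t => t.clock ≤ s.clock + ((neighbors L x).length + 1) * 80 ∧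
      Searching n B L (π ++ [x]) t.reg t.arr ∧
      Buckets n (t.arr 7) (t.arr 6) (t.arr 8) (t.arr 10) (t.arr 11) ∧
      t.reg 11 = s.reg 11 + 1 ∧ t.reg 8 ≤ 1 ∧
      (t.reg 8 ≠ 0 ↔ ∃ w, MaxLabel n B π w ∧ B.Undir x w) ∧
      ∑ k ∈ Finset.range n, t.arr 11 k ≤
        (∑ k ∈ Finset.range n, s.arr 11 k) + (neighbors L x).length ∧
      t.arr 9 = Function.update (s.arr 9) π.length x := by
  have hπ : MCS n B (π ++ [x]) := hs.mcs.snoc hx hr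
  have hlen := hπ.length_le
  simp only [List.length_append, List.length_singleton] at hlen
  have hxn := hx.lt
  have htop := hs.top_le
  set V := Function.update (s.arr 8) x (π.length + 1) with hVdef
  -- The marks are positions plus 1, so that 0 stands for "unvisited".
  have hV : ∀ w < n, V w = 0 ↔ w ∉ π ++ [x] := by
    intro w hw
    rw [hVdef, Function.update_apply, hs.search.visited w hw]
    by_cases h1 : w = x <;> by_cases h2 : w ∈ π <;> simp [h1, h2]
  have hne : ∀ w, w ∉ π ++ [x] → w ∉ π := fun w hw h => hw (List.mem_append_left _ h)
  let A : ℕ → (ℕ → ℕ) → (ℕ → ℕ → ℕ) → List ℕ → Prop := fun i r a _ =>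
    r 6 = x ∧ VisitMem n B L π x V (∑ k ∈ Finset.range n, s.arr 11 k) i (r 8) a
  simp only [visit, runs_seq, runs_store, runs_set, Expr.eval, tick_reg, tick_arr, setArr_reg,
    setArr_arr, setReg_reg, setReg_arr, hs.count, h6]
  refine ⟨by omega, by omega, by omega, by simp [h6]; omega, by simp; omega, by omega, ?_⟩
  refine (Runs.neighbor_loop (A := A) 64 hL hW hxn rfl ?_ ?_ ?_ ?_).mono ?_
  · rintro i r a c k v hk ⟨h1, h2⟩
    rcases hk with rfl | rfl <;> exact ⟨by simpa using h1, by simpa using h2⟩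
  · exact fun i r a c h => ⟨h.1, h.2.graph⟩
  · refine ⟨by simp [h6], ?_⟩
    refine ⟨hs.graph.congr fun i hi => ?_, by simp [h6, hVdef], fun w hw hwn => ?_, ?_,
      fun w hw hwn => ?_, ?_, by simp, by simp, by simp⟩
    · interval_cases i <;> simp
    · simpa using hs.search.label w hw (hne w hwn)
    · simpa using hs.search.label x hxn hx.notMem
    · simpa using hs.search.indegree w hw (hne w hwn)
    · simpa [h6] using hb
  · rintro i hi t h10 ⟨h6', hvm⟩
    refine (runs_updateNeighbor_visitMem hL hB hW hπ hV hi h6' h10 hvm).mono ?_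
    rintro u hu ⟨hc, hvm'⟩
    exact ⟨hc, (hu.reg_eq rfl).trans h6', hvm'⟩
  · rintro t ht ⟨hc, h6', hvm⟩
    have h11 : t.reg 11 = s.reg 11 := by rw [ht.reg_eq rfl]; simp
    have h4 : t.reg 4 = n := by rw [ht.reg_eq rfl]; simpa using hs.vertices
    have h7 : t.reg 7 = π.length + 1 := by rw [ht.reg_eq rfl]; simp
    have h9 : t.arr 9 = Function.update (s.arr 9) π.length x := by
      rw [ht.arr_eq rfl]; simp
    have hall : ∀ w, w ∈ (neighbors L x).take (neighbors L x).length ↔ B.Adj x w := by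
      intro w
      rw [List.take_length, hL.mem_neighbors]
    refine ⟨by simp only [Expr.eval, h11]; omega, ?_, ?_, ?_, ?_, ?_, ?_, ?_, ?_⟩
    · simp at hc ⊢
      omega
    · refine ⟨hvm.graph, ⟨fun w hw => ?_, fun w hw hwn => ?_, fun w hw hwn => ?_, fun i hi => ?_⟩,
        hπ, by simpa using h4, by simpa using h7, by simpa [h11] using htop, fun w hw hwn => ?_⟩
      · rw [hvm.visited, hVdef, Function.update_apply, hs.search.visited w hw]
        by_cases h1 : w = x
        · subst h1
          simp [List.idxOf_append, hx.notMem]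
        · by_cases h2 : w ∈ π <;> simp [h1, h2, List.idxOf_append]
      · rw [hvm.label w hw hwn]
        by_cases h1 : B.Adj x w
        · rw [if_pos ((hall w).2 h1)]
        · rw [if_neg fun h => h1 ((hall w).1 h), label_snoc, if_neg h1, add_zero]
      · rw [hvm.indegree w hw hwn]
        by_cases h1 : B.Adj x w
        · rw [if_pos ((hall w).2 h1)]
        · rw [if_neg fun h => h1 ((hall w).1 h), hL.indegree_snoc hx.notMem w, if_neg fun h => h1 h.1, add_zero]
      · simp only [tick_arr, setReg_arr, h9]
        rcases lt_or_ge i π.length with h1 | h1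
        · rw [Function.update_of_ne h1.ne, hs.search.order i h1, List.getElem_append_left h1]
        · obtain rfl : i = π.length := by simp at hi; omega
          simp
      · have h1 := hs.le_top w hw (hne w hwn)
        simp only [tick_reg, setReg_reg, Function.update_self, Expr.eval, h11]
        rw [label_snoc]
        split_ifs <;> omega
    · exact hvm.buckets
    · simp [h11]
    · simpa using hvm.flag_le
    · have h1 : ∀ w, (w ∈ (neighbors L x).take (neighbors L x).length ∧ w ∉ π ++ [x] ∧
          B.Undir x w ∧ B.label π w = B.label π x) ↔ MaxLabel n B π w ∧ B.Undir x w := by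
        intro w
        rw [hall]
        constructor
        · rintro ⟨hxw, hwn, hu, hl⟩
          exact ⟨maxLabel_of_label_eq hx (hB.lt _ _ hxw).2 (hne w hwn) hl, hu⟩
        · rintro ⟨hm, hu⟩
          refine ⟨hu.1, ?_, hu, hx.label_eq hm⟩
          simp only [List.mem_append, List.mem_singleton, not_or]
          refine ⟨hm.notMem, ?_⟩
          rintro rfl
          exact hB.loopless _ hu.1
      simp only [← h1]
      simpa using hvm.flag
    · exact hvm.size
    · exact h9

end RAM

namespace RAM

variable {n W : ℕ} {B : Digraph ℕ} {L : List (ℕ × ℕ)} {π : List ℕ} {x : ℕ}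

/-! ### Building the representation of the graph -/

theorem runs_setOffsets (hW : n * n + 2 * L.length + n + 2 ≤ W) {s : State}
    (h0 : s.arr 0 0 = n) :
    Runs W setOffsets s fun t => t.clock ≤ s.clock + 30 * (n + 1) ∧ t.reg 4 = n ∧
      ∀ u < n, t.arr 1 u = u * n := by
  let A : ℕ → (ℕ → ℕ) → (ℕ → ℕ → ℕ) → List ℕ → Prop := fun i r a _ =>
    r 4 = n ∧ r 17 = i * n ∧ ∀ u < i, a 1 u = u * n
  simp only [setOffsets, runs_seq, runs_set, Expr.eval, tick_arr, h0]
  refine ⟨by omega, by omega, ?_⟩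
  refine (Runs.range_loop_const (A := A) n 12 rfl (by omega) ?_ ?_ ?_ ?_).mono ?_
  · rintro i r a - v ⟨h1, h2, h3⟩
    exact ⟨by simpa using h1, by simpa using h2, h3⟩
  · exact fun i s h => h.1
  · exact ⟨by simp, by simp, by simp⟩
  · rintro i hi t h5 ⟨h4, h17, h1⟩
    have := mul_add_le hi le_rfl
    simp [h4, h5, h17]
    refine ⟨by omega, by omega, by omega, by simpa using h4, by simp; ring, fun u hu => ?_⟩
    rcases eq_or_ne u i with rfl | hne
    · simp
    · simpa [hne] using h1 u (by omega)
  · rintro t - ⟨hc, h4, -, h1⟩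
    simp at hc
    exact ⟨by omega, h4, h1⟩

/-- The matrix may have far more cells than there are edges. Linear time is possible because memory
is initially 0 and only the cells of edges are written. -/
theorem runs_insertPairs (hL : Lists n B L) (hW : n * n + 2 * L.length + n + 2 ≤ W) {s : State}
    (hin : HoldsPairs L (s.arr 0)) (hlen : s.reg 0 = 1 + 2 * L.length)
    (h1 : ∀ u < n, s.arr 1 u = u * n) (h2 : ∀ u, s.arr 2 u = 0) (h4 : ∀ u, s.arr 4 u = 0) :
    Runs W (pairLoop insertPair) s fun t => t.clock ≤ s.clock + L.length * 40 + 10 ∧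
      (∀ u < n, ∀ v < n, t.arr 2 (u * n + v) ≠ 0 ↔ B.Adj u v) ∧
      (∀ u < n, t.arr 4 u = (neighbors L u).length) ∧
      ∀ u < n, ∀ k, ∀ h : k < (neighbors L u).length, t.arr 3 (u * n + k) = (neighbors L u)[k] := by
  let A : ℕ → (ℕ → ℕ) → (ℕ → ℕ → ℕ) → List ℕ → Prop := fun i r a _ =>
    (∀ u < n, a 1 u = u * n) ∧
    (∀ u < n, ∀ v < n, a 2 (u * n + v) ≠ 0 ↔ (u, v) ∈ L.take i) ∧
    (∀ u < n, a 4 u = (neighbors (L.take i) u).length) ∧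
    ∀ u < n, ∀ k, ∀ h : k < (neighbors (L.take i) u).length,
      a 3 (u * n + k) = (neighbors (L.take i) u)[k]
  refine (Runs.pair_loop (A := A) 24 rfl rfl rfl hlen hin (by omega) ?_ ?_ ?_ ?_).mono ?_
  · intro e he
    have := hL.lt e he
    omega
  · exact fun i r a c x v _ h => h
  · exact ⟨h1, by simp [h2], by simp [h4, neighbors], by simp [neighbors]⟩
  · rintro i hi t h2 h3 ⟨ha1, ha2, ha4, ha3⟩
    set u := L[i].1 with hu
    set v := L[i].2 with hv
    have huv := hL.lt _ (List.getElem_mem hi)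
    rw [← hu, ← hv] at huv
    have htake : L.take (i + 1) = L.take i ++ [(u, v)] := by
      rw [← List.take_concat_get' _ _ hi]
    have hlt : (neighbors (L.take (i + 1)) u).length ≤ n :=
      length_neighbors_le (hL.nodup.sublist (List.take_sublist _ _))
        fun e he => hL.lt e (List.mem_of_mem_take he)
    have hnbu : neighbors (L.take (i + 1)) u = neighbors (L.take i) u ++ [v] := by
      rw [htake, neighbors_append]
      simp [neighbors]
    have hnbn : ∀ w, w ≠ u → neighbors (L.take (i + 1)) w = neighbors (L.take i) w := by
      intro w hw
      rw [htake, neighbors_append]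
      simp [neighbors, hw.symm]
    have hlen' := congrArg List.length hnbu
    simp at hlen'
    have hd := ha4 u huv.1
    have hb1 := mul_add_lt huv.1 huv.2
    have hb2 := mul_add_lt huv.1 (show (neighbors (L.take i) u).length < n by omega)
    simp [insertPair, h2, h3, ha1 u huv.1, hd]
    refine ⟨by omega, by omega, by omega, by omega, by omega, by omega,
      by simpa using ha1, fun w hw z hz => ?_, fun w hw => ?_, fun w hw k hk => ?_⟩
    · rw [htake, List.mem_append, List.mem_singleton, ← ha2 w hw z hz, Prod.mk.injEq]
      by_cases he : w = u ∧ z = v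
      · obtain ⟨rfl, rfl⟩ := he
        simp
      · have : w * n + z ≠ u * n + v := fun h => he (add_mul_inj hz huv.2 h)
        simp [this, he]
    · rcases eq_or_ne w u with rfl | hne
      · simp [hnbu]
      · simp [hne, hnbn w hne, ha4 w hw]
    · rcases eq_or_ne w u with rfl | hne
      · simp only [hnbu] at hk ⊢
        simp only [List.length_append, List.length_singleton] at hk
        rcases lt_or_ge k (neighbors (L.take i) u).length with hlt' | hge
        · have : u * n + k ≠ u * n + (neighbors (L.take i) u).length := by omega
          simp only [List.getElem_append_left hlt', Function.update_self, Function.update_of_ne,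
            ne_eq, Nat.reduceEqDiff, not_false_eq_true]
          rw [Function.update_of_ne this, ha3 u hw k hlt']
        · obtain rfl : k = (neighbors (L.take i) u).length := by omega
          simp
      · simp only [hnbn w hne] at hk ⊢
        have hkn : k < n := hk.trans_le (length_neighbors_le
          (hL.nodup.sublist (List.take_sublist _ _)) fun e he => hL.lt e (List.mem_of_mem_take he))
        have : w * n + k ≠ u * n + (neighbors (L.take i) u).length := fun h =>
          hne (add_mul_inj hkn (by omega) h).1
        simp [this, ha3 w hw k hk]
  · rintro t - ⟨hc, -, h2, h4, h3⟩
    rw [List.take_length] at h2 h4 h3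
    exact ⟨hc, fun u hu v hv => (h2 u hu v hv).trans (hL.adj u v).symm, h4, h3⟩

theorem runs_countArcs (hL : Lists n B L) (hW : n * n + 2 * L.length + n + 2 ≤ W) {s : State}
    (hin : HoldsPairs L (s.arr 0)) (hlen : s.reg 0 = 1 + 2 * L.length)
    (h1 : ∀ u < n, s.arr 1 u = u * n)
    (h2 : ∀ u < n, ∀ v < n, s.arr 2 (u * n + v) ≠ 0 ↔ B.Adj u v) (h5 : ∀ u, s.arr 5 u = 0) :
    Runs W (pairLoop countArc) s fun t => t.clock ≤ s.clock + L.length * 40 + 10 ∧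
      ∀ u < n, t.arr 5 u = indegree B L [] u := by
  classical
  let A : ℕ → (ℕ → ℕ) → (ℕ → ℕ → ℕ) → List ℕ → Prop := fun i r a _ =>
    (∀ u < n, a 1 u = u * n) ∧
    (∀ u < n, ∀ v < n, a 2 (u * n + v) ≠ 0 ↔ B.Adj u v) ∧
    (∀ u < n, a 5 u = (L.take i).countP fun e => e.2 = u ∧ B.Arc e.1 u)
  refine (Runs.pair_loop (A := A) 24 rfl rfl rfl hlen hin (by omega) ?_ ?_ ?_ ?_).mono ?_
  · intro e he
    have := hL.lt e he
    omega
  · exact fun i r a c x v _ h => h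
  · exact ⟨h1, h2, by simp [h5]⟩
  · rintro i hi t hr2 hr3 ⟨ha1, ha2, ha5⟩
    set u := L[i].1 with hu
    set v := L[i].2 with hv
    have huv := hL.lt _ (List.getElem_mem hi)
    have hadj : B.Adj u v := (hL.adj _ _).2 (List.getElem_mem hi)
    rw [← hu, ← hv] at huv
    have htake : L.take (i + 1) = L.take i ++ [(u, v)] := by
      rw [← List.take_concat_get' _ _ hi]
    have hle : t.arr 5 v ≤ i := by
      rw [ha5 v huv.2]
      exact List.countP_le_length.trans (by simp)
    have hm := ha2 v huv.2 u huv.1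
    by_cases hA : B.Adj v u
    · have hm' : t.arr 2 (v * n + u) ≠ 0 := hm.2 hA
      simp [countArc, hr2, hr3, ha1 v huv.2, hm', add_assoc]
      refine ⟨ha1, ha2, fun w hw => ?_⟩
      rw [ha5 w hw, htake, List.countP_append, List.countP_singleton]
      have : ¬ (v = w ∧ B.Arc u w) := by
        rintro ⟨rfl, h⟩
        exact h.2 hA
      simp [this]
    · have hm' : t.arr 2 (v * n + u) = 0 := by
        by_contra hc
        exact hA (hm.1 hc)
      simp [countArc, hr2, hr3, ha1 v huv.2, hm', add_assoc]
      refine ⟨by omega, by omega, by simpa using ha1, by simpa using ha2, fun w hw => ?_⟩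
      rw [htake, List.countP_append, List.countP_singleton]
      rcases eq_or_ne w v with rfl | hne
      · have h1 : B.Arc u v := ⟨hadj, hA⟩
        have h2 := ha5 v hw
        simp at h2
        simp [h1, h2]
      · simp [hne, hne.symm, ha5 w hw]
  · rintro t - ⟨hc, -, -, h5⟩
    rw [List.take_length] at h5
    refine ⟨hc, fun u hu => (h5 u hu).trans ?_⟩
    simp [indegree]

theorem runs_setup (hL : Lists n B L) (hW : n * n + 2 * L.length + n + 2 ≤ W) {s : State}
    (h0 : s.arr 0 0 = n) (hin : HoldsPairs L (s.arr 0)) (hlen : s.reg 0 = 1 + 2 * L.length)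
    (hz : ∀ a ≠ 0, ∀ u, s.arr a u = 0) :
    Runs W setup s fun t => t.clock ≤ s.clock + 80 * (n + L.length + 1) ∧ t.reg 4 = n ∧
      GraphMem n B L t.arr := by
  refine (runs_setOffsets hW h0).seq ?_
  rintro t ht ⟨hc, h4, h1⟩
  have hin' : HoldsPairs L (t.arr 0) := by rw [ht.arr_eq rfl]; exact hin
  refine (runs_insertPairs hL hW hin' ((ht.reg_eq rfl).trans hlen) h1 (fun u => ?_)
    fun u => ?_).seq ?_
  · rw [ht.arr_eq rfl]; exact hz 2 (by norm_num) u
  · rw [ht.arr_eq rfl]; exact hz 4 (by norm_num) u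
  rintro t' ht' ⟨hc', h2, hl, hnb⟩
  have h1' : t'.arr 1 = t.arr 1 := ht'.arr_eq rfl
  have h0' : t'.arr 0 = t.arr 0 := ht'.arr_eq rfl
  refine (runs_countArcs hL hW (h0' ▸ hin') (((ht'.reg_eq rfl).trans (ht.reg_eq rfl)).trans hlen)
    (h1' ▸ h1) h2 fun u => ?_).mono ?_
  · rw [ht'.arr_eq rfl, ht.arr_eq rfl]; exact hz 5 (by norm_num) u
  rintro t'' ht'' ⟨hc'', h5⟩
  refine ⟨by omega, ((ht''.reg_eq rfl).trans (ht'.reg_eq rfl)).trans h4, ?_, ?_, ?_, ?_, ?_, h5⟩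
  · rw [ht''.arr_eq rfl, h0']; exact hin'
  · rw [ht''.arr_eq rfl, h1']; exact h1
  · rw [ht''.arr_eq rfl]; exact h2
  · rw [ht''.arr_eq rfl]; exact hl
  · rw [ht''.arr_eq rfl]; exact hnb

/-! ### Starting a search -/

theorem runs_clearVertices (hW : n * n + 2 * L.length + n + 2 ≤ W) {s : State}
    (h4 : s.reg 4 = n) (hg : GraphMem n B L s.arr) :
    Runs W (rangeLoop 5 (.reg 4) clearVertex) s fun t => t.clock ≤ s.clock + n * 40 + 10 ∧
      ∀ w < n, t.arr 6 w = indegree B L [] w ∧ t.arr 7 w = 0 ∧ t.arr 8 w = 0 ∧ t.arr 11 w = 0 ∧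
        t.arr 15 w = 0 ∧ t.arr 17 w = 0 := by
  let A : ℕ → (ℕ → ℕ) → (ℕ → ℕ → ℕ) → List ℕ → Prop := fun i r a _ =>
    r 4 = n ∧ a 5 = s.arr 5 ∧ ∀ w < i, a 6 w = indegree B L [] w ∧ a 7 w = 0 ∧ a 8 w = 0 ∧
      a 11 w = 0 ∧ a 15 w = 0 ∧ a 17 w = 0
  refine (Runs.range_loop_const (A := A) n 28 rfl (by omega) ?_ ?_ ?_ ?_).mono ?_
  · rintro i r a - v ⟨h1, h2⟩
    exact ⟨by simpa using h1, h2⟩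
  · exact fun i s h => h.1
  · exact ⟨h4, rfl, by simp⟩
  · rintro i hi t h5 ⟨h4, ha5, hw⟩
    have h5i : t.arr 5 i = indegree B L [] i := by rw [ha5]; exact hg.indegree i hi
    have hle : indegree B L [] i ≤ L.length := indegree_le
    simp [clearVertex, h5, h5i]
    refine ⟨by omega, by omega, by omega, h4, by simpa using ha5, fun w hwi => ?_⟩
    rcases eq_or_ne w i with rfl | hne
    · simp
    · simpa [hne] using hw w (by omega)
  · rintro t - ⟨hc, -, -, h⟩
    simp at hc
    exact ⟨by omega, h⟩

theorem runs_pushInitial (hW : n * n + 2 * L.length + n + 2 ≤ W) {s : State}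
    (h4 : s.reg 4 = n) (h11 : ∀ k < n, s.arr 11 k = 0) (h8 : ∀ w < n, s.arr 8 w = 0)
    (h7 : ∀ w < n, s.arr 7 w = 0) :
    Runs W (rangeLoop 5 (.reg 4) pushInitial) s fun t => t.clock ≤ s.clock + n * 40 + 10 ∧
      Buckets n (t.arr 7) (t.arr 6) (t.arr 8) (t.arr 10) (t.arr 11) ∧
      ∑ k ∈ Finset.range n, t.arr 11 k ≤ n := by
  let A : ℕ → (ℕ → ℕ) → (ℕ → ℕ → ℕ) → List ℕ → Prop := fun i r a _ =>
    r 4 = n ∧ a 6 = s.arr 6 ∧ (∀ k, 0 < k → k < n → a 11 k = 0) ∧ (0 < n → a 11 0 ≤ i) ∧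
    (∀ t < a 11 0, a 10 t < i ∧ s.arr 6 (a 10 t) = 0) ∧
    (∀ t < a 11 0, ∀ t' < a 11 0, a 10 t = a 10 t' → t = t') ∧
    ∀ w < i, s.arr 6 w = 0 → ∃ t < a 11 0, a 10 t = w
  -- For `n = 0` there is no stack 0, and its size has not been cleared.
  rcases Nat.eq_zero_or_pos n with rfl | hn
  · refine (Runs.range_loop_const (A := fun _ r _ _ => r 4 = 0) 0 0 rfl (by omega) ?_ ?_ h4
      (by simp)).mono ?_
    · rintro i r a - v h1
      simpa using h1
    · exact fun i s h => h
    · rintro t - ⟨hc, -⟩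
      simp at hc
      exact ⟨by omega, ⟨by simp, by simp, by simp, by simp, by simp⟩, by simp⟩
  refine (Runs.range_loop_const (A := A) n 28 rfl (by omega) ?_ ?_ ?_ ?_).mono ?_
  · rintro i r a - v ⟨h1, h2⟩
    exact ⟨by simpa using h1, h2⟩
  · exact fun i s h => h.1
  · exact ⟨h4, rfl, fun k _ hk => h11 k hk, fun hn => (h11 0 hn).le, by simp [h11 0 hn],
      by simp [h11 0 hn], by simp⟩
  · rintro i hi t h5 ⟨h4, ha6, hk, h0, hent, hinj, hmem⟩
    have h0' := h0 hn
    by_cases hi0 : s.arr 6 i = 0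
    · simp [pushInitial, h5, ha6, hi0]
      refine ⟨by omega, by omega, by omega, h4, by simpa using ha6, fun k hk0 hkn => ?_,
        fun _ => by simpa using h0', fun j hj => ?_, fun j hj j' hj' he => ?_, fun w hw hw0 => ?_⟩
      · simpa [hk0.ne'] using hk k hk0 hkn
      · simp at hj
        rcases eq_or_ne j (t.arr 11 0) with rfl | hne
        · simp [hi0]
        · have := hent j (by omega)
          simp [hne]
          exact ⟨by omega, this.2⟩
      · simp at hj hj' he
        rcases eq_or_ne j (t.arr 11 0) with rfl | hne <;>
          rcases eq_or_ne j' (t.arr 11 0) with rfl | hne'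
        · rfl
        · simp [hne'] at he
          have := (hent j' (by omega)).1
          omega
        · simp [hne] at he
          have := (hent j (by omega)).1
          omega
        · simp [hne, hne'] at he
          exact hinj j (by omega) j' (by omega) he
      · rcases eq_or_ne w i with rfl | hne
        · exact ⟨t.arr 11 0, by simp, by simp⟩
        · obtain ⟨j, hj, hjw⟩ := hmem w (by omega) hw0
          exact ⟨j, by simp; omega, by simpa [hj.ne] using hjw⟩
    · simp [pushInitial, h5, ha6, hi0]
      refine ⟨h4, by simpa using ha6, hk, fun hn => (h0 hn).trans (by omega), fun j hj => ?_, hinj,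
        fun w hw hw0 => ?_⟩
      · have := hent j hj
        exact ⟨by omega, this.2⟩
      · refine hmem w ?_ hw0
        have : w ≠ i := by
          rintro rfl
          exact hi0 hw0
        omega
  · rintro t ht ⟨hc, -, ha6, hk, h0, hent, hinj, hmem⟩
    simp at hc
    have ha7 : t.arr 7 = s.arr 7 := ht.arr_eq rfl
    have ha8 : t.arr 8 = s.arr 8 := ht.arr_eq rfl
    have hk0 : ∀ k < n, ∀ j < t.arr 11 k, k = 0 := by
      intro k hkn j hj
      by_contra hc
      rw [hk k (by omega) hkn] at hj
      omega
    refine ⟨by omega, ⟨fun k hkn j hj => ?_, fun k hkn j hj => ?_, fun k hkn j hj _ => ?_,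
      fun k hkn j hj j' hj' he => ?_, fun w hw hv hi => ?_⟩, ?_⟩
    · obtain rfl := hk0 k hkn j hj
      simpa using (hent j hj).1
    · obtain rfl := hk0 k hkn j hj
      omega
    · obtain rfl := hk0 k hkn j hj
      rw [ha6]
      simpa using (hent j hj).2
    · obtain rfl := hk0 k hkn j hj
      exact hinj j hj j' hj' (by simpa using he)
    · rw [ha7, h7 w hw]
      simpa using hmem w hw (by rwa [← ha6])
    · rw [Finset.sum_eq_single_of_mem 0 (by simpa using hn)
        fun k hkn hk0 => hk k (by omega) (by simpa using hkn)]
      exact h0 hn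

theorem runs_reset (hW : n * n + 2 * L.length + n + 2 ≤ W) {s : State}
    (h4 : s.reg 4 = n) (hg : GraphMem n B L s.arr) :
    Runs W reset s fun t => t.clock ≤ s.clock + 80 * n + 24 ∧
      Searching n B L [] t.reg t.arr ∧
      Buckets n (t.arr 7) (t.arr 6) (t.arr 8) (t.arr 10) (t.arr 11) ∧
      ∑ k ∈ Finset.range n, t.arr 11 k ≤ n ∧ t.reg 11 = 0 ∧
      ∀ w < n, t.arr 15 w = 0 ∧ t.arr 17 w = 0 := by
  refine (runs_clearVertices hW h4 hg).seq ?_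
  rintro t ht ⟨hc, hw⟩
  have h4t : t.reg 4 = n := (ht.reg_eq rfl).trans h4
  refine (runs_pushInitial hW h4t (fun k hk => (hw k hk).2.2.2.1) (fun k hk => (hw k hk).2.2.1)
    (fun k hk => (hw k hk).2.1)).seq ?_
  rintro u hu ⟨hcu, hb, hsum⟩
  have hg' : GraphMem n B L u.arr := hu.graphMem (ht.graphMem hg rfl) rfl
  have h4u : u.reg 4 = n := (hu.reg_eq rfl).trans h4t
  have h6 : u.arr 6 = t.arr 6 := hu.arr_eq rfl
  have h7 : u.arr 7 = t.arr 7 := hu.arr_eq rfl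
  have h8 : u.arr 8 = t.arr 8 := hu.arr_eq rfl
  have h15 : u.arr 15 = t.arr 15 := hu.arr_eq rfl
  have h17 : u.arr 17 = t.arr 17 := hu.arr_eq rfl
  simp
  refine ⟨by omega, ⟨hg', ⟨fun w hwn => ?_, fun w hwn _ => ?_, fun w hwn _ => ?_, by simp⟩, .nil,
    by simpa using h4u, by simp, by simp, by simp [label]⟩, hb, hsum, fun w hwn => ?_⟩
  · simp [h8, hw w hwn]
  · simp [h7, hw w hwn, label]
  · simp [h6, hw w hwn]
  · rw [h15, h17]
    exact (hw w hwn).2.2.2.2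

end RAM

/-! ### Completing a search and replaying a prefix of it, in amortized linear time. -/

namespace RAM

variable {n W : ℕ} {B : Digraph ℕ} {L : List (ℕ × ℕ)} {π : List ℕ} {x : ℕ}

/-- The number of unvisited vertices and of their out-edges. -/
def remaining (n : ℕ) (L : List (ℕ × ℕ)) (π : List ℕ) : ℕ :=
  ∑ w ∈ Finset.range n with w ∉ π, ((neighbors L w).length + 1)

theorem remaining_nil (hL : Lists n B L) : remaining n L [] = L.length + n := by
  simp [remaining, Finset.sum_add_distrib, sum_length_neighbors hL.lt]

theorem remaining_snoc (hx : x < n) (hxπ : x ∉ π) :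
    remaining n L (π ++ [x]) + ((neighbors L x).length + 1) = remaining n L π := by
  unfold remaining
  rw [← Finset.sum_erase_add _ _ (show x ∈ (Finset.range n).filter (· ∉ π) by simp [hx, hxπ])]
  congr 2
  ext w
  simp
  tauto

theorem Searching.congr {r r' : ℕ → ℕ} {a a' : ℕ → ℕ → ℕ} (h : Searching n B L π r a)
    (h4 : r' 4 = r 4) (h7 : r' 7 = r 7) (h11 : r' 11 = r 11) (ha : ∀ i < 10, a' i = a i) :
    Searching n B L π r' a' := by
  refine ⟨h.graph.congr fun i hi => ha i (by omega), ⟨?_, ?_, ?_, ?_⟩, h.mcs, h4.trans h.vertices,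
    h7.trans h.count, h11 ▸ h.top_le, h11 ▸ h.le_top⟩
  · rw [ha 8 (by norm_num)]; exact h.search.visited
  · rw [ha 7 (by norm_num)]; exact h.search.label
  · rw [ha 6 (by norm_num)]; exact h.search.indegree
  · rw [ha 9 (by norm_num)]; exact h.search.order

/-- `x` has an undirected edge to an unvisited vertex of maximum label. -/
def HasAlternative (n : ℕ) (B : Digraph ℕ) (π : List ℕ) (x : ℕ) : Prop :=
  ∃ w, MaxLabel n B π w ∧ B.Undir x w

theorem Searching.visited_eq_zero {r : ℕ → ℕ} {a : ℕ → ℕ → ℕ} (h : Searching n B L π r a) {w : ℕ}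
    (hw : w < n) : a 8 w = 0 ↔ w ∉ π := by
  rw [h.search.visited w hw]
  split_ifs with h1 <;> simp [h1]

theorem runs_visitFree (hL : Lists n B L) (hB : B.IsBucketOn n)
    (hW : n * n + 2 * L.length + n + 2 ≤ W) {s : State} (hs : Searching n B L π s.reg s.arr)
    (hx : MaxLabel n B π x) (hr : B.Ready π x) (h6 : s.reg 6 = x)
    (hb : Buckets n (s.arr 7) (s.arr 6) (Function.update (s.arr 8) x (π.length + 1)) (s.arr 10)
      (s.arr 11)) :
    Runs W visitFree s fun t => t.clock ≤ s.clock + ((neighbors L x).length + 1) * 80 + 20 ∧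
      Searching n B L (π ++ [x]) t.reg t.arr ∧
      Buckets n (t.arr 7) (t.arr 6) (t.arr 8) (t.arr 10) (t.arr 11) ∧
      t.reg 11 = s.reg 11 + 1 ∧
      ∑ k ∈ Finset.range n, t.arr 11 k ≤
        (∑ k ∈ Finset.range n, s.arr 11 k) + (neighbors L x).length ∧
      (∃ f, t.arr 12 = Function.update (s.arr 12) π.length f ∧
        (f ≠ 0 ↔ HasAlternative n B π x)) ∧
      t.arr 14 = Function.update (s.arr 14) π.length 0 := by
  have hπ : MCS n B (π ++ [x]) := hs.mcs.snoc hx hr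
  have hlen := hπ.length_le
  simp only [List.length_append, List.length_singleton] at hlen
  refine (runs_visit hL hB hW hs hx hr h6 hb).seq ?_
  rintro t ht ⟨hc, hst, hbt, h11, h8, h8', hsum, -⟩
  have h7 := hst.count
  simp at h7
  have h12 : t.arr 12 = s.arr 12 := ht.arr_eq rfl
  have h14 : t.arr 14 = s.arr 14 := ht.arr_eq rfl
  simp only [runs_seq, runs_store, Expr.eval, h7, tick_reg, setArr_reg]
  refine ⟨by omega, by omega, by omega, by omega, ?_, ?_, ?_, h11, hsum, ⟨t.reg 8, ?_, h8'⟩, ?_⟩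
  · simp
    omega
  · refine hst.congr rfl rfl rfl fun i hi => ?_
    simp [show i ≠ 14 by omega, show i ≠ 12 by omega]
  · exact hbt
  · simp [h12]
  · simp [h14]

/-- At the levels from `i` on, the alternatives are still to be collected. -/
def FreshFrom (n : ℕ) (B : Digraph ℕ) (π : List ℕ) (i : ℕ) (a : ℕ → ℕ → ℕ) : Prop :=
  ∀ l, ∀ h : l < π.length, i ≤ l →
    (a 12 l ≠ 0 ↔ HasAlternative n B (π.take l) π[l]) ∧ a 14 l = 0

theorem FreshFrom.snoc {i f : ℕ} {a a' : ℕ → ℕ → ℕ} (h : FreshFrom n B π i a)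
    (h12 : a' 12 = Function.update (a 12) π.length f) (hf : f ≠ 0 ↔ HasAlternative n B π x)
    (h14 : a' 14 = Function.update (a 14) π.length 0) : FreshFrom n B (π ++ [x]) i a' := by
  intro l hl hil
  rw [h12, h14]
  rcases lt_or_ge l π.length with h1 | h1
  · rw [Function.update_of_ne h1.ne, Function.update_of_ne h1.ne, List.getElem_append_left h1,
      List.take_append_of_le_length h1.le]
    exact h l h1 hil
  · obtain rfl : l = π.length := by simp at hl; omega
    simpa using hf

/-- The potential `2 * remaining + top + total stack size` drops by at least 1 per 160 steps.
Visiting a vertex with `d` out-neighbors lowers the first term by `2 * (d + 1)`, pops one entry,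
pushes at most `d` and raises the top by 1. Discarding a stale entry or lowering the top takes
constant time and lowers the potential by 1. -/
theorem runs_descend (hL : Lists n B L) (hB : B.IsBucketOn n)
    (hW : n * n + 2 * L.length + n + 2 ≤ W) {s : State} (hs : Searching n B L π s.reg s.arr)
    (hb : Buckets n (s.arr 7) (s.arr 6) (s.arr 8) (s.arr 10) (s.arr 11)) :
    Runs W descend s fun t => t.clock ≤ s.clock +
        160 * (2 * remaining n L π + n + ∑ k ∈ Finset.range n, s.arr 11 k) + 4 ∧
      ∃ ρ, Searching n B L (π ++ ρ) t.reg t.arr ∧ (π ++ ρ).length = n ∧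
        FreshFrom n B (π ++ ρ) π.length t.arr ∧
        ∀ l < π.length, t.arr 12 l = s.arr 12 l ∧ t.arr 14 l = s.arr 14 l := by
  set T := s.clock + 160 * (2 * remaining n L π + n + ∑ k ∈ Finset.range n, s.arr 11 k) with hT
  have htop := hs.top_le
  have hπn := hs.mcs.length_le
  refine Runs.while_measure (I := fun k t => t.clock + 160 * k ≤ T ∧ ∃ ρ,
    k = 2 * remaining n L (π ++ ρ) + t.reg 11 + ∑ k ∈ Finset.range n, t.arr 11 k ∧
    Searching n B L (π ++ ρ) t.reg t.arr ∧
    Buckets n (t.arr 7) (t.arr 6) (t.arr 8) (t.arr 10) (t.arr 11) ∧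
    FreshFrom n B (π ++ ρ) π.length t.arr ∧
    ∀ l < π.length, t.arr 12 l = s.arr 12 l ∧ t.arr 14 l = s.arr 14 l)
    (k := 2 * remaining n L π + s.reg 11 + ∑ k ∈ Finset.range n, s.arr 11 k) ?_ ?_
  · refine ⟨by omega, [], by simp, by simpa using hs, hb, ?_, by simp⟩
    intro l hl hl'
    simp at hl
    omega
  rintro k t ⟨hc, ρ, hk, hst, hbt, hf, hl⟩
  have h7 := hst.count
  have h4 := hst.vertices
  have hlen := hst.mcs.length_le
  rcases Nat.eq_or_lt_of_le hlen with hn | hn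
  · refine Or.inl ⟨by simp [h7, h4]; simp at hn; omega, ?_, ρ, hst, hn, hf, hl⟩
    simp
    omega
  refine Or.inr ⟨by simp [h7, h4]; simpa using hn, ?_⟩
  set σ := π ++ ρ with hσ
  have hj := hst.top_le
  set j := t.reg 11 with hjdef
  have hjn : j < n := by omega
  refine runs_ite.2 ⟨fun hne => ?_, fun h0 => ?_⟩
  · have hpos : 0 < t.arr 11 j := by
      simp only [Expr.eval, tick_reg, tick_arr, ← hjdef] at hne
      omega
    set u := t.arr 10 (j * n + (t.arr 11 j - 1)) with hu
    have hun : u < n := hbt.lt j hjn _ (by omega)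
    have hsz := hbt.size_le hjn
    have hoff : t.arr 1 j = j * n := hst.graph.offset j hjn
    have hpred := sum_update_pred hjn hpos
    have hpop : Runs W popTop (t.tick ((Expr.lt (.reg 7) (.reg 4)).cost + 1) |>.tick
        ((Expr.get 11 (.reg 11)).cost + 1)) fun v => v.clock ≤ t.clock + 40 ∧ v.reg 6 = u ∧
        v.arr 11 = Function.update (t.arr 11) j (t.arr 11 j - 1) := by
      simp [popTop, ← hjdef, hoff, ← hu, add_assoc]
      omega
    refine hpop.seq ?_
    rintro v hv ⟨hcv, h6, h11⟩
    have hr11 : v.reg 11 = j := hv.reg_eq rfl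
    have hsv : Searching n B L σ v.reg v.arr := by
      refine hst.congr (hv.reg_eq rfl) (hv.reg_eq rfl) (hv.reg_eq rfl) fun i hi => ?_
      refine hv.arr_eq ?_
      interval_cases i <;> rfl
    have e6 : v.arr 6 = t.arr 6 := hv.arr_eq rfl
    have e7 : v.arr 7 = t.arr 7 := hv.arr_eq rfl
    have e8 : v.arr 8 = t.arr 8 := hv.arr_eq rfl
    have e10 : v.arr 10 = t.arr 10 := hv.arr_eq rfl
    have e12 : v.arr 12 = t.arr 12 := hv.arr_eq rfl
    have e14 : v.arr 14 = t.arr 14 := hv.arr_eq rfl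
    -- The popped entry is stale: it is visited, or it has risen to a higher stack.
    have hskip : (∀ w, t.arr 8 w = 0 → t.arr 7 w = j → u ≠ w) → ∀ z : State, z.reg = v.reg →
        z.arr = v.arr → z.clock ≤ v.clock + 12 → ∃ k' < k, z.clock + 160 * k' ≤ T ∧ ∃ ρ,
          k' = 2 * remaining n L (π ++ ρ) + z.reg 11 + ∑ k ∈ Finset.range n, z.arr 11 k ∧
          Searching n B L (π ++ ρ) z.reg z.arr ∧
          Buckets n (z.arr 7) (z.arr 6) (z.arr 8) (z.arr 10) (z.arr 11) ∧
          FreshFrom n B (π ++ ρ) π.length z.arr ∧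
          ∀ l < π.length, z.arr 12 l = s.arr 12 l ∧ z.arr 14 l = s.arr 14 l := by
      intro hstale z hz1 hz2 hzc
      refine ⟨k - 1, by omega, by omega, ρ, ?_, ?_, ?_, ?_, ?_⟩
      · rw [hz1, hz2, hr11, h11, ← hσ]
        omega
      · rw [hz1, hz2]
        exact hsv
      · rw [hz2, e6, e7, e8, e10, h11]
        exact hbt.pop hpos fun w hw => ⟨hw, hstale w hw⟩
      · intro l hl' hl''
        rw [hz2, e12, e14]
        exact hf l hl' hl''
      · rw [hz2, e12, e14]
        exact hl
    refine runs_ite.2 ⟨fun hvis => ?_, fun hvis => ?_⟩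
    · simp only [Expr.eval, h6, e8] at hvis
      refine runs_skip.2 (hskip ?_ _ rfl rfl (by simp))
      rintro w hw - rfl
      exact hvis hw
    simp only [Expr.eval, h6, e8] at hvis
    refine runs_ite.2 ⟨fun hlab => ?_, fun hlab => ?_⟩
    · simp only [Expr.eval, tick_reg, tick_arr, h6, e7, hr11] at hlab
      have hlab' : t.arr 7 u = j := by
        by_contra hc
        simp [hc] at hlab
      have huσ : u ∉ σ := (hst.visited_eq_zero hun).1 hvis
      have hlu : B.label σ u = j := by rw [← hst.search.label u hun huσ, hlab']
      have hmax : MaxLabel n B σ u := ⟨hun, huσ, fun w hw hwσ => hlu ▸ hst.le_top w hw hwσ⟩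
      have hready : B.Ready σ u := by
        rw [← hL.indegree_eq_zero, ← hst.search.indegree u hun huσ]
        exact hbt.ready j hjn _ (by omega) hvis
      refine (runs_visitFree hL hB hW (s := (v.tick _).tick _) hsv hmax hready h6 ?_).mono ?_
      · simp only [tick_arr, e6, e7, e8, e10, h11]
        refine hbt.pop hpos fun w hw => ?_
        have hne : w ≠ u := by
          rintro rfl
          simp at hw
        rw [Function.update_of_ne hne] at hw
        exact ⟨hw, fun _ => hne.symm⟩
      · rintro z hz ⟨hcz, hsz, hbz, hz11, hsum, ⟨f, hf12, hff⟩, hz14⟩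
        have hrem := remaining_snoc (L := L) hun huσ
        simp only [tick_reg, tick_arr, h11, hr11] at hsum hz11
        simp only [tick_arr, e12, e14] at hf12 hz14
        simp only [tick_clock, Expr.cost] at hcz
        have hsp : (π ++ ρ) ++ [u] = π ++ (ρ ++ [u]) := by simp
        rw [← hσ] at hsp
        refine ⟨2 * remaining n L (σ ++ [u]) + z.reg 11 + ∑ k ∈ Finset.range n, z.arr 11 k,
          by omega, by omega, ρ ++ [u], ?_, ?_, hbz, ?_, ?_⟩
        · rw [← hsp]
        · rw [← hsp]
          exact hsz
        · rw [← hsp]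
          exact hf.snoc hf12 hff hz14
        · intro l hlπ
          have : l ≠ σ.length := by simp [hσ]; omega
          rw [hf12, hz14, Function.update_of_ne this, Function.update_of_ne this]
          exact hl l hlπ
    · simp only [Expr.eval, tick_reg, tick_arr, h6, e7, hr11] at hlab
      refine runs_skip.2 (hskip ?_ _ rfl rfl (by simp))
      rintro w - hw rfl
      simp [hw] at hlab
  · simp only [Expr.eval, tick_reg, tick_arr, ← hjdef] at h0
    -- Some ready vertex has maximum label. If this label were `j`, the vertex would be in the empty
    -- stack `j`; so all labels are smaller and the bound may be lowered.
    obtain ⟨y, hy, hyr⟩ := hB.exists_ready_maxLabel hst.mcs hn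
    have hly := hst.le_top y hy.lt hy.notMem
    have hlt : B.label σ y < j := by
      refine lt_of_le_of_ne hly fun he => ?_
      obtain ⟨i, hi, -⟩ := hbt.mem y hy.lt ((hst.visited_eq_zero hy.lt).2 hy.notMem)
        (by rw [hst.search.indegree y hy.lt hy.notMem]; exact hL.indegree_eq_zero.2 hyr)
      rw [hst.search.label y hy.lt hy.notMem, he, h0] at hi
      omega
    simp only [runs_set, Expr.eval, tick_reg, ← hjdef]
    refine ⟨by omega, k - 1, by omega, by simp; omega, ρ, ?_, ?_, hbt, hf, hl⟩
    · simp [← hσ]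
      omega
    · rw [← hσ]
      refine ⟨hst.graph, hst.search, hst.mcs, by simpa using h4, by simpa using h7, ?_,
        fun w hw hwσ => ?_⟩
      · simp
        omega
      · have := hy.le w hw hwσ
        simp
        omega

/-- Nothing is popped and the top is never lowered, so it equals the number of visits. The order
array is overwritten with the values it already holds, so the vertex at the branching level can
still be read from it. -/
theorem runs_replay (hL : Lists n B L) (hB : B.IsBucketOn n)
    (hW : n * n + 2 * L.length + n + 2 ≤ W) {s : State} {τ : List ℕ} {i : ℕ} (hτ : MCS n B τ)
    (hs : Searching n B L [] s.reg s.arr)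
    (hb : Buckets n (s.arr 7) (s.arr 6) (s.arr 8) (s.arr 10) (s.arr 11))
    (hi : i ≤ τ.length) (h12 : s.reg 12 = i) (h11 : s.reg 11 = 0)
    (h9 : ∀ l, ∀ h : l < τ.length, s.arr 9 l = τ[l]) :
    Runs W replay s fun t => t.clock ≤ s.clock + 100 * (L.length + n) + 4 ∧
      Searching n B L (τ.take i) t.reg t.arr ∧
      Buckets n (t.arr 7) (t.arr 6) (t.arr 8) (t.arr 10) (t.arr 11) ∧
      t.reg 11 = i ∧ t.arr 9 = s.arr 9 ∧
      ∑ k ∈ Finset.range n, t.arr 11 k ≤ (∑ k ∈ Finset.range n, s.arr 11 k) + L.length + n := by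
  have hrem := remaining_nil hL
  refine Runs.while_count (I := fun l t => Searching n B L (τ.take l) t.reg t.arr ∧
    Buckets n (t.arr 7) (t.arr 6) (t.arr 8) (t.arr 10) (t.arr 11) ∧ t.reg 11 = l ∧
    t.reg 12 = i ∧ t.arr 9 = s.arr 9 ∧
    (∑ k ∈ Finset.range n, t.arr 11 k) + remaining n L (τ.take l) ≤
      (∑ k ∈ Finset.range n, s.arr 11 k) + remaining n L [] ∧
    t.clock + 100 * remaining n L (τ.take l) ≤ s.clock + 100 * remaining n L []) i ?_ ?_ ?_
  · exact ⟨hs, hb, h11, h12, rfl, le_rfl, le_rfl⟩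
  · rintro l hl t ⟨hst, hbt, h11', h12', h9', hsum, hc⟩
    have hlτ : l < τ.length := by omega
    have h7 := hst.count
    have hlen : (τ.take l).length = l := by simp; omega
    rw [hlen] at h7
    refine ⟨by simp [h7, h12', hl], ?_⟩
    set x := τ[l] with hx
    obtain ⟨hmax, hready⟩ := hτ.getElem hlτ
    rw [← hx] at hmax hready
    have hxn := hmax.lt
    have htake : τ.take (l + 1) = τ.take l ++ [x] := by rw [hx, List.take_concat_get' _ _ hlτ]
    have h9x : t.arr 9 l = x := by rw [h9']; exact h9 l hlτ
    simp only [runs_seq, runs_set, Expr.eval, tick_reg, tick_arr, h7, h9x]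
    refine ⟨by omega, ?_⟩
    refine (runs_visit hL hB hW (x := x) ?_ hmax hready (by simp) ?_).mono ?_
    · exact hst.congr (by simp) (by simp) (by simp) fun i _ => rfl
    · refine hbt.mono_vis fun w hw => ?_
      have hne : w ≠ x := by
        rintro rfl
        simp at hw
      simpa [hne] using hw
    · rintro u hu ⟨hcu, hsu, hbu, hu11, -, -, husum, hu9⟩
      have hrs := remaining_snoc (L := L) hmax.lt hmax.notMem
      simp only [tick_reg, tick_arr, setReg_reg, setReg_arr] at hu11 husum hu9
      simp at hcu
      refine ⟨htake ▸ hsu, hbu, ?_, ?_, ?_, ?_, ?_⟩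
      · simpa [h11'] using hu11
      · rw [hu.reg_eq rfl]
        simpa using h12'
      · rw [hu9, hlen, ← h9', ← h9x]
        exact Function.update_eq_self ..
      · rw [htake]
        omega
      · rw [htake]
        omega
  · rintro t ⟨hst, hbt, h11', h12', h9', hsum, hc⟩
    have h7 := hst.count
    have hlen : (τ.take i).length = i := by simp; omega
    rw [hlen] at h7
    refine ⟨by simp [h7, h12'], ?_, hst, hbt, h11', h9', ?_⟩
    · simp
      omega
    · simp only [tick_arr]
      omega

end RAM

/-! ### Which AMOs remain after part of the tree of choices has been explored. -/

namespace Digraph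

variable {n : ℕ} {B D : Digraph ℕ} {π τ τ' : List ℕ} {x : ℕ}

/-- The vertices that can be visited instead of `x` after `π`. -/
def alternatives (n : ℕ) (B : Digraph ℕ) (π : List ℕ) (x : ℕ) : Set ℕ :=
  {z | z ∈ comp n B π x ∧ B.Ready π z ∧ z ≠ x}

/-- `D` extends a branch that is still to be explored: `P l` are the vertices that are still to be
visited at level `l` instead of the vertex of `τ`. -/
def Remaining (B : Digraph ℕ) (τ : List ℕ) (P : ℕ → Set ℕ) (D : Digraph ℕ) : Prop :=
  ∃ l < τ.length, ∃ z ∈ P l, B.Ext (τ.take l ++ [z]) D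

/-- All alternatives at level `l` are still to be explored. -/
def Fresh (n : ℕ) (B : Digraph ℕ) (τ : List ℕ) (P : ℕ → Set ℕ) (l : ℕ) : Prop :=
  ∀ h : l < τ.length, (∃ w, MaxLabel n B (τ.take l) w ∧ B.Undir τ[l] w) →
    alternatives n B (τ.take l) τ[l] ⊆ P l

variable (hB : B.IsBucketOn n)
include hB

/-- Follow `τ` level by level. Where there is an undirected edge, the vertex that `D` wants next is
that of `τ` or one of the alternatives; elsewhere `D` must agree with `τ`. -/
theorem eq_orient_or_branch (hτ : MCS n B τ) (hn : τ.length = n) {P : ℕ → Set ℕ} {k : ℕ}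
    (hk : k ≤ n) (hP : ∀ l, k ≤ l → Fresh n B τ P l) (hD : B.Ext (τ.take k) D) :
    D = B.orient τ ∨
      ∃ l, k ≤ l ∧ l < τ.length ∧ ∃ z ∈ P l, B.Ext (τ.take l ++ [z]) D := by
  have key : ∀ m, k ≤ m → m ≤ n → B.Ext (τ.take m) D ∨
      ∃ l, k ≤ l ∧ l < τ.length ∧ ∃ z ∈ P l, B.Ext (τ.take l ++ [z]) D := by
    intro m hkm
    induction m, hkm using Nat.le_induction with
    | base => exact fun _ => Or.inl hD
    | succ m hkm ih =>
      intro hmn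
      rcases ih (by omega) with h1 | h1
      · have hm : m < τ.length := by omega
        obtain ⟨hmax, hready⟩ := hτ.getElem hm
        rw [← List.take_concat_get' _ _ hm]
        by_cases hu : ∃ w, MaxLabel n B (τ.take m) w ∧ B.Undir τ[m] w
        · obtain ⟨z, hz, hzr, hze⟩ := hB.exists_ext_snoc h1 hmax hready
          rcases eq_or_ne z τ[m] with rfl | hne
          · exact Or.inl hze
          · exact Or.inr ⟨m, hkm, hm, z, hP m hkm hm hu ⟨hz, hzr, hne⟩, hze⟩
        · push Not at hu
          exact Or.inl (hB.ext_snoc_of_no_undir h1 hmax hready hu)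
      · exact Or.inr h1
  refine (key n hk le_rfl).imp_left fun h => orient_adj_of_ext hB hτ hn ?_
  rwa [← hn, List.take_length] at h

/-- The orientation along `τ` continues with `τ[l]` at level `l`, and by uniqueness with no
alternative. This keeps an output from being produced again. -/
theorem not_remaining_orient (hτ : MCS n B τ) (hn : τ.length = n) {P : ℕ → Set ℕ}
    (hP : ∀ l, ∀ h : l < τ.length, P l ⊆ alternatives n B (τ.take l) τ[l])
    (hD : B.IsAMO D) : ¬ Remaining B τ P (B.orient τ) := by
  rintro ⟨l, hl, z, hz, he⟩
  have h1 := (isAMO_orient hB hτ hn hD).take (l + 1)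
  rw [← List.take_concat_get' _ _ hl] at h1
  obtain ⟨hz1, -, hz2⟩ := hP l hl hz
  exact hz2 (ext_snoc_unique (hτ.getElem hl).1 hz1 .refl he h1)

/-- One step of the depth-first traversal. The branch of `z` at the last pending level is exchanged
for the orientation along the new order and the fresh branches below it; the earlier levels share
their prefixes with the old order. -/
theorem remaining_step (hτ' : MCS n B τ') (hn : τ.length = n) (hn' : τ'.length = n)
    {P P' : ℕ → Set ℕ} {i z : ℕ} (hi : i < n) (hz : z ∈ P i) (hgt : ∀ l < n, i < l → P l = ∅)
    (htake : τ'.take (i + 1) = τ.take i ++ [z]) (hlt' : ∀ l < i, P' l = P l)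
    (hi' : P' i = P i \ {z}) (hP' : ∀ l, i + 1 ≤ l → Fresh n B τ' P' l) (hD : B.IsAMO D) :
    Remaining B τ P D ↔ D = B.orient τ' ∨ Remaining B τ' P' D := by
  have htl : ∀ l ≤ i, τ'.take l = τ.take l := by
    intro l hl
    have h1 := congrArg (List.take l) htake
    rw [List.take_take, min_eq_left (by omega), List.take_append_of_le_length (by simp; omega),
      List.take_take, min_eq_left hl] at h1
    exact h1
  constructor
  · rintro ⟨l, hl, z', hz', he⟩
    rcases lt_trichotomy l i with h1 | rfl | h1
    · exact Or.inr ⟨l, by omega, z', hlt' l h1 ▸ hz', by rwa [htl l h1.le]⟩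
    · rcases eq_or_ne z' z with rfl | hne
      · rw [← htake] at he
        refine (eq_orient_or_branch hB hτ' hn' (by omega) hP' he).imp_right ?_
        rintro ⟨k, -, hk, h2⟩
        exact ⟨k, hk, h2⟩
      · exact Or.inr ⟨l, by omega, z', hi' ▸ ⟨hz', hne⟩, by rwa [htl l le_rfl]⟩
    · rw [hgt l (by omega) h1] at hz'
      exact absurd hz' (Set.notMem_empty _)
  · rintro (rfl | ⟨l, hl, z', hz', he⟩)
    · refine ⟨i, by omega, z, hz, ?_⟩
      rw [← htake]
      exact (isAMO_orient hB hτ' hn' hD).take _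
    · rcases lt_trichotomy l i with h1 | rfl | h1
      · exact ⟨l, by omega, z', hlt' l h1 ▸ hz', by rwa [← htl l h1.le]⟩
      · rw [hi'] at hz'
        exact ⟨l, by omega, z', hz'.1, by rwa [← htl l le_rfl]⟩
      · refine ⟨i, by omega, z, hz, ?_⟩
        have h2 := (he.of_append).take (i + 1)
        rwa [List.take_take, min_eq_left (by omega), htake] at h2

end Digraph

/-! ### Storing and collecting the alternatives of a level. -/

namespace RAM

variable {n W : ℕ} {B : Digraph ℕ} {L : List (ℕ × ℕ)} {π : List ℕ} {x : ℕ}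

/-- The arrays hold the alternatives `f l` of each level `l`. -/
structure HoldsAlternatives (n : ℕ) (f : ℕ → List ℕ) (a : ℕ → ℕ → ℕ) : Prop where
  length_le : ∀ l < n, (f l).length ≤ n
  length : ∀ l < n, a 14 l = (f l).length
  entry : ∀ l < n, ∀ k, ∀ h : k < (f l).length, a 13 (l * n + k) = (f l)[k]

theorem HoldsAlternatives.congr {f : ℕ → List ℕ} {a a' : ℕ → ℕ → ℕ} (h : HoldsAlternatives n f a)
    (h13 : a' 13 = a 13) (h14 : a' 14 = a 14) : HoldsAlternatives n f a' :=
  ⟨h.length_le, h14 ▸ h.length, h13 ▸ h.entry⟩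

/-- Emptying a list or dropping its last entry changes only the stored length. -/
theorem HoldsAlternatives.update {f : ℕ → List ℕ} {a a' : ℕ → ℕ → ℕ} {l : List ℕ} {i : ℕ}
    (h : HoldsAlternatives n f a) (h13 : a' 13 = a 13)
    (h14 : a' 14 = Function.update (a 14) i l.length) (hl : l <+: f i) (hi : i < n) :
    HoldsAlternatives n (Function.update f i l) a' := by
  refine ⟨fun k hk => ?_, fun k hk => ?_, fun k hk j hj => ?_⟩ <;> rcases eq_or_ne k i with rfl | hne
  · rw [Function.update_self]
    exact hl.length_le.trans (h.length_le k hk)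
  · rw [Function.update_of_ne hne]
    exact h.length_le k hk
  · simp [h14]
  · simp [h14, hne, h.length k hk]
  · simp only [Function.update_self] at hj ⊢
    rw [h13, h.entry k hk j (hj.trans_le hl.length_le)]
    exact (hl.getElem hj).symm
  · simp only [Function.update_of_ne hne] at hj ⊢
    rw [h13, h.entry k hk j hj]

theorem HoldsAlternatives.push {f : ℕ → List ℕ} {a a' : ℕ → ℕ → ℕ} {i z : ℕ}
    (h : HoldsAlternatives n f a)
    (h13 : a' 13 = Function.update (a 13) (i * n + (f i).length) z)
    (h14 : a' 14 = Function.update (a 14) i ((f i).length + 1)) (hi : i < n)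
    (hlt : (f i).length < n) :
    HoldsAlternatives n (Function.update f i (f i ++ [z])) a' := by
  refine ⟨fun k hk => ?_, fun k hk => ?_, fun k hk j hj => ?_⟩ <;> rcases eq_or_ne k i with rfl | hne
  · simpa using hlt
  · simpa [hne] using h.length_le k hk
  · simp [h14]
  · simp [h14, hne, h.length k hk]
  · simp only [Function.update_self] at hj ⊢
    simp at hj
    rcases lt_or_ge j (f k).length with h1 | h1
    · rw [h13, Function.update_of_ne (by omega), h.entry k hk j h1, List.getElem_append_left h1]
    · obtain rfl : j = (f k).length := by omega
      simp [h13]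
  · simp only [Function.update_of_ne hne] at hj ⊢
    rw [h13, Function.update_of_ne, h.entry k hk j hj]
    intro he
    exact hne (add_mul_inj (hj.trans_le (h.length_le k hk)) hlt he).1

/-- The queue of the graph search for the component of `x` holds `q`. -/
structure QueueMem (n : ℕ) (B : Digraph ℕ) (π : List ℕ) (x : ℕ) (q : List ℕ) (r : ℕ → ℕ)
    (a : ℕ → ℕ → ℕ) : Prop where
  length : r 15 = q.length
  entry : ∀ k, ∀ h : k < q.length, a 16 k = q[k]
  mark : ∀ w < n, a 15 w ≠ 0 ↔ w ∈ q
  nodup : q.Nodup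
  mem_comp : ∀ y ∈ q, y ∈ comp n B π x

theorem QueueMem.lt {q : List ℕ} {r : ℕ → ℕ} {a : ℕ → ℕ → ℕ} (h : QueueMem n B π x q r a)
    (hx : MaxLabel n B π x) : ∀ y ∈ q, y < n := fun y hy =>
  (comp_maxLabel hx (h.mem_comp y hy)).lt

theorem runs_enqueueNeighbor {s : State} {w : ℕ} {q : List ℕ} (hW : n + 2 ≤ W) (hwn : w < n)
    (hx : MaxLabel n B π x) (h10 : s.reg 10 = w) (h13 : s.reg 13 = x)
    (hq : QueueMem n B π x q s.reg s.arr) {y : ℕ} (hy : y ∈ q) (hyw : B.Adj y w)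
    (hm : (s.arr 8 w = 0 ∧ s.arr 7 w = s.arr 7 x) ↔ MaxLabel n B π w) :
    Runs W enqueueNeighbor s fun t => t.clock ≤ s.clock + 40 ∧ ∃ q', q <+: q' ∧
      QueueMem n B π x q' t.reg t.arr ∧ (MaxLabel n B π w → w ∈ q') := by
  have hlen := length_le_of_nodup_of_lt hq.nodup (hq.lt hx)
  by_cases hp : (s.arr 8 w = 0 ∧ s.arr 7 w = s.arr 7 x) ∧ s.arr 15 w = 0
  · obtain ⟨⟨h8, h7⟩, h15⟩ := hp
    have hmax := hm.1 ⟨h8, h7⟩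
    have hwq : w ∉ q := fun hc => (hq.mark w hwn).2 hc h15
    have hnd : (q ++ [w]).Nodup := by
      rw [List.nodup_append]
      exact ⟨hq.nodup, List.nodup_singleton _, fun a ha b hb hab => hwq (by
        rw [List.mem_singleton] at hb
        rwa [← hb, ← hab])⟩
    have hlen' := length_le_of_nodup_of_lt hnd (n := n) (by
      intro a ha
      rcases List.mem_append.1 ha with h | h
      · exact hq.lt hx a h
      · rw [List.mem_singleton] at h
        exact h ▸ hwn)
    simp at hlen'
    have hl := hq.length
    have hr : Runs W enqueueNeighbor s fun t => t.clock ≤ s.clock + 40 ∧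
        t.reg 15 = q.length + 1 ∧ t.arr 15 = Function.update (s.arr 15) w 1 ∧
        t.arr 16 = Function.update (s.arr 16) q.length w := by
      simp [enqueueNeighbor, h10, h13, h8, h7, h15, hl, add_assoc]
      omega
    refine hr.mono ?_
    rintro t - ⟨hc, h15', ha15, ha16⟩
    refine ⟨hc, q ++ [w], List.prefix_append _ _, ⟨by simpa using h15', fun k hk => ?_,
      fun v hv => ?_, hnd, fun v hv => ?_⟩, fun _ => by simp⟩
    · rw [ha16]
      rcases lt_or_ge k q.length with h1 | h1
      · rw [Function.update_of_ne h1.ne, hq.entry k h1, List.getElem_append_left h1]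
      · obtain rfl : k = q.length := by simp at hk; omega
        simp
    · rw [ha15, List.mem_append, List.mem_singleton]
      rcases eq_or_ne v w with rfl | hne
      · simp
      · rw [Function.update_of_ne hne, hq.mark v hv]
        simp [hne]
    · rcases List.mem_append.1 hv with h | h
      · exact hq.mem_comp v h
      · rw [List.mem_singleton] at h
        subst h
        exact Relation.ReflTransGen.tail (hq.mem_comp y hy) ⟨hyw, hmax⟩
  · have hr : Runs W enqueueNeighbor s fun t => t.clock ≤ s.clock + 40 ∧
        t.reg = s.reg ∧ t.arr = s.arr := by
      by_cases h8 : s.arr 8 w = 0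
      · by_cases h7 : s.arr 7 w = s.arr 7 x
        · have h15 : s.arr 15 w ≠ 0 := fun h => hp ⟨⟨h8, h7⟩, h⟩
          simp [enqueueNeighbor, h10, h13, h8, h7, h15, add_assoc]
        · simp [enqueueNeighbor, h10, h13, h8, h7, add_assoc]
      · simp [enqueueNeighbor, h10, h13, h8, add_assoc]
    refine hr.mono ?_
    rintro t - ⟨hc, h1, h2⟩
    refine ⟨hc, q, List.prefix_rfl, h1 ▸ h2 ▸ hq, fun hmax => ?_⟩
    by_contra hc
    exact hp ⟨hm.2 hmax, by_contra fun h => hc ((hq.mark w hwn).1 h)⟩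

theorem runs_enqueueNeighbors (hL : Lists n B L) (hW : n * n + 2 * L.length + n + 2 ≤ W)
    {s : State} (hs : Searching n B L π s.reg s.arr) (hx : MaxLabel n B π x)
    (h13 : s.reg 13 = x) {q : List ℕ} (hq : QueueMem n B π x q s.reg s.arr) {y : ℕ} (hy : y ∈ q)
    (h6 : s.reg 6 = y) :
    Runs W (neighborLoop enqueueNeighbor) s fun t =>
      t.clock ≤ s.clock + (neighbors L y).length * 56 + 7 ∧ ∃ q', q <+: q' ∧
        QueueMem n B π x q' t.reg t.arr ∧ ∀ w, B.Adj y w → MaxLabel n B π w → w ∈ q' := by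
  have hyn := hq.lt hx y hy
  let A : ℕ → (ℕ → ℕ) → (ℕ → ℕ → ℕ) → List ℕ → Prop := fun i r a _ =>
    r 6 = y ∧ r 13 = x ∧ GraphMem n B L a ∧ a 7 = s.arr 7 ∧ a 8 = s.arr 8 ∧ ∃ q', q <+: q' ∧
      QueueMem n B π x q' r a ∧ ∀ w ∈ (neighbors L y).take i, MaxLabel n B π w → w ∈ q'
  refine (Runs.neighbor_loop (A := A) 40 hL hW hyn rfl ?_ ?_ ?_ ?_).mono ?_
  · rintro i r a c k v hk ⟨h1, h2, h3, h4, h5, q', hqq, hq', hT⟩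
    have hk' : k ≠ 6 ∧ k ≠ 13 ∧ k ≠ 15 := by omega
    refine ⟨by simpa [hk'.1.symm] using h1, by simpa [hk'.2.1.symm] using h2, h3, h4, h5, q', hqq,
      ⟨by simpa [hk'.2.2.symm] using hq'.length, hq'.entry, hq'.mark, hq'.nodup, hq'.mem_comp⟩, hT⟩
  · exact fun i r a c h => ⟨h.1, h.2.2.1⟩
  · exact ⟨h6, h13, hs.graph, rfl, rfl, q, List.prefix_rfl, hq, by simp⟩
  · rintro i hi t h10 ⟨h6', h13', hg, h7, h8, q', hqq, hq', hT⟩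
    set w := (neighbors L y)[i] with hw
    have hyw : B.Adj y w := hL.mem_neighbors.1 (List.getElem_mem hi)
    have hwn := (hL.lt_of_adj hyw).2
    refine (runs_enqueueNeighbor (by omega) hwn hx h10 h13' hq' (hqq.subset hy) hyw ?_).mono ?_
    · rw [h7, h8, hs.visited_eq_zero hwn, hs.search.label x hx.lt hx.notMem]
      constructor
      · rintro ⟨h1, h2⟩
        rw [hs.search.label w hwn h1] at h2
        exact maxLabel_of_label_eq hx hwn h1 h2
      · intro h
        refine ⟨h.notMem, ?_⟩
        rw [hs.search.label w hwn h.notMem]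
        exact hx.label_eq h
    · rintro u hu ⟨hc, q'', hqq', hq'', hw'⟩
      refine ⟨hc, (hu.reg_eq rfl).trans h6', (hu.reg_eq rfl).trans h13', hu.graphMem hg rfl,
        (hu.arr_eq rfl).trans h7, (hu.arr_eq rfl).trans h8, q'', hqq.trans hqq', hq'', ?_⟩
      intro v hv hvm
      rw [← List.take_concat_get' _ _ hi, List.mem_append, List.mem_singleton] at hv
      rcases hv with hv | rfl
      · exact hqq'.subset (hT v hv hvm)
      · exact hw' hvm
  · rintro t - ⟨hc, -, -, -, -, -, q', hqq, hq', hT⟩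
    rw [List.take_length] at hT
    exact ⟨by omega, q', hqq, hq', fun w hw => hT w (hL.mem_neighbors.2 hw)⟩

open Classical in
/-- The vertices of the list `q` that can be visited instead of `x`. -/
noncomputable def eligible (B : Digraph ℕ) (π : List ℕ) (x : ℕ) (q : List ℕ) : List ℕ :=
  q.filter fun z => B.Ready π z ∧ z ≠ x

open Classical in
theorem runs_pushAlternative (hL : Lists n B L) (hW : n * n + 2 * L.length + n + 2 ≤ W)
    {s : State} {i y : ℕ} {f : ℕ → List ℕ}
    (hs : Searching n B L π s.reg s.arr) (h6 : s.reg 6 = y) (hy : y < n) (hyπ : y ∉ π)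
    (h13 : s.reg 13 = x) (h12 : s.reg 12 = i) (hi : i < n) (hf : HoldsAlternatives n f s.arr)
    (hlt : (f i).length < n) :
    Runs W pushAlternative s fun t => t.clock ≤ s.clock + 40 ∧
      HoldsAlternatives n (Function.update f i
        (f i ++ if B.Ready π y ∧ y ≠ x then [y] else [])) t.arr := by
  have hoff := hs.graph.offset i hi
  have h14 := hf.length i hi
  have hr : B.Ready π y ↔ s.arr 6 y = 0 := by
    rw [hs.search.indegree y hy hyπ, hL.indegree_eq_zero]
  have haddr := mul_add_lt hi hlt
  by_cases hp : B.Ready π y ∧ y ≠ x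
  · have h0 := hr.1 hp.1
    rw [if_pos hp]
    have hrun : Runs W pushAlternative s fun t => t.clock ≤ s.clock + 40 ∧
        t.arr 13 = Function.update (s.arr 13) (i * n + (f i).length) y ∧
        t.arr 14 = Function.update (s.arr 14) i ((f i).length + 1) := by
      simp [pushAlternative, h6, h0, h13, hp.2, h12, hoff, h14, add_assoc]
      omega
    exact hrun.mono fun t _ ⟨hc, h1, h2⟩ => ⟨hc, hf.push h1 h2 hi hlt⟩
  · rw [if_neg hp, List.append_nil, Function.update_eq_self]
    have hrun : Runs W pushAlternative s fun t => t.clock ≤ s.clock + 40 ∧ t.arr = s.arr := by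
      by_cases h0 : s.arr 6 y = 0
      · have hyx : y = x := by
          by_contra hc
          exact hp ⟨hr.2 h0, hc⟩
        subst hyx
        simp [pushAlternative, h6, h0, h13, add_assoc]
      · simp [pushAlternative, h6, h0, add_assoc]
    exact hrun.mono fun t _ ⟨hc, h1⟩ => ⟨hc, h1 ▸ hf⟩

/-- Breadth-first search for the component. The measure is `remaining` of the dequeued part of the
queue, so every dequeued vertex pays for its own out-edges. When the queue is exhausted it is closed
under the steps that define `comp`. -/
theorem runs_collect (hL : Lists n B L) (hW : n * n + 2 * L.length + n + 2 ≤ W) {s : State}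
    {i : ℕ} {f : ℕ → List ℕ} (hs : Searching n B L π s.reg s.arr) (hx : MaxLabel n B π x)
    (h9 : s.arr 9 i = x) (h12 : s.reg 12 = i) (hi : i < n)
    (h15 : ∀ w < n, s.arr 15 w = 0) (hf : HoldsAlternatives n f s.arr) :
    Runs W collect s fun t => t.clock ≤ s.clock + 100 * (L.length + n) + 60 ∧
      ∃ l : List ℕ, l.Nodup ∧ (∀ z, z ∈ l ↔ z ∈ alternatives n B π x) ∧
        HoldsAlternatives n (Function.update f i l) t.arr ∧
        t.arr 12 = Function.update (s.arr 12) i 0 := by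
  have hxn := hx.lt
  have hrem := remaining_nil hL
  simp only [collect, runs_seq, runs_set, runs_store, Expr.eval, tick_reg, tick_arr, setReg_reg,
    setReg_arr, setArr_reg, setArr_arr, h12, h9]
  refine ⟨by omega, by omega, by simp; omega, by simp; omega, by omega, by omega, by omega,
    by simp [h12]; omega, by omega, by simp [h12]; omega, by omega, ?_⟩
  refine Runs.while_measure (I := fun k t => ∃ h q, k = remaining n L (q.take h) ∧
    t.clock + 100 * k ≤ s.clock + 100 * remaining n L [] + 50 ∧ t.reg 14 = h ∧ h ≤ q.length ∧
    QueueMem n B π x q t.reg t.arr ∧ x ∈ q ∧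
    (∀ y ∈ q.take h, ∀ w, B.Adj y w → MaxLabel n B π w → w ∈ q) ∧
    Searching n B L π t.reg t.arr ∧ t.reg 13 = x ∧ t.reg 12 = i ∧
    HoldsAlternatives n (Function.update f i (eligible B π x (q.take h))) t.arr ∧
    t.arr 12 = Function.update (s.arr 12) i 0) (k := remaining n L []) ?_ ?_
  · refine ⟨0, [x], by simp, by simp; omega, by simp, by simp, ⟨by simp, by simp, fun w hw => ?_,
      by simp, by simp [comp, Relation.ReflTransGen.refl]⟩, by simp, by simp, ?_, by simp,
      by simpa using h12, ?_, by simp [h12]⟩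
    · rcases eq_or_ne w x with rfl | hne
      · simp
      · simp [hne, h15 w hw]
    · exact hs.congr (by simp) (by simp) (by simp) fun j hj => by
        simp [show j ≠ 12 by omega, show j ≠ 14 by omega, show j ≠ 15 by omega,
          show j ≠ 16 by omega]
    · exact hf.update (by simp) (by simp [h12, eligible]) (by simp [eligible]) hi
  rintro k t ⟨h, q, hk, hc, hr14, hhq, hq, hxq, hcl, hst, h13, hr12, hft, ha12⟩
  have hr15 := hq.length
  have hqn := length_le_of_nodup_of_lt hq.nodup (hq.lt hx)
  rcases Nat.eq_or_lt_of_le hhq with hh | hh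
  · refine Or.inl ⟨by simp [hr14, hr15, hh], by simp; omega, eligible B π x q,
      hq.nodup.filter _, fun z => ?_, ?_, ha12⟩
    · rw [hh, List.take_length] at hcl
      have hmem : z ∈ comp n B π x ↔ z ∈ q := by
        refine ⟨fun hz => ?_, hq.mem_comp z⟩
        have hz' : Relation.ReflTransGen (fun a b => B.Adj a b ∧ MaxLabel n B π b) x z := hz
        clear hz
        induction hz' with
        | refl => exact hxq
        | tail _ hbc ih => exact hcl _ ih _ hbc.1 hbc.2
      simp [eligible, alternatives, hmem]
      tauto
    · rwa [hh, List.take_length] at hft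
  · refine Or.inr ⟨by simp [hr14, hr15, hh], ?_⟩
    set y := q[h] with hy
    have hyq : y ∈ q := List.getElem_mem hh
    have hymax := comp_maxLabel hx (hq.mem_comp y hyq)
    have hyt : y ∉ q.take h := by
      intro hc
      obtain ⟨j, hj, hjw⟩ := List.getElem_of_mem hc
      rw [List.getElem_take] at hjw
      simp only [List.length_take, lt_min_iff] at hj
      have := hq.nodup.getElem_inj_iff.1 (hjw.trans hy)
      omega
    have htake : q.take (h + 1) = q.take h ++ [y] := by rw [hy, List.take_concat_get' _ _ hh]
    have hremy := remaining_snoc (L := L) hymax.lt hyt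
    have h16 : t.arr 16 h = y := hq.entry h hh
    have hyn := hymax.lt
    simp only [runs_seq, runs_set, Expr.eval, tick_reg, tick_arr, setReg_reg, setReg_arr, hr14, h16]
    refine ⟨by omega, by simp [hr14]; omega, ?_⟩
    have hel : (eligible B π x (q.take h)).length < n :=
      (List.length_filter_le _ _).trans_lt (by simp; omega)
    refine (runs_pushAlternative hL hW (x := x) (i := i) (y := y)
      (f := Function.update f i (eligible B π x (q.take h))) (π := π) ?_ ?_ hyn hymax.notMem
      ?_ ?_ hi ?_ ?_).mono ?_
    · exact hst.congr rfl rfl rfl fun j _ => rfl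
    · simp
    · simpa using h13
    · simpa using hr12
    · exact hft
    · simpa using hel
    rintro u hu ⟨hcu, hfu⟩
    simp only [tick_clock, setReg_clock, Expr.cost] at hcu
    have hu6 : u.reg 6 = y := by rw [hu.reg_eq rfl]; simp
    have hu13 : u.reg 13 = x := by rw [hu.reg_eq rfl]; simpa using h13
    have hu12 : u.reg 12 = i := by rw [hu.reg_eq rfl]; simpa using hr12
    have hu14 : u.reg 14 = h + 1 := by rw [hu.reg_eq rfl]; simp [hr14]
    have hu15 : u.reg 15 = t.reg 15 := by rw [hu.reg_eq rfl]; simp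
    have hua12 : u.arr 12 = t.arr 12 := hu.arr_eq rfl
    have hua15 : u.arr 15 = t.arr 15 := hu.arr_eq rfl
    have hua16 : u.arr 16 = t.arr 16 := hu.arr_eq rfl
    have hsu : Searching n B L π u.reg u.arr := by
      refine hst.congr (by rw [hu.reg_eq rfl]; rfl) (by rw [hu.reg_eq rfl]; rfl)
        (by rw [hu.reg_eq rfl]; rfl) fun j hj => ?_
      rw [hu.arr_eq (a := j) (by interval_cases j <;> rfl)]
      rfl
    have hqu : QueueMem n B π x q u.reg u.arr :=
      ⟨hu15 ▸ hq.length, hua16 ▸ hq.entry, hua15 ▸ hq.mark, hq.nodup, hq.mem_comp⟩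
    refine (runs_enqueueNeighbors hL hW hsu hx hu13 hqu hyq hu6).mono ?_
    rintro v hv ⟨hcv, q', hqq, hq', hcl'⟩
    -- The queue only grows at its end, so its dequeued part is unchanged.
    have htq : q'.take h = q.take h := by
      obtain ⟨r, rfl⟩ := hqq
      rw [List.take_append_of_le_length hhq]
    have htq' : q'.take (h + 1) = q.take (h + 1) := by
      obtain ⟨r, rfl⟩ := hqq
      rw [List.take_append_of_le_length hh]
    refine ⟨remaining n L (q'.take (h + 1)), ?_, h + 1, q', rfl, ?_, ?_, ?_, hq',
      hqq.subset hxq, ?_, ?_, ?_, ?_, ?_, ?_⟩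
    · rw [htq', htake]
      omega
    · rw [htq', htake]
      omega
    · rw [hv.reg_eq rfl, hu14]
    · exact hh.trans_le hqq.length_le
    · intro z hz w hzw hw
      rw [htq', htake, List.mem_append, List.mem_singleton] at hz
      rcases hz with hz | rfl
      · exact hqq.subset (hcl z hz w hzw hw)
      · exact hcl' w hzw hw
    · refine hsu.congr (hv.reg_eq rfl) (hv.reg_eq rfl) (hv.reg_eq rfl) fun j hj => ?_
      exact hv.arr_eq (by interval_cases j <;> rfl)
    · rw [hv.reg_eq rfl, hu13]
    · rw [hv.reg_eq rfl, hu12]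
    · refine HoldsAlternatives.congr (a := u.arr) ?_ (hv.arr_eq rfl) (hv.arr_eq rfl)
      convert hfu using 1
      rw [htq', htake]
      simp only [Function.update_self, Function.update_idem, eligible, List.filter_append]
      congr 2
      by_cases hp : B.Ready π y ∧ y ≠ x <;> simp [List.filter_cons, hp]
    · rw [hv.arr_eq rfl, hua12, ha12]

end RAM

/-! ### Taking an alternative and finding the next branching level. -/

namespace RAM

variable {n W : ℕ} {B : Digraph ℕ} {L : List (ℕ × ℕ)} {π : List ℕ} {x : ℕ}

/-- `l` lists alternatives to visiting `x` after `π`. -/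
structure IsPending (n : ℕ) (B : Digraph ℕ) (π : List ℕ) (x : ℕ) (l : List ℕ) : Prop where
  nodup : l.Nodup
  subset : ∀ z ∈ l, z ∈ alternatives n B π x

/-- The resulting list is nonempty in both cases: a fresh level was marked because of an undirected
edge, which guarantees a ready alternative, and a collected level was selected because its list is
nonempty. -/
theorem runs_collectIfNeeded (hL : Lists n B L) (hB : B.IsBucketOn n)
    (hW : n * n + 2 * L.length + n + 2 ≤ W) {s : State}
    {i : ℕ} {f : ℕ → List ℕ} (hs : Searching n B L π s.reg s.arr) (hx : MaxLabel n B π x)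
    (hr : B.Ready π x) (h9 : s.arr 9 i = x) (h12 : s.reg 12 = i) (hi : i < n)
    (h15 : ∀ w < n, s.arr 15 w = 0) (hf : HoldsAlternatives n f s.arr)
    (hfresh : s.arr 12 i ≠ 0 → HasAlternative n B π x)
    (hold : s.arr 12 i = 0 → f i ≠ [] ∧ IsPending n B π x (f i)) :
    Runs W (.ite (.get 12 (.reg 12)) collect .skip) s fun t =>
      t.clock ≤ s.clock + 100 * (L.length + n) + 70 ∧
      ∃ l : List ℕ, l ≠ [] ∧ IsPending n B π x l ∧ (s.arr 12 i = 0 → l = f i) ∧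
        (s.arr 12 i ≠ 0 → alternatives n B π x ⊆ {z | z ∈ l}) ∧
        HoldsAlternatives n (Function.update f i l) t.arr ∧
        t.arr 12 = Function.update (s.arr 12) i 0 := by
  rw [runs_ite]
  simp only [Expr.eval, h12]
  refine ⟨fun h => ?_, fun h => ?_⟩
  · refine (runs_collect hL hW (s := s.tick _) hs hx h9 h12 hi h15 hf).mono ?_
    rintro t - ⟨hc, l, hl, hl', hft, ht12⟩
    simp only [tick_clock, Expr.cost] at hc
    refine ⟨by omega, l, ?_, ⟨hl, fun z hz => (hl' z).1 hz⟩, fun h' => absurd h' h,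
      fun _ z hz => (hl' z).2 hz, hft, ht12⟩
    obtain ⟨w, hw, hxw⟩ := hfresh h
    obtain ⟨z, hz, hzx, hzr⟩ := hB.exists_ready_of_undir hs.mcs.closed hr hw hxw
    exact List.ne_nil_of_mem ((hl' z).2 ⟨hz, hzr, hzx⟩)
  · obtain ⟨h1, h2⟩ := hold h
    rw [runs_skip]
    refine ⟨by simp; omega, f i, h1, h2, fun _ => rfl, fun h' => absurd h h', ?_, ?_⟩
    · rw [Function.update_eq_self]
      exact hf
    · rw [← h, Function.update_eq_self]
      rfl

theorem runs_branch (hL : Lists n B L) (hB : B.IsBucketOn n)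
    (hW : n * n + 2 * L.length + n + 2 ≤ W) {s : State}
    {i : ℕ} {f : ℕ → List ℕ} (hs : Searching n B L π s.reg s.arr)
    (hb : Buckets n (s.arr 7) (s.arr 6) (s.arr 8) (s.arr 10) (s.arr 11))
    (hx : MaxLabel n B π x)
    (hr : B.Ready π x) (h9 : s.arr 9 i = x) (h12 : s.reg 12 = i) (hi : i < n)
    (h15 : ∀ w < n, s.arr 15 w = 0) (hf : HoldsAlternatives n f s.arr)
    (hfresh : s.arr 12 i ≠ 0 → HasAlternative n B π x)
    (hold : s.arr 12 i = 0 → f i ≠ [] ∧ IsPending n B π x (f i)) :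
    Runs W branch s fun t => t.clock ≤ s.clock + 200 * (L.length + n) + 200 ∧
      ∃ l z, IsPending n B π x (l ++ [z]) ∧ (s.arr 12 i = 0 → l ++ [z] = f i) ∧
        (s.arr 12 i ≠ 0 → alternatives n B π x ⊆ {y | y ∈ l ++ [z]}) ∧
        HoldsAlternatives n (Function.update f i l) t.arr ∧
        t.arr 12 = Function.update (s.arr 12) i 0 ∧
        Searching n B L (π ++ [z]) t.reg t.arr ∧
        Buckets n (t.arr 7) (t.arr 6) (t.arr 8) (t.arr 10) (t.arr 11) ∧
        ∑ k ∈ Finset.range n, t.arr 11 k ≤ (∑ k ∈ Finset.range n, s.arr 11 k) + n := by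
  refine (runs_collectIfNeeded hL hB hW hs hx hr h9 h12 hi h15 hf hfresh hold).seq ?_
  rintro t ht ⟨hc, l', hne, hl', h0, h1, hft, ht12⟩
  -- The list is a stack: its last entry is explored next, and `l` is left for later rounds.
  obtain ⟨l, z, rfl⟩ : ∃ l z, l' = l ++ [z] :=
    ⟨l'.dropLast, l'.getLast hne, (List.dropLast_append_getLast hne).symm⟩
  obtain ⟨hzc, hzr, hzx⟩ := hl'.subset z (by simp)
  have hz := comp_maxLabel hx hzc
  have hzn := hz.lt
  have hr12 : t.reg 12 = i := (ht.reg_eq rfl).trans h12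
  have h14 : t.arr 14 i = l.length + 1 := by rw [hft.length i hi]; simp
  have hlen := hft.length_le i hi
  simp only [Function.update_self, List.length_append, List.length_singleton] at hlen
  have hentry : t.arr 13 (i * n + l.length) = z := by
    rw [hft.entry i hi l.length (by simp)]
    simp
  have hst : Searching n B L π t.reg t.arr :=
    hs.congr (ht.reg_eq rfl) (ht.reg_eq rfl) (ht.reg_eq rfl) fun j hj =>
      ht.arr_eq (by interval_cases j <;> rfl)
  have hoff := hst.graph.offset i hi
  have hdeg := hL.length_neighbors_le (u := z)
  simp only [runs_seq, runs_store, runs_set, Expr.eval, tick_reg, tick_arr, setReg_reg,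
    setReg_arr, setArr_arr, setArr_reg, hr12, h14]
  have haddr := mul_add_lt hi (show l.length < n by omega)
  have hn2 : n ≤ n * n := Nat.le_mul_self n
  refine ⟨by omega, by omega, ?_, ?_⟩
  · simp [hoff, hentry]
    omega
  refine (runs_visit hL hB hW (x := z) (π := π) ?_ hz hzr ?_ ?_).mono ?_
  · exact hst.congr (by simp) (by simp) (by simp) fun j hj => by
      simp [show j ≠ 14 by omega]
  · simp [hoff, hentry]
  · have hbt : Buckets n (t.arr 7) (t.arr 6) (t.arr 8) (t.arr 10) (t.arr 11) := by
      rw [ht.arr_eq (a := 7) rfl, ht.arr_eq (a := 6) rfl, ht.arr_eq (a := 8) rfl,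
        ht.arr_eq (a := 10) rfl, ht.arr_eq (a := 11) rfl]
      exact hb
    refine Buckets.mono_vis (vis := t.arr 8) (by simpa using hbt) fun w hw => ?_
    rcases eq_or_ne w z with rfl | hwz
    · simp at hw
    · simpa [hwz] using hw
  · rintro u hu ⟨hcu, hsu, hbu, -, -, -, hsum, -⟩
    refine ⟨?_, l, z, hl', h0, h1, ?_, ?_, hsu, hbu, ?_⟩
    · simp at hcu
      omega
    · have h2 : HoldsAlternatives n (Function.update (Function.update f i (l ++ [z])) i l) u.arr := by
        refine hft.update ?_ ?_ (by simp) hi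
        · rw [hu.arr_eq rfl]
          simp
        · rw [hu.arr_eq rfl]
          simp
      simpa using h2
    · rw [hu.arr_eq rfl]
      simpa using ht12
    · have h11 : t.arr 11 = s.arr 11 := ht.arr_eq rfl
      simp [h11] at hsum
      omega

theorem runs_findLevel {s : State} (hW : n + 2 ≤ W) (h4 : s.reg 4 = n) :
    Runs W findLevel s fun t => t.clock ≤ s.clock + 40 * n + 60 ∧
      ((t.reg 13 = 0 ∧ ∀ l < n, s.arr 12 l = 0 ∧ s.arr 14 l = 0) ∨
        (t.reg 13 = 1 ∧ t.reg 12 < n ∧ (s.arr 12 (t.reg 12) ≠ 0 ∨ s.arr 14 (t.reg 12) ≠ 0) ∧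
          ∀ l < n, t.reg 12 < l → s.arr 12 l = 0 ∧ s.arr 14 l = 0)) := by
  simp only [findLevel, runs_seq, runs_set, Expr.eval, tick_reg, setReg_reg, h4]
  refine ⟨by omega, by omega, ?_⟩
  refine Runs.while_measure (I := fun k t => t.arr = s.arr ∧ t.reg 12 ≤ n ∧
    k = t.reg 12 + (1 - t.reg 13) ∧
    t.clock + 30 * t.reg 12 ≤ s.clock + 30 * n + 10 + t.reg 13 * 30 ∧
      ((t.reg 13 = 0 ∧ ∀ l < n, t.reg 12 ≤ l → s.arr 12 l = 0 ∧ s.arr 14 l = 0) ∨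
        (t.reg 13 = 1 ∧ t.reg 12 < n ∧ (s.arr 12 (t.reg 12) ≠ 0 ∨ s.arr 14 (t.reg 12) ≠ 0) ∧
          ∀ l < n, t.reg 12 < l → s.arr 12 l = 0 ∧ s.arr 14 l = 0))) (k := n + 1) ?_ ?_
  · simp
    refine ⟨by omega, fun l hl h => by omega⟩
  rintro k t ⟨ha, hle, hk, hc, h | h⟩
  · obtain ⟨h13, hl⟩ := h
    rw [h13] at hc hk
    rcases Nat.eq_zero_or_pos (t.reg 12) with h0 | h0
    · refine Or.inl ⟨by simp [h13, h0], ?_, Or.inl ⟨by simpa using h13, fun l hln => hl l hln (by omega)⟩⟩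
      simp
      omega
    · refine Or.inr ⟨by simp [h13, h0], ?_⟩
      set j := t.reg 12 - 1 with hj
      have hl' : ∀ l < n, j < l → s.arr 12 l = 0 ∧ s.arr 14 l = 0 := fun l hln hjl =>
        hl l hln (by omega)
      simp only [runs_seq, runs_set, Expr.eval, tick_reg, setReg_reg, ← hj]
      refine ⟨by omega, ?_⟩
      by_cases h12 : s.arr 12 j = 0
      · by_cases h14 : s.arr 14 j = 0
        · simp [ha, h12, h14, h13, ← hj]
          refine ⟨by omega, by omega, by omega, fun l hln hjl => ?_⟩
          rcases Nat.eq_or_lt_of_le hjl with rfl | h2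
          · exact ⟨h12, h14⟩
          · exact hl' l hln h2
        · simp [ha, h12, h14, h13, ← hj]
          refine ⟨by omega, by omega, by omega, by omega, by omega, hl'⟩
      · simp [ha, h12, h13, ← hj]
        refine ⟨by omega, by omega, by omega, by omega, by omega, hl'⟩
  · obtain ⟨h13, hlt, hor, hl⟩ := h
    rw [h13] at hc hk
    refine Or.inl ⟨?_, ?_, Or.inr ⟨by simpa using h13, by simpa using hlt, by simpa using hor, by simpa using hl⟩⟩
    · simp only [Expr.eval, h13]
      by_cases h0 : 0 < t.reg 12 <;> simp [h0]
    · simp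
      omega

end RAM

/-! ### Output and the morality test. -/

namespace RAM

variable {n W : ℕ} {B : Digraph ℕ} {L : List (ℕ × ℕ)} {τ : List ℕ}

/-- The edges of the orientation along `τ`. -/
def orientedPairs (L : List (ℕ × ℕ)) (τ : List ℕ) : List (ℕ × ℕ) :=
  L.filter fun e => τ.idxOf e.1 < τ.idxOf e.2

/-- The words of a list of pairs. -/
def pairWords (L : List (ℕ × ℕ)) : List ℕ := L.flatMap fun e => [e.1, e.2]

theorem Searching.position {r : ℕ → ℕ} {a : ℕ → ℕ → ℕ} (h : Searching n B L τ r a)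
    (hn : τ.length = n) {w : ℕ} (hw : w < n) : a 8 w = τ.idxOf w + 1 := by
  rw [h.search.visited w hw, if_pos (h.mcs.mem_of_length hn hw)]

theorem runs_output (hL : Lists n B L) (hW : n * n + 2 * L.length + n + 2 ≤ W) {s : State}
    (hs : Searching n B L τ s.reg s.arr) (hn : τ.length = n) (h0 : s.reg 0 = 1 + 2 * L.length)
    (hcur : s.cur = []) :
    Runs W output s fun t => t.clock = 0 ∧ t.cur = [] ∧
      ∃ k ≤ s.clock + 60 * (L.length + 1),
        t.log = s.log ++ [(pairWords (orientedPairs L τ), k)] := by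
  refine (Runs.pair_loop (L := L) (A := fun i _ a c => a 8 = s.arr 8 ∧
    c = pairWords (orientedPairs (L.take i) τ)) 20 rfl rfl rfl h0 hs.graph.input (by omega)
    (fun e he => ?_) (fun i r a c x v _ h => h) ?_ ?_).seq ?_
  · have := hL.lt e he
    omega
  · simp [hcur, orientedPairs, pairWords]
  · rintro i hi t h2 h3 ⟨h8, hc⟩
    obtain ⟨hl1, hl2⟩ := hL.lt _ (List.getElem_mem hi)
    have hp1 := hs.position hn hl1
    have hp2 := hs.position hn hl2
    have hsplit : pairWords (orientedPairs (L.take (i + 1)) τ) =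
        pairWords (orientedPairs (L.take i) τ) ++
          if τ.idxOf L[i].1 < τ.idxOf L[i].2 then [L[i].1, L[i].2] else [] := by
      rw [← List.take_concat_get' _ _ hi, orientedPairs, List.filter_append, pairWords,
        List.flatMap_append]
      congr 1
      split_ifs with hlt <;> simp [hlt]
    rw [hsplit]
    by_cases hlt : τ.idxOf L[i].1 < τ.idxOf L[i].2
    · simp [writePair, h2, h3, h8, hp1, hp2, hlt, hc, add_assoc]
      omega
    · simp [writePair, h2, h3, h8, hp1, hp2, hlt, hc, add_assoc]
  · rintro t ht ⟨hc, -, hct⟩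
    rw [runs_emit]
    refine ⟨rfl, rfl, t.clock + 1, by omega, ?_⟩
    rw [List.take_length] at hct
    simp [hct, ht.log_eq rfl]

/-- `a v` is the position of the last in-neighbor of `v` among the pairs in `L` that are directed
along `τ`, or `0`. -/
structure Latest (n : ℕ) (τ : List ℕ) (L : List (ℕ × ℕ)) (a : ℕ → ℕ) : Prop where
  le : ∀ e ∈ L, τ.idxOf e.1 < τ.idxOf e.2 → τ.idxOf e.1 + 1 ≤ a e.2
  eq : ∀ v < n, a v = 0 ∨ ∃ u, (u, v) ∈ L ∧ τ.idxOf u < τ.idxOf v ∧ a v = τ.idxOf u + 1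

theorem runs_updateLatest (hL : Lists n B L) (hW : n * n + 2 * L.length + n + 2 ≤ W) {s : State}
    (hs : Searching n B L τ s.reg s.arr) (hn : τ.length = n) (h0 : s.reg 0 = 1 + 2 * L.length)
    (h17 : ∀ v < n, s.arr 17 v = 0) :
    Runs W (pairLoop updateLatest) s fun t => t.clock ≤ s.clock + 60 * (L.length + 1) ∧
      Latest n τ L (t.arr 17) := by
  refine (Runs.pair_loop (L := L) (A := fun i _ a _ => a 8 = s.arr 8 ∧
    Latest n τ (L.take i) (a 17)) 30 rfl rfl rfl h0 hs.graph.input (by omega)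
    (fun e he => ?_) (fun i r a c x v _ h => h) ?_ ?_).mono ?_
  · have := hL.lt e he
    omega
  · exact ⟨rfl, by simp, fun v hv => Or.inl (h17 v hv)⟩
  · rintro i hi t h2 h3 ⟨h8, hM⟩
    obtain ⟨hl1, hl2⟩ := hL.lt _ (List.getElem_mem hi)
    have hp1 := hs.position hn hl1
    have hp2 := hs.position hn hl2
    have hlen := List.idxOf_lt_length_of_mem (hs.mcs.mem_of_length hn hl1)
    rw [← List.take_concat_get' _ _ hi]
    set u := L[i].1 with hu
    set v := L[i].2 with hv
    have hLi : L[i] = (u, v) := rfl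
    rw [hLi]
    by_cases hlt : τ.idxOf u < τ.idxOf v
    · by_cases hlt' : t.arr 17 v < τ.idxOf u + 1
      · have hr : Runs W updateLatest t fun t' => t'.clock ≤ t.clock + 30 ∧ t'.arr 8 = s.arr 8 ∧
            t'.arr 17 = Function.update (t.arr 17) v (τ.idxOf u + 1) := by
          simp [updateLatest, h2, h3, h8, hp1, hp2, hlt, hlt', add_assoc]
          omega
        refine hr.mono ?_
        rintro t' - ⟨hc, ha8, ha17⟩
        refine ⟨hc, ha8, ?_, ?_⟩
        · intro e he hle
          rw [ha17]
          rcases List.mem_append.1 he with he | he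
          · have := hM.le e he hle
            rcases eq_or_ne e.2 v with hev | hev
            · rw [hev] at this ⊢
              rw [Function.update_self]
              omega
            · rwa [Function.update_of_ne hev]
          · rw [List.mem_singleton] at he
            subst he
            simp
        · intro w hw
          rw [ha17]
          rcases eq_or_ne w v with rfl | hev
          · exact Or.inr ⟨u, by simp, hlt, by simp⟩
          · rw [Function.update_of_ne hev]
            refine (hM.eq w hw).imp_right ?_
            rintro ⟨a, h1, h2⟩
            exact ⟨a, List.mem_append_left _ h1, h2⟩
      · have hr : Runs W updateLatest t fun t' => t'.clock ≤ t.clock + 30 ∧ t'.arr = t.arr := by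
          simp [updateLatest, h2, h3, h8, hp1, hp2, hlt, hlt', add_assoc]
        refine hr.mono ?_
        rintro t' - ⟨hc, ha⟩
        rw [ha]
        refine ⟨hc, h8, fun e he hle => ?_, fun w hw => (hM.eq w hw).imp_right ?_⟩
        · rcases List.mem_append.1 he with he | he
          · exact hM.le e he hle
          · rw [List.mem_singleton] at he
            subst he
            simp only
            omega
        · rintro ⟨a, h1, h2⟩
          exact ⟨a, List.mem_append_left _ h1, h2⟩
    · have hr : Runs W updateLatest t fun t' => t'.clock ≤ t.clock + 30 ∧ t'.arr = t.arr := by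
        simp [updateLatest, h2, h3, h8, hp1, hp2, hlt, add_assoc]
      refine hr.mono ?_
      rintro t' - ⟨hc, ha⟩
      rw [ha]
      refine ⟨hc, h8, fun e he hle => ?_, fun w hw => (hM.eq w hw).imp_right ?_⟩
      · rcases List.mem_append.1 he with he | he
        · exact hM.le e he hle
        · rw [List.mem_singleton] at he
          subst he
          exact absurd hle hlt
      · rintro ⟨a, h1, h2⟩
        exact ⟨a, List.mem_append_left _ h1, h2⟩
  · rintro t - ⟨hc, -, hM⟩
    rw [List.take_length] at hM
    exact ⟨by omega, hM⟩

/-- The condition on `p` singles out the latest in-neighbor of the head, since positions determine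
vertices. So each pair is compared with one vertex only, as `orient_moral_of_latest` permits. -/
theorem runs_testPairs (hL : Lists n B L) (hW : n * n + 2 * L.length + n + 2 ≤ W) {s : State}
    (hs : Searching n B L τ s.reg s.arr) (hn : τ.length = n) (h0 : s.reg 0 = 1 + 2 * L.length)
    (h17 : Latest n τ L (s.arr 17)) (h16 : s.reg 16 = 0) :
    Runs W (pairLoop testPair) s fun t => t.clock ≤ s.clock + 60 * (L.length + 1) ∧
      (t.reg 16 = 0 ↔ ∀ e ∈ L, τ.idxOf e.1 < τ.idxOf e.2 →
        ∀ p < n, s.arr 17 e.2 = τ.idxOf p + 1 → p ≠ e.1 → B.Adj e.1 p) := by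
  refine (Runs.pair_loop (L := L) (A := fun i r a _ => a = s.arr ∧
    (r 16 = 0 ↔ ∀ e ∈ L.take i, τ.idxOf e.1 < τ.idxOf e.2 →
        ∀ p < n, s.arr 17 e.2 = τ.idxOf p + 1 → p ≠ e.1 → B.Adj e.1 p))
    40 rfl rfl rfl h0 hs.graph.input (by omega)
    (fun e he => ?_) (fun i r a c x v hx h => ?_) ?_ ?_).mono ?_
  · have := hL.lt e he
    omega
  · rwa [Function.update_of_ne (by omega)]
  · exact ⟨rfl, by simp [h16]⟩
  · rintro i hi t h2 h3 ⟨ha, hr16⟩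
    have hmem := List.getElem_mem hi
    obtain ⟨hl1, hl2⟩ := hL.lt _ hmem
    have hp1 := hs.position hn hl1
    have hp2 := hs.position hn hl2
    have hoff := hs.graph.offset _ hl1
    rw [← List.take_concat_get' _ _ hi]
    simp only [List.mem_append, List.mem_singleton, or_imp, forall_and, forall_eq]
    by_cases hlt : τ.idxOf L[i].1 < τ.idxOf L[i].2
    · have hle := h17.le _ hmem hlt
      rcases h17.eq _ hl2 with h | ⟨q, hq, hqlt, hqe⟩
      -- The value 0 is impossible, because the pair under test is itself an in-edge of its head.
      · omega
      have hqn := (hL.lt _ hq).1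
      have hq9 : s.arr 9 (τ.idxOf q) = q := by
        rw [hs.search.order _ (List.idxOf_lt_length_of_mem (hs.mcs.mem_of_length hn hqn))]
        simp
      have hmat := hs.graph.matrix _ hl1 _ hqn
      have hcond : (∀ p < n, s.arr 17 L[i].2 = τ.idxOf p + 1 → p ≠ L[i].1 → B.Adj L[i].1 p) ↔
          (q = L[i].1 ∨ B.Adj L[i].1 q) := by
        constructor
        · intro h
          rcases eq_or_ne q L[i].1 with h1 | h1
          · exact Or.inl h1
          · exact Or.inr (h q hqn hqe h1)
        · intro h p hp hpe hne
          have hpq : p = q := by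
            refine (List.idxOf_inj (hs.mcs.mem_of_length hn hp)).1 ?_
            omega
          subst hpq
          exact h.resolve_left hne
      simp only [hlt, true_imp_iff, hcond]
      by_cases hqu : q = L[i].1
      · rw [hqu] at hqe
        simp [testPair, h2, h3, ha, hp1, hp2, hlt, hqe, hqu, hr16, add_assoc]
      · have hidx : τ.idxOf q ≠ τ.idxOf L[i].1 := fun h =>
          hqu ((List.idxOf_inj (hs.mcs.mem_of_length hn hqn)).1 h)
        by_cases hadj : B.Adj L[i].1 q
        · simp [testPair, h2, h3, ha, hp1, hp2, hlt, hqe, hidx, hq9, hoff, hmat.2 hadj, hadj, hr16,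
            add_assoc]
        · have hm0 : s.arr 2 (L[i].1 * n + q) = 0 := by
            by_contra h
            exact hadj (hmat.1 h)
          simp [testPair, h2, h3, ha, hp1, hp2, hlt, hqe, hidx, hq9, hoff, hm0, hadj, hqu,
            add_assoc]
          omega
    · simp [testPair, h2, h3, ha, hp1, hp2, hlt, hr16, add_assoc]
  · rintro t - ⟨hc, -, h⟩
    rw [List.take_length] at h
    exact ⟨by omega, h⟩

theorem runs_testMoral (hL : Lists n B L) (hB : B.IsBucketOn n)
    (hW : n * n + 2 * L.length + n + 2 ≤ W) {s : State}
    (hs : Searching n B L τ s.reg s.arr) (hn : τ.length = n) (h0 : s.reg 0 = 1 + 2 * L.length)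
    (h17 : ∀ v < n, s.arr 17 v = 0) :
    Runs W testMoral s fun t => t.clock ≤ s.clock + 130 * (L.length + 1) ∧
      (t.reg 16 = 0 ↔ ∀ u c v, (B.orient τ).Adj u c → (B.orient τ).Adj v c → u ≠ v →
        B.Linked u v) := by
  unfold testMoral
  rw [runs_seq, runs_set]
  refine ⟨Nat.zero_le _, ?_⟩
  refine (runs_updateLatest hL hW (s := (s.setReg 16 0).tick 2) ?_ hn (by simpa using h0) h17).seq ?_
  · exact hs.congr rfl rfl rfl fun _ _ => rfl
  rintro t ht ⟨hc, hM⟩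
  refine (runs_testPairs hL hW (τ := τ) ?_ hn ?_ hM ?_).mono ?_
  · exact hs.congr (ht.reg_eq rfl) (ht.reg_eq rfl) (ht.reg_eq rfl) fun j hj =>
      ht.arr_eq (by interval_cases j <;> rfl)
  · rw [ht.reg_eq rfl]
    simpa using h0
  · rw [ht.reg_eq rfl]
    simp
  rintro u - ⟨hcu, hu⟩
  refine ⟨by simp at hc; omega, hu.trans ?_⟩
  have hmem : ∀ {w}, w < n → w ∈ τ := fun hw => hs.mcs.mem_of_length hn hw
  constructor
  · intro h
    refine orient_moral_of_latest hB hs.mcs hn fun c p hpc hmax w hwc hwp => ?_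
    have hpn := (hL.lt_of_adj hpc.1).1
    refine h (w, c) ((hL.adj _ _).1 hwc.1) hwc.2 p hpn ?_ hwp.symm
    have h1 := hM.le (p, c) ((hL.adj _ _).1 hpc.1) hpc.2
    rcases hM.eq c (hL.lt_of_adj hpc.1).2 with h2 | ⟨q, hq, hqc, h2⟩
    · simp only at h1
      omega
    · have := hmax q ⟨(hL.adj _ _).2 hq, hqc⟩
      simp only at h1 ⊢
      omega
  · rintro hm ⟨w, c⟩ hwc hlt p hp hpe hne
    have hw : (B.orient τ).Adj w c := ⟨(hL.adj _ _).2 hwc, hlt⟩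
    rcases hM.eq c (hL.lt_of_adj hw.1).2 with h2 | ⟨q, hq, hqc, h2⟩
    · simp only at hpe
      omega
    · have hpq : p = q := (List.idxOf_inj (hmem hp)).1 (by simp only at hpe; omega)
      subst hpq
      refine latest_of_orient_moral hs.mcs hB hn hm ⟨(hL.adj _ _).2 hq, hqc⟩ (fun v hv => ?_) hw
        (Ne.symm hne)
      have := hM.le (v, c) ((hL.adj _ _).1 hv.1) hv.2
      simp only at this
      omega

end RAM

/-! ### One round of the enumeration and its invariant. -/

namespace RAM

variable {n W : ℕ} {B : Digraph ℕ} {L : List (ℕ × ℕ)} {τ : List ℕ}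

theorem runs_seq_assoc {p q r : Prog} {s : State} {Q : State → Prop} :
    Runs W ((p ;; q) ;; r) s Q ↔ Runs W (p ;; q ;; r) s Q := by
  simp only [runs_seq]

theorem remaining_le (hL : Lists n B L) (π : List ℕ) : remaining n L π ≤ L.length + n := by
  rw [← remaining_nil hL]
  unfold remaining
  refine Finset.sum_le_sum_of_subset fun w hw => ?_
  simp at hw ⊢
  exact hw.1

/-- From any ready vertex of the component the forward search reaches the same component, by
`comp_closed`. -/
theorem mem_comp_of_mem_comp {π : List ℕ} {x y z : ℕ} (hB : B.IsBucketOn n) (hx : MaxLabel n B π x)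
    (hr : B.Ready π z) (hz : z ∈ comp n B π x) (hy : y ∈ comp n B π x) : y ∈ comp n B π z := by
  have h := (linkedWithin_symm (comp_connected hz)).trans (comp_connected hy)
  clear hy
  induction h with
  | refl => exact .refl
  | tail _ hbc ih => exact hB.comp_closed hr ih (comp_maxLabel hx hbc.2.2) hbc.1.symm

/-- Once `z` has replaced `x` in the order, the rest of the list consists of alternatives to `z`, so
it never has to be recomputed at this level. -/
theorem IsPending.init {π l : List ℕ} {x z : ℕ} (hB : B.IsBucketOn n) (hx : MaxLabel n B π x)
    (h : IsPending n B π x (l ++ [z])) : IsPending n B π z l := by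
  have hnd := List.nodup_append.1 h.nodup
  refine ⟨hnd.1, fun y hy => ?_⟩
  obtain ⟨hzc, hzr, -⟩ := h.subset z (by simp)
  obtain ⟨hyc, hyr, -⟩ := h.subset y (by simp [hy])
  exact ⟨mem_comp_of_mem_comp hB hx hzr hzc hyc, hyr, hnd.2.2 y hy z (by simp)⟩

/-- Explore the next branch. -/
theorem runs_search (hL : Lists n B L) (hB : B.IsBucketOn n)
    (hW : n * n + 2 * L.length + n + 2 ≤ W) {s : State} {i : ℕ} {f : ℕ → List ℕ}
    (hs : Searching n B L τ s.reg s.arr) (hi : i < τ.length) (h12 : s.reg 12 = i)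
    (hf : HoldsAlternatives n f s.arr)
    (hfresh : s.arr 12 i ≠ 0 → HasAlternative n B (τ.take i) τ[i])
    (hold : s.arr 12 i = 0 → f i ≠ [] ∧ IsPending n B (τ.take i) τ[i] (f i)) :
    Runs W (((reset ;; replay) ;; branch) ;; descend) s fun t =>
      t.clock ≤ s.clock + 1500 * (n + L.length + 1) ∧
      ∃ l z ρ, IsPending n B (τ.take i) τ[i] (l ++ [z]) ∧ (s.arr 12 i = 0 → l ++ [z] = f i) ∧
        (s.arr 12 i ≠ 0 → alternatives n B (τ.take i) τ[i] ⊆ {y | y ∈ l ++ [z]}) ∧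
        Searching n B L (τ.take i ++ [z] ++ ρ) t.reg t.arr ∧
        (τ.take i ++ [z] ++ ρ).length = n ∧
        FreshFrom n B (τ.take i ++ [z] ++ ρ) (i + 1) t.arr ∧
        HoldsAlternatives n (fun k => if k < i then f k else if k = i then l else []) t.arr ∧
        (∀ k < i, t.arr 12 k = s.arr 12 k) ∧ t.arr 12 i = 0 := by
  have hin : i < n := hi.trans_le hs.mcs.length_le
  obtain ⟨hx, hr⟩ := hs.mcs.getElem hi
  rw [runs_seq_assoc, runs_seq_assoc]
  refine (runs_reset hW hs.vertices hs.graph).seq ?_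
  rintro s₁ e₁ ⟨c₁, hs₁, hb₁, hsum₁, h11₁, hz₁⟩
  have h9₁ : s₁.arr 9 = s.arr 9 := e₁.arr_eq rfl
  refine (runs_replay hL hB hW hs.mcs hs₁ hb₁ hi.le ((e₁.reg_eq rfl).trans h12) h11₁ (by
    rw [h9₁]; exact hs.search.order)).seq ?_
  rintro s₂ e₂ ⟨c₂, hs₂, hb₂, -, h9₂, hsum₂⟩
  have h12₂ : s₂.arr 12 = s.arr 12 := (e₂.arr_eq rfl).trans (e₁.arr_eq rfl)
  refine (runs_branch hL hB hW (f := f) hs₂ hb₂ hx hr ?_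
    (((e₂.reg_eq rfl).trans (e₁.reg_eq rfl)).trans h12) hin ?_ ?_ (h12₂ ▸ hfresh)
    (h12₂ ▸ hold)).seq ?_
  · rw [h9₂, h9₁, hs.search.order i hi]
  · intro w hw
    rw [e₂.arr_eq rfl]
    exact (hz₁ w hw).1
  · exact hf.congr ((e₂.arr_eq rfl).trans (e₁.arr_eq rfl)) ((e₂.arr_eq rfl).trans (e₁.arr_eq rfl))
  rintro s₃ e₃ ⟨c₃, l, z, hl, h0, h1, hf₃, h12₃, hs₃, hb₃, hsum₃⟩
  have hlen : (τ.take i ++ [z]).length = i + 1 := by simp; omega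
  have hrem := remaining_le hL (τ.take i ++ [z])
  refine (runs_descend hL hB hW hs₃ hb₃).mono ?_
  rintro s₄ e₄ ⟨c₄, ρ, hs₄, hn₄, hfr₄, hlev₄⟩
  rw [hlen] at hfr₄ hlev₄
  refine ⟨by omega, l, z, ρ, hl, h12₂ ▸ h0, h12₂ ▸ h1, hs₄, hn₄, hfr₄, ?_, ?_, ?_⟩
  · have hfk : ∀ k, k ≤ i → (if k < i then f k else if k = i then l else []) =
        Function.update f i l k := by
      intro k hk
      rcases Nat.eq_or_lt_of_le hk with rfl | h
      · simp
      · rw [if_pos h, Function.update_of_ne h.ne]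
    have hfk' : ∀ k, i < k → (if k < i then f k else if k = i then l else []) = [] := by
      intro k hk
      rw [if_neg (by omega), if_neg (by omega)]
    refine ⟨fun k hk => ?_, fun k hk => ?_, fun k hk => ?_⟩ <;>
      rcases le_or_gt k i with h | h
    · rw [hfk k h]
      exact hf₃.length_le k hk
    · rw [hfk' k h]
      exact Nat.zero_le _
    · rw [hfk k h, (hlev₄ k (by omega)).2]
      exact hf₃.length k hk
    · rw [hfk' k h]
      exact (hfr₄ k (by omega) h).2
    · rw [hfk k h, e₄.arr_eq rfl]
      exact hf₃.entry k hk
    · simp [hfk' k h]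
  · intro k hk
    rw [(hlev₄ k (by omega)).1, h12₃, Function.update_of_ne hk.ne, h12₂]
  · rw [(hlev₄ i (by omega)).1, h12₃, Function.update_self]

/-- The vertices that are still to be visited at level `l` instead of the vertex of `τ`. -/
def pending (n : ℕ) (B : Digraph ℕ) (τ : List ℕ) (g : ℕ → ℕ) (f : ℕ → List ℕ) (l : ℕ) : Set ℕ :=
  {z | (g l ≠ 0 ∧ ∃ h : l < τ.length, z ∈ alternatives n B (τ.take l) τ[l]) ∨ (g l = 0 ∧ z ∈ f l)}

/-- `Ds` has been output, and the branches that are pending in the search that ended with `τ` are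
still to be explored. -/
structure Enumerated (n : ℕ) (B : Digraph ℕ) (L : List (ℕ × ℕ)) (d : ℕ) (τ : List ℕ)
    (f : ℕ → List ℕ) (Ds : List (Digraph ℕ)) (s : State) : Prop where
  input : s.reg 0 = 1 + 2 * L.length
  search : Searching n B L τ s.reg s.arr
  full : τ.length = n
  holds : HoldsAlternatives n f s.arr
  fresh : ∀ l, ∀ h : l < τ.length, s.arr 12 l ≠ 0 → HasAlternative n B (τ.take l) τ[l]
  isPending : ∀ l, ∀ h : l < τ.length, s.arr 12 l = 0 → IsPending n B (τ.take l) τ[l] (f l)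
  nodup : Ds.Nodup
  amo : ∀ D ∈ Ds, B.IsAMO D
  mem_iff : ∀ D, B.IsAMO D → (D ∈ Ds ↔ ¬ Remaining B τ (pending n B τ (s.arr 12) f) D)
  cur : s.cur = []
  log : List.Forall₂ (fun o D => ∃ σ, D = B.orient σ ∧ o.1 = pairWords (orientedPairs L σ)) s.log Ds
  delay : ∀ o ∈ s.log, o.2 ≤ d

theorem Enumerated.congr {d : ℕ} {f : ℕ → List ℕ} {Ds : List (Digraph ℕ)} {s t : State}
    (h : Enumerated n B L d τ f Ds s) (h0 : t.reg 0 = s.reg 0) (h4 : t.reg 4 = s.reg 4)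
    (h7 : t.reg 7 = s.reg 7) (h11 : t.reg 11 = s.reg 11) (ha : t.arr = s.arr)
    (hc : t.cur = s.cur) (hl : t.log = s.log) : Enumerated n B L d τ f Ds t := by
  obtain ⟨h1, h2, h3, h4', h5, h6, h7', h8, h9, h10, h11', h12⟩ := h
  refine ⟨h0.trans h1, h2.congr h4 h7 h11 fun i _ => by rw [ha], h3, ha ▸ h4', ha ▸ h5, ha ▸ h6, h7',
    h8, ha ▸ h9, hc.trans h10, hl ▸ h11', hl ▸ h12⟩

theorem pending_subset {g : ℕ → ℕ} {f : ℕ → List ℕ} {l : ℕ} (hl : l < τ.length)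
    (h : g l = 0 → IsPending n B (τ.take l) τ[l] (f l)) :
    pending n B τ g f l ⊆ alternatives n B (τ.take l) τ[l] := by
  rintro z (⟨-, _, hz⟩ | ⟨hg, hz⟩)
  · exact hz
  · exact (h hg).subset z hz

theorem FreshFrom.fresh {i : ℕ} {a : ℕ → ℕ → ℕ} (h : FreshFrom n B τ i a) (f : ℕ → List ℕ) {l : ℕ}
    (hl : i ≤ l) : Fresh n B τ (pending n B τ (a 12) f) l :=
  fun hlt hw _ hz => Or.inl ⟨(h l hlt hl).1.2 hw, hlt, hz⟩

/-- What `findLevel` computes. -/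
def FoundLevel (n : ℕ) (s : State) : Prop :=
  (s.reg 13 = 0 ∧ ∀ l < n, s.arr 12 l = 0 ∧ s.arr 14 l = 0) ∨
    (s.reg 13 = 1 ∧ s.reg 12 < n ∧ (s.arr 12 (s.reg 12) ≠ 0 ∨ s.arr 14 (s.reg 12) ≠ 0) ∧
      ∀ l < n, s.reg 12 < l → s.arr 12 l = 0 ∧ s.arr 14 l = 0)

theorem Enumerated.runs_findLevel {d : ℕ} {f : ℕ → List ℕ} {Ds : List (Digraph ℕ)} {s : State}
    (h : Enumerated n B L d τ f Ds s) (hW : n * n + 2 * L.length + n + 2 ≤ W) :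
    Runs W findLevel s fun t => t.clock ≤ s.clock + 40 * n + 60 ∧ Enumerated n B L d τ f Ds t ∧
      FoundLevel n t := by
  refine (RAM.runs_findLevel (by omega) h.search.vertices).mono ?_
  rintro t ht ⟨hc, hf⟩
  have ha : t.arr = s.arr := by
    funext j
    exact ht.arr_eq rfl
  refine ⟨hc, h.congr (ht.reg_eq rfl) (ht.reg_eq rfl) (ht.reg_eq rfl) (ht.reg_eq rfl) ha
    (ht.cur_eq rfl) (ht.log_eq rfl), ?_⟩
  unfold FoundLevel
  rwa [ha]

/-- The remaining AMOs change according to `remaining_step`. The new orientation was remaining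
before the round and is not afterwards, so it has not been output before and will not be output
again. The delay adds the preceding `findLevel` to this round up to its output. -/
theorem Enumerated.runs_step {d : ℕ} {f : ℕ → List ℕ} {Ds : List (Digraph ℕ)} {s : State}
    (h : Enumerated n B L d τ f Ds s) (hL : Lists n B L) (hB : B.IsBucketOn n)
    (hW : n * n + 2 * L.length + n + 2 ≤ W) (hDs : Ds ≠ [])
    (hc : s.clock ≤ 40 * n + 100) (hd : 3000 * (n + L.length + 1) ≤ d)
    (h12 : s.reg 12 < n) (hne : s.arr 12 (s.reg 12) ≠ 0 ∨ s.arr 14 (s.reg 12) ≠ 0)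
    (hgt : ∀ l < n, s.reg 12 < l → s.arr 12 l = 0 ∧ s.arr 14 l = 0) :
    Runs W (reset ;; replay ;; branch ;; descend ;; output ;; findLevel) s fun t =>
      t.clock ≤ 40 * n + 60 ∧ (∃ τ' f' D, Enumerated n B L d τ' f' (Ds ++ [D]) t) ∧
        FoundLevel n t := by
  -- The mere existence of an AMO makes the orientation along the next search order an AMO, without
  -- a further test.
  obtain ⟨D₀, hD₀⟩ := List.exists_mem_of_ne_nil Ds hDs
  have hamo₀ := h.amo D₀ hD₀
  generalize hi : s.reg 12 = i at h12 hne hgt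
  have hiτ : i < τ.length := h.full.symm ▸ h12
  rw [← runs_seq_assoc, ← runs_seq_assoc, ← runs_seq_assoc]
  refine (runs_search hL hB hW h.search hiτ hi h.holds (h.fresh i hiτ) fun h0 => ⟨?_, ?_⟩).seq ?_
  · have h1 := hne.resolve_left (by simpa using h0)
    rw [h.holds.length i h12] at h1
    exact List.ne_nil_of_length_pos (Nat.pos_of_ne_zero h1)
  · exact h.isPending i hiτ h0
  rintro t et ⟨ct, l, z, ρ, hl, hl0, hl1, hst, hlen, hfr, hft, hlt, hlti⟩
  generalize hτ' : τ.take i ++ [z] ++ ρ = τ' at hst hlen hfr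
  have hlen_i : (τ.take i).length = i := by simp; omega
  have htake : τ'.take (i + 1) = τ.take i ++ [z] := by
    rw [← hτ', List.take_append_of_le_length (by simp; omega)]
    exact List.take_of_length_le (by rw [List.length_append, hlen_i]; simp)
  have htakel : ∀ k ≤ i, τ'.take k = τ.take k := by
    intro k hk
    rw [← hτ', List.append_assoc, List.take_append_of_le_length (by simp; omega), List.take_take,
      min_eq_left hk]
  have hgetl : ∀ k, ∀ hk : k < i, ∀ (h1 : k < τ'.length) (h2 : k < τ.length), τ'[k] = τ[k] := by
    intro k hk h1 h2
    subst hτ'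
    rw [List.getElem_append_left (by simp; omega), List.getElem_append_left (by simp; omega),
      List.getElem_take]
  have hgeti : ∀ h1 : i < τ'.length, τ'[i] = z := by
    intro h1
    subst hτ'
    rw [List.getElem_append_left (by simp; omega), List.getElem_append_right (by simp)]
    simp
  set f' : ℕ → List ℕ := fun k => if k < i then f k else if k = i then l else [] with hf'
  have hf'l : ∀ k < i, f' k = f k := fun k hk => if_pos hk
  have hf'i : f' i = l := by simp [hf']
  have hf'g : ∀ k, i < k → f' k = [] := fun k hk => by
    simp only [hf']
    rw [if_neg (by omega), if_neg (by omega)]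
  have hmcs := hst.mcs
  have hP0 : ∀ k, ∀ hk : k < τ'.length, t.arr 12 k = 0 →
      IsPending n B (τ'.take k) τ'[k] (f' k) := by
    intro k hk h0
    rcases lt_trichotomy k i with h1 | rfl | h1
    · rw [htakel k h1.le, hgetl k h1 hk (by omega), hf'l k h1]
      exact h.isPending k (by omega) (hlt k h1 ▸ h0)
    · rw [htakel k le_rfl, hgeti, hf'i]
      exact hl.init hB (h.search.mcs.getElem hiτ).1
    · rw [hf'g k h1]
      exact ⟨List.nodup_nil, by simp⟩
  have hstep : ∀ D, B.IsAMO D → (Remaining B τ (pending n B τ (s.arr 12) f) D ↔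
      D = B.orient τ' ∨ Remaining B τ' (pending n B τ' (t.arr 12) f') D) := by
    intro D hD
    have hzl : z ∉ l := fun hc => (List.nodup_append.1 hl.nodup).2.2 z hc z (by simp) rfl
    -- A fresh level and a collected one look alike after `branch`: the pending vertices are exactly
    -- the entries of the list before its last one was removed.
    have hPi : pending n B τ (s.arr 12) f i = {y | y ∈ l ++ [z]} := by
      by_cases h0 : s.arr 12 i = 0
      · ext y
        simp [pending, h0, ← hl0 h0]
      · refine Set.Subset.antisymm (fun y hy => ?_) fun y hy => ?_
        · rcases hy with ⟨-, _, hy⟩ | ⟨hy, -⟩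
          · exact hl1 h0 hy
          · exact absurd hy h0
        · exact Or.inl ⟨h0, hiτ, hl.subset y hy⟩
    refine remaining_step hB hmcs h.full hlen h12 (z := z) ?_ ?_ htake ?_ ?_ ?_ hD
    · rw [hPi]
      simp
    · intro k hk hik
      obtain ⟨h1, h2⟩ := hgt k hk hik
      rw [h.holds.length k hk, List.length_eq_zero_iff] at h2
      simp [pending, h1, h2]
    · intro k hk
      have h1 : k < τ.length := by omega
      have h2 : k < τ'.length := by omega
      ext y
      simp [pending, hlt k hk, hf'l k hk, h1, h2, htakel k hk.le, hgetl k hk h2 h1]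
    · rw [hPi]
      ext y
      simp only [pending, hlti, hf'i]
      simp
      grind
    · exact fun k hk => hfr.fresh f' hk
  refine (runs_output hL hW hst hlen ((et.reg_eq rfl).trans h.input)
    ((et.cur_eq rfl).trans h.cur)).seq ?_
  rintro u eu ⟨hcu, hcur, k, hk, hlog⟩
  have hsubset : ∀ k, ∀ hk : k < τ'.length, pending n B τ' (t.arr 12) f' k ⊆
      alternatives n B (τ'.take k) τ'[k] := fun k hk => pending_subset hk (hP0 k hk)
  have hnot := not_remaining_orient hB hmcs hlen hsubset hamo₀
  have hamo' := (isAMO_orient hB hmcs hlen hamo₀).amo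
  have ha : u.arr = t.arr := funext fun j => eu.arr_eq rfl
  have hu : Enumerated n B L d τ' f' (Ds ++ [B.orient τ']) u := by
    refine ⟨((eu.reg_eq rfl).trans (et.reg_eq rfl)).trans h.input,
      hst.congr (eu.reg_eq rfl) (eu.reg_eq rfl) (eu.reg_eq rfl) fun j _ => by rw [ha], hlen,
      ha ▸ hft, ?_, ha ▸ hP0, ?_, ?_, ?_, hcur, ?_, ?_⟩
    · rw [ha]
      intro k hk h0
      rcases lt_trichotomy k i with h1 | rfl | h1
      · rw [htakel k h1.le, hgetl k h1 hk (by omega)]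
        exact h.fresh k (by omega) (hlt k h1 ▸ h0)
      · exact absurd hlti h0
      · exact (hfr k hk h1).1.1 h0
    · refine List.nodup_append.2 ⟨h.nodup, List.nodup_singleton _, fun D hD D' hD' heq => ?_⟩
      rw [List.mem_singleton] at hD'
      subst hD' heq
      -- The new orientation was still remaining, so it was not among the outputs.
      exact (h.mem_iff _ hamo').1 hD ((hstep _ hamo').2 (Or.inl rfl))
    · intro D hD
      rcases List.mem_append.1 hD with h1 | h1
      · exact h.amo D h1
      · rw [List.mem_singleton.1 h1]
        exact hamo'
    · intro D hD
      rw [ha, List.mem_append, List.mem_singleton, h.mem_iff D hD, hstep D hD]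
      constructor
      · rintro (h1 | rfl)
        · exact fun h2 => h1 (Or.inr h2)
        · exact hnot
      · intro h1
        by_cases h2 : D = B.orient τ'
        · exact Or.inr h2
        · exact Or.inl fun h3 => h3.elim h2 h1
    · rw [hlog, et.log_eq rfl]
      exact List.rel_append (R := _) h.log (.cons ⟨τ', rfl, rfl⟩ .nil)
    · rw [hlog, et.log_eq rfl]
      intro o ho
      rcases List.mem_append.1 ho with h1 | h1
      · exact h.delay o h1
      · rw [List.mem_singleton.1 h1]
        refine le_trans ?_ hd
        simp only
        omega
  refine (hu.runs_findLevel hW).mono ?_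
  rintro v ev ⟨hcv, hv, hfound⟩
  exact ⟨by omega, ⟨τ', f', _, hv⟩, hfound⟩

end RAM

namespace Digraph

variable {B D : Digraph ℕ} {u v : ℕ}

theorem IsAMO.adj (h : B.IsAMO D) (huv : D.Adj u v) : B.Adj u v := by
  rcases (h.skeleton u v).1 (Or.inl huv) with h1 | h1
  · exact h1
  · by_contra h2
    exact h.acyclic u (.tail (.single huv) (h.arcs v u ⟨h1, h2⟩))

end Digraph

/-! ### Correctness of the whole program. -/

namespace RAM

variable {n W : ℕ} {B : Digraph ℕ} {L : List (ℕ × ℕ)} {τ : List ℕ}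

-- An AMO is determined by the subset of the listed pairs that it keeps. The exponential bound
-- serves only as a termination measure for the main loop and does not enter the running time
-- between outputs.
open Classical in
theorem length_le_of_isAMO (hL : Lists n B L) {Ds : List (Digraph ℕ)} (hn : Ds.Nodup)
    (h : ∀ D ∈ Ds, B.IsAMO D) : Ds.length ≤ 2 ^ L.length := by
  rw [← List.toFinset_card_of_nodup hn]
  refine (Finset.card_le_card_of_injOn (t := L.toFinset.powerset)
    (fun D => L.toFinset.filter fun e => D.Adj e.1 e.2) (fun D _ => Finset.mem_coe.2 (Finset.mem_powerset.2 (Finset.filter_subset _ _)))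
    fun D hD D' hD' heq => ?_).trans ?_
  · have key : ∀ E ∈ Ds, ∀ u v, E.Adj u v ↔ (u, v) ∈ L.toFinset.filter fun e => E.Adj e.1 e.2 := by
      intro E hE u v
      simp only [Finset.mem_filter, List.mem_toFinset]
      exact ⟨fun he => ⟨(hL.adj u v).1 ((h E hE).adj he), he⟩, fun he => he.2⟩
    ext u v
    rw [key D (by simpa using hD), key D' (by simpa using hD')]
    exact iff_of_eq (congrArg ((u, v) ∈ ·) heq)
  · rw [Finset.card_powerset]
    exact Nat.pow_le_pow_right (by norm_num) (List.toFinset_card_le L)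

theorem runs_first (hL : Lists n B L) (hB : B.IsBucketOn n)
    (hW : n * n + 2 * L.length + n + 2 ≤ W) {s : State} (h0 : s.arr 0 0 = n)
    (hin : HoldsPairs L (s.arr 0)) (hlen : s.reg 0 = 1 + 2 * L.length)
    (hz : ∀ a ≠ 0, ∀ u, s.arr a u = 0) :
    Runs W (((setup ;; reset) ;; descend) ;; testMoral) s fun t =>
      t.clock ≤ s.clock + 1500 * (n + L.length + 1) ∧
      ∃ τ, Searching n B L τ t.reg t.arr ∧ τ.length = n ∧ FreshFrom n B τ 0 t.arr ∧
        (t.reg 16 = 0 ↔ ∀ u c v, (B.orient τ).Adj u c → (B.orient τ).Adj v c → u ≠ v →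
          B.Linked u v) := by
  rw [runs_seq_assoc, runs_seq_assoc]
  refine (runs_setup hL hW h0 hin hlen hz).seq ?_
  rintro s₁ e₁ ⟨c₁, h4, hg⟩
  refine (runs_reset hW h4 hg).seq ?_
  rintro s₂ e₂ ⟨c₂, hs₂, hb₂, hsum, -, hz₂⟩
  refine (runs_descend hL hB hW hs₂ hb₂).seq ?_
  rintro s₃ e₃ ⟨c₃, τ, hs₃, hn, hfr, -⟩
  rw [List.nil_append] at hs₃ hn hfr
  have hrem := remaining_nil hL
  refine (runs_testMoral hL hB hW hs₃ hn ?_ fun w hw => ?_).mono ?_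
  · exact ((e₃.reg_eq rfl).trans (e₂.reg_eq rfl)).trans ((e₁.reg_eq rfl).trans hlen)
  · rw [e₃.arr_eq rfl]
    exact (hz₂ w hw).2
  rintro s₄ e₄ ⟨c₄, h16⟩
  refine ⟨by omega, τ, ?_, hn, ?_, h16⟩
  · exact hs₃.congr (e₄.reg_eq rfl) (e₄.reg_eq rfl) (e₄.reg_eq rfl) fun j hj =>
      e₄.arr_eq (by interval_cases j <;> rfl)
  · intro l hl hl'
    rw [e₄.arr_eq (a := 12) rfl, e₄.arr_eq (a := 14) rfl]
    exact hfr l hl hl'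

theorem runs_enumerate (hL : Lists n B L) (hB : B.IsBucketOn n)
    (hW : n * n + 2 * L.length + n + 2 ≤ W) {s : State} (h0 : s.arr 0 0 = n)
    (hin : HoldsPairs L (s.arr 0)) (hlen : s.reg 0 = 1 + 2 * L.length)
    (hz : ∀ a ≠ 0, ∀ u, s.arr a u = 0) (hcur : s.cur = []) (hlog : s.log = []) (hc : s.clock = 0) :
    Runs W enumerate s fun t => t.cur = [] ∧ t.clock ≤ 3000 * (n + L.length + 1) ∧
      (∀ o ∈ t.log, o.2 ≤ 3000 * (n + L.length + 1)) ∧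
      ∃ Ds : List (Digraph ℕ), Ds.Nodup ∧ (∀ D, D ∈ Ds ↔ B.IsAMO D) ∧
        List.Forall₂ (fun o D => ∃ σ, D = B.orient σ ∧ o.1 = pairWords (orientedPairs L σ))
          t.log Ds := by
  unfold enumerate
  rw [← runs_seq_assoc, ← runs_seq_assoc, ← runs_seq_assoc]
  refine (runs_first hL hB hW h0 hin hlen hz).seq ?_
  rintro t et ⟨ct, τ, hs, hn, hfr, h16⟩
  have htlog : t.log = [] := (et.log_eq rfl).trans hlog
  have htcur : t.cur = [] := (et.cur_eq rfl).trans hcur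
  rw [runs_ite]
  simp only [Expr.eval, Expr.cost]
  refine ⟨fun h => ?_, fun h => ?_⟩
  · rw [runs_skip]
    refine ⟨htcur, ?_, by simp [htlog], [], List.nodup_nil, fun D => ?_, by simp [htlog]⟩
    · simp
      omega
    · simp only [List.not_mem_nil, false_iff]
      intro hD
      -- An AMO would make this orientation moral, so a failed test shows that there is nothing to
      -- output.
      refine h (h16.2 fun u c v hu hv hne => ?_)
      have hamo := (isAMO_orient hB hs.mcs hn hD).amo
      exact (hamo.skeleton u v).1 (hamo.moral u c v hu hv hne)
  have hmoral := h16.1 h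
  have hamo := (isAMO_orient_of_moral hB hs.mcs hn hmoral).amo
  refine (runs_output hL hW (τ := τ) (s := t.tick 2) hs hn ((et.reg_eq rfl).trans hlen) htcur).seq ?_
  rintro u eu ⟨hcu, hucur, k, hk, hulog⟩
  have ha : u.arr = t.arr := funext fun j => eu.arr_eq rfl
  have hmcs := hs.mcs
  have hP0 : ∀ l, ∀ hl : l < τ.length, t.arr 12 l = 0 → IsPending n B (τ.take l) τ[l] [] :=
    fun l hl _ => ⟨List.nodup_nil, by simp⟩
  have hu : Enumerated n B L (3000 * (n + L.length + 1)) τ (fun _ => []) [B.orient τ] u := by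
    refine ⟨(eu.reg_eq rfl).trans ((et.reg_eq rfl).trans hlen),
      hs.congr (eu.reg_eq rfl) (eu.reg_eq rfl) (eu.reg_eq rfl) fun j _ => by rw [ha], hn, ?_,
      ?_, fun l hl _ => ⟨List.nodup_nil, by simp⟩, List.nodup_singleton _, by simpa using hamo, ?_,
      hucur, ?_, ?_⟩
    · rw [ha]
      exact ⟨by simp, fun l hl => (hfr l (hn.symm ▸ hl) (Nat.zero_le _)).2, by simp⟩
    · rw [ha]
      exact fun l hl => (hfr l hl (Nat.zero_le _)).1.1
    · intro D hD
      rw [ha, List.mem_singleton]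
      constructor
      · rintro rfl
        exact not_remaining_orient hB hmcs hn (fun l hl => pending_subset hl (hP0 l hl)) hD
      · intro h1
        -- After the first search all levels are fresh, so any AMO is this orientation or branches
        -- off at some level.
        refine (eq_orient_or_branch hB hmcs hn (k := 0) (Nat.zero_le _)
          (fun l hl => hfr.fresh (fun _ => []) hl) (ext_nil.2 hD)).resolve_right ?_
        rintro ⟨l, -, h2⟩
        exact h1 ⟨l, h2⟩
    · rw [hulog]
      simp [htlog]
      exact ⟨τ, rfl, rfl⟩
    · rw [hulog]
      simp [htlog] at hk ⊢
      omega
  refine (hu.runs_findLevel hW).seq ?_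
  rintro v ev ⟨hcv, hv, hfound⟩
  -- Each round adds an output, and there are at most `2 ^ L.length` AMOs.
  refine Runs.while_measure (I := fun k w => ∃ τ f Ds,
    Enumerated n B L (3000 * (n + L.length + 1)) τ f Ds w ∧ FoundLevel n w ∧ Ds ≠ [] ∧
    k + Ds.length = 2 ^ L.length ∧ w.clock ≤ 40 * n + 60) (k := 2 ^ L.length - 1) ?_ ?_
  · have := length_le_of_isAMO hL hv.nodup hv.amo
    simp only [List.length_singleton] at this
    exact ⟨τ, _, _, hv, hfound, by simp, by simp; omega, by omega⟩
  rintro k w ⟨τ, f, Ds, hw, hf | hf, hDs, hkD, hcw⟩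
  · obtain ⟨h13, hl⟩ := hf
    refine Or.inl ⟨h13, hw.cur, by simp; omega, hw.delay, Ds, hw.nodup, fun D =>
      ⟨hw.amo D, fun hD => (hw.mem_iff D hD).2 ?_⟩, hw.log⟩
    rintro ⟨l, hlt, z, hz, -⟩
    have hln : l < n := hw.full ▸ hlt
    obtain ⟨h1, h2⟩ := hl l hln
    rw [hw.holds.length l hln, List.length_eq_zero_iff] at h2
    simp [pending, h1, h2] at hz
  · obtain ⟨h13, h12, hne, hgt⟩ := hf
    refine Or.inr ⟨by simp [h13], ?_⟩
    have hw' : Enumerated n B L (3000 * (n + L.length + 1)) τ f Ds (w.tick 2) :=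
      hw.congr rfl rfl rfl rfl rfl rfl rfl
    refine (hw'.runs_step hL hB hW hDs (by simp; omega) le_rfl h12 hne hgt).mono ?_
    rintro w' - ⟨hc', ⟨τ', f', D, he⟩, hf'⟩
    have hle := length_le_of_isAMO hL he.nodup he.amo
    simp only [List.length_append, List.length_singleton] at hle
    exact ⟨k - 1, by omega, τ', f', _, he, hf', by simp, by simp; omega, hc'⟩

end RAM

namespace Digraph

/-! ### Buckets -/

section Bucket

variable {U : Type*} {G : Digraph U}

/-- Two directed edges into a vertex of a bucket from nonadjacent vertices lead to all vertices of
the bucket. -/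
theorem IsMPDAG.arc_of_reachable (hG : G.IsMPDAG) {a b c d : U} (hac : G.Arc a c) (hbc : G.Arc b c)
    (hne : a ≠ b) (hl : ¬ G.Linked a b) (h : G.toSimpleGraphStrict.Reachable c d) :
    G.Arc a d ∧ G.Arc b d := by
  rw [SimpleGraph.reachable_iff_reflTransGen] at h
  have hl' : ¬ G.Linked b a := fun h => hl (Or.symm h)
  obtain ⟨-, hM⟩ := hG
  induction h with
  | refl => exact ⟨hac, hbc⟩
  | @tail d e _ hde ih =>
    obtain ⟨had, hbd⟩ := ih
    have hde' : G.Undir d e := hde.2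
    have hed : G.Undir e d := ⟨hde'.2, hde'.1⟩
    -- An edge directed from `e` into `a` or `b` contradicts rule 2. If exactly one of `a - e`, `b -
    -- e` is undirected, rule 1 links `a` and `b`; if both are, rule 3 does.
    have hea : ¬ G.Arc e a := fun h => hM.r2 _ _ _ h had hed
    have heb : ¬ G.Arc e b := fun h => hM.r2 _ _ _ h hbd hed
    have hae := hM.r1 _ _ _ had hde'
    have hbe := hM.r1 _ _ _ hbd hde'
    have h1 := hM.r1 a e b
    have h2 := hM.r1 b e a
    have h3 := hM.r3 e a d b hne
    simp only [Arc, Undir, Linked] at *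
    grind

/-- Otherwise `a` has directed edges to all vertices of the undirected component of `c`, to itself
among them. -/
theorem IsMPDAG.linked_of_arcs (hG : G.IsMPDAG) {a b c : U} (hac : G.Arc a c) (hbc : G.Arc b c)
    (hne : a ≠ b) (h : G.toSimpleGraphStrict.Reachable c a) : G.Linked a b := by
  by_contra hl
  exact hG.1.1 a (hG.arc_of_reachable hac hbc hne hl h).1.1

end Bucket

/-! ### Passing from `Fin n` to natural numbers, which are the words of the machine. -/

variable {n : ℕ}

/-- The graph on the natural numbers with the edges of `B`. -/
def mapVal (B : Digraph (Fin n)) : Digraph ℕ where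
  Adj x y := ∃ u v : Fin n, B.Adj u v ∧ (u : ℕ) = x ∧ (v : ℕ) = y

/-- The graph induced by the first `n` natural numbers. -/
def comapVal (n : ℕ) (D : Digraph ℕ) : Digraph (Fin n) where
  Adj u v := D.Adj u v

section MapVal

variable {B D : Digraph (Fin n)}

@[simp] theorem mapVal_adj {u v : Fin n} : B.mapVal.Adj u v ↔ B.Adj u v := by
  simp only [mapVal]
  constructor
  · rintro ⟨u', v', h, h1, h2⟩
    rwa [← Fin.ext h1, ← Fin.ext h2]
  · exact fun h => ⟨u, v, h, rfl, rfl⟩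

theorem mapVal_adj_lt {x y : ℕ} (h : B.mapVal.Adj x y) : x < n ∧ y < n := by
  obtain ⟨u, v, -, rfl, rfl⟩ := h
  exact ⟨u.2, v.2⟩

@[simp] theorem mapVal_linked {u v : Fin n} : B.mapVal.Linked u v ↔ B.Linked u v := by
  simp [Linked]

@[simp] theorem mapVal_arc {u v : Fin n} : B.mapVal.Arc u v ↔ B.Arc u v := by
  simp [Arc]

@[simp] theorem mapVal_undir {u v : Fin n} : B.mapVal.Undir u v ↔ B.Undir u v := by
  simp [Undir]

theorem comapVal_mapVal : comapVal n D.mapVal = D := by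
  ext u v
  simp [comapVal]

theorem mapVal_comapVal {D : Digraph ℕ} (h : ∀ x y, D.Adj x y → x < n ∧ y < n) :
    (comapVal n D).mapVal = D := by
  ext x y
  constructor
  · rintro ⟨u, v, huv, rfl, rfl⟩
    exact huv
  · intro hxy
    obtain ⟨hx, hy⟩ := h x y hxy
    exact ⟨⟨x, hx⟩, ⟨y, hy⟩, hxy, rfl, rfl⟩

theorem transGen_val {r : ℕ → ℕ → Prop} (hr : ∀ x y, r x y → x < n ∧ y < n) {x y : ℕ}
    (h : TransGen r x y) : ∃ hx : x < n, ∃ hy : y < n,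
      TransGen (fun u v : Fin n => r u v) ⟨x, hx⟩ ⟨y, hy⟩ := by
  induction h with
  | single h => exact ⟨(hr _ _ h).1, (hr _ _ h).2, .single h⟩
  | tail _ hbc ih =>
    obtain ⟨hx, hy, h⟩ := ih
    exact ⟨hx, (hr _ _ hbc).2, h.tail hbc⟩

theorem isAMO_mapVal : B.mapVal.IsAMO D.mapVal ↔ B.IsAMO D := by
  have hlt : ∀ {E : Digraph (Fin n)} {x y : ℕ}, E.mapVal.Linked x y → x < n ∧ y < n :=
    fun h => h.elim mapVal_adj_lt fun h => (mapVal_adj_lt h).symm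
  constructor
  · intro h
    refine ⟨fun u v => ?_, fun u v huv => ?_, fun v hv => ?_, fun u c v huc hvc hne => ?_⟩
    · simpa using h.skeleton u v
    · simpa using h.arcs u v (by simpa using huv)
    · exact h.acyclic v (TransGen.lift Fin.val (fun a b hab => mapVal_adj.2 hab) _ _ hv)
    · simpa using h.moral u c v (by simpa using huc) (by simpa using hvc) (by simpa [Fin.ext_iff] using hne)
  · intro h
    refine ⟨fun x y => ?_, fun x y hxy => ?_, fun x hx' => ?_, ?_⟩
    · constructor <;> intro hxy <;> obtain ⟨hx, hy⟩ := hlt hxy <;> lift x to Fin n using hx <;>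
        lift y to Fin n using hy <;> have := h.skeleton x y <;> simp_all
    · obtain ⟨hx, hy⟩ := mapVal_adj_lt hxy.1
      lift x to Fin n using hx
      lift y to Fin n using hy
      simpa using h.arcs x y (by simpa using hxy)
    · obtain ⟨hx, _, h1⟩ := transGen_val (fun _ _ => mapVal_adj_lt) hx'
      exact h.acyclic _ (TransGen.mono (fun a b hab => mapVal_adj.1 hab) _ _ h1)
    · rintro _ _ _ ⟨u, c, huc, rfl, rfl⟩ ⟨v, c', hvc, rfl, h2⟩ hne
      obtain rfl : c' = c := Fin.ext h2
      simpa using h.moral u c' v huc hvc (by rintro rfl; exact hne rfl)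

end MapVal

theorem IsBucket.isBucketOn {B : Digraph (Fin n)} (hB : B.IsBucket) : B.mapVal.IsBucketOn n := by
  obtain ⟨U, _, G, hG, K, e, he⟩ := hB
  have hArc : ∀ u v, B.Arc u v ↔ G.Arc (e u) (e v) := fun u v => by simp [Arc, he]
  have hUndir : ∀ u v, B.Undir u v ↔ G.Undir (e u) (e v) := fun u v => by simp [Undir, he]
  have hLinked : ∀ u v, B.Linked u v ↔ G.Linked (e u) (e v) := fun u v => by simp [Linked, he]
  refine ⟨fun u v h => mapVal_adj_lt h, ?_, fun x hx' => ?_, ?_, ?_, ?_⟩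
  · rintro _ ⟨u, v, huv, rfl, h⟩
    obtain rfl : v = u := Fin.ext h
    exact hG.1.1 _ ((he _ _).1 huv)
  · obtain ⟨hx, _, h1⟩ := transGen_val (fun _ _ h => mapVal_adj_lt h.1) hx'
    exact hG.1.2 _ (TransGen.lift (fun u => (e u : U))
      (fun a b hab => (hArc _ _).1 (mapVal_arc.1 hab)) _ _ h1)
  · intro a b c hab hbc
    obtain ⟨ha, hb⟩ := mapVal_adj_lt hab.1
    obtain ⟨-, hc⟩ := mapVal_adj_lt hbc.1
    lift a to Fin n using ha
    lift b to Fin n using hb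
    lift c to Fin n using hc
    rw [mapVal_arc, hArc] at hab
    rw [mapVal_undir, hUndir] at hbc
    rw [mapVal_linked, hLinked]
    exact hG.2.r1 _ _ _ hab hbc
  · intro a b c hab hbc hac
    obtain ⟨ha, hb⟩ := mapVal_adj_lt hab.1
    obtain ⟨-, hc⟩ := mapVal_adj_lt hbc.1
    lift a to Fin n using ha
    lift b to Fin n using hb
    lift c to Fin n using hc
    rw [mapVal_arc, hArc] at hab hbc
    rw [mapVal_undir, hUndir] at hac
    exact hG.2.r2 _ _ _ hab hbc hac
  · intro a b c hac hbc hne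
    obtain ⟨ha, hc⟩ := mapVal_adj_lt hac.1
    obtain ⟨hb, -⟩ := mapVal_adj_lt hbc.1
    lift a to Fin n using ha
    lift b to Fin n using hb
    lift c to Fin n using hc
    rw [mapVal_arc, hArc] at hac hbc
    rw [mapVal_linked, hLinked]
    refine hG.linked_of_arcs hac hbc (fun h => hne ?_) ?_
    · rw [e.injective (Subtype.ext h)]
    · exact SimpleGraph.ConnectedComponent.exact ((e c).2.trans (e a).2.symm)

/-- A component is nonempty. This lets a multiple of `n` absorb the additive constants in the
running time. -/
theorem IsBucket.pos {B : Digraph (Fin n)} (hB : B.IsBucket) : 0 < n := by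
  obtain ⟨U, _, G, hG, K, e, he⟩ := hB
  obtain ⟨u, hu⟩ := K.nonempty_supp
  exact (Nat.zero_le _).trans_lt (e.symm ⟨u, hu⟩).2

/-- The map to unordered pairs has fibers of size at most two; looplessness ensures that its values
are edges. -/
theorem IsEdgeList.length_le {B : Digraph (Fin n)} {L : List (Fin n × Fin n)} (hL : B.IsEdgeList L)
    (hB : ∀ v, ¬ B.Adj v v) : L.length ≤ 2 * B.numEdges := by
  classical
  have hfin : B.toSimpleGraphInclusive.edgeSet.Finite := Set.toFinite _
  rw [numEdges, Set.ncard_eq_toFinset_card _ hfin, ← List.toFinset_card_of_nodup hL.1]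
  refine Finset.card_le_mul_card_image_of_maps_to (f := fun e => s(e.1, e.2)) ?_ _ ?_
  · rintro ⟨u, v⟩ he
    rw [List.mem_toFinset, hL.2] at he
    rw [Set.Finite.mem_toFinset, SimpleGraph.mem_edgeSet, toSimpleGraphInclusive,
      SimpleGraph.fromRel_adj]
    exact ⟨fun h : u = v => hB u (by rwa [← h] at he), Or.inl he⟩
  · intro b _
    induction b with
    | _ x y =>
      refine (Finset.card_le_card (t := {(x, y), (y, x)}) ?_).trans Finset.card_le_two
      rintro ⟨u, v⟩ h
      simpa [Sym2.eq_iff] using (Finset.mem_filter.1 h).2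

end Digraph

/-! ### Input and output words, and the final bounds. -/

namespace RAM

/-- The pairs of natural numbers of a list of pairs. -/
def valPairs {n : ℕ} (L : List (Fin n × Fin n)) : List (ℕ × ℕ) :=
  L.map fun e => ((e.1 : ℕ), (e.2 : ℕ))

variable {n : ℕ} {B : Digraph (Fin n)} {L : List (Fin n × Fin n)}

theorem edgeWords_eq (L : List (Fin n × Fin n)) : edgeWords L = pairWords (valPairs L) := by
  simp [edgeWords, pairWords, valPairs, List.flatMap_map]

theorem length_pairWords (L : List (ℕ × ℕ)) : (pairWords L).length = 2 * L.length := by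
  induction L with
  | nil => rfl
  | cons e L ih =>
    simp only [pairWords, List.flatMap_cons, List.length_append, List.length_cons,
      List.length_nil] at ih ⊢
    omega

theorem holdsPairs_init (x : ℕ) (L : List (ℕ × ℕ)) :
    HoldsPairs L fun i => (x :: pairWords L).getD i 0 := by
  have key : ∀ (L : List (ℕ × ℕ)) (i : ℕ) (h : i < L.length),
      (pairWords L).getD (2 * i) 0 = L[i].1 ∧ (pairWords L).getD (2 * i + 1) 0 = L[i].2 := by
    intro L
    induction L with
    | nil => simp
    | cons e L ih =>
      rintro (_ | i) h
      · simp [pairWords]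
      · have := ih i (by simpa using h)
        simpa [pairWords, mul_add] using this
  intro i h
  have := key L i h
  beta_reduce
  rw [show 1 + 2 * i = 2 * i + 1 by ring, List.getD_cons_succ, List.getD_cons_succ]
  exact this

theorem lists_valPairs (hL : B.IsEdgeList L) : Lists n B.mapVal (valPairs L) := by
  refine ⟨hL.1.map fun a b h => ?_, fun x y => ?_, fun e he => ?_⟩
  · simp only [Prod.mk.injEq] at h
    exact Prod.ext (Fin.ext h.1) (Fin.ext h.2)
  · simp only [mapVal, valPairs, List.mem_map, Prod.mk.injEq, Prod.exists, hL.2]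
  · obtain ⟨a, -, rfl⟩ := List.mem_map.1 he
    exact ⟨a.1.2, a.2.2⟩

/-- Of the two listed pairs of an undirected edge only the one with increasing positions is kept, so
filtering the input list gives an edge list of the orientation. -/
theorem exists_edgeList_orient (hL : B.IsEdgeList L) (σ : List ℕ) :
    ∃ M : List (Fin n × Fin n), (comapVal n (B.mapVal.orient σ)).IsEdgeList M ∧
      pairWords (orientedPairs (valPairs L) σ) = edgeWords M := by
  refine ⟨L.filter fun e => σ.idxOf (e.1 : ℕ) < σ.idxOf (e.2 : ℕ), ⟨hL.1.filter _, fun u v => ?_⟩, ?_⟩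
  · simp [hL.2, comapVal, orient]
  · rw [edgeWords_eq, orientedPairs, valPairs, valPairs, List.filter_map]
    rfl

theorem enumeratesAMOs (hB : B.IsBucket) :
    EnumeratesAMOs enumerate (10000 * (n + B.numEdges) ^ 2) (10000 * (n + B.numEdges)) B := by
  intro L hL
  have hBn := hB.isBucketOn
  have hn := hB.pos
  have hlen := hL.length_le fun v hv => hBn.loopless v (mapVal_adj.2 hv)
  have hlen' : (valPairs L).length = L.length := by simp [valPairs]
  -- The words needed are at most quadratic: the matrix needs addresses up to `n * n`, the input
  -- position goes up to `1 + 2 * L.length`, and `L.length` is at most twice the number of edges.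
  have hW : n * n + 2 * (valPairs L).length + n + 2 ≤ 10000 * (n + B.numEdges) ^ 2 := by
    rw [hlen']
    nlinarith [Nat.zero_le (n * B.numEdges), Nat.zero_le (B.numEdges * B.numEdges),
      Nat.mul_le_mul_right n hn, Nat.mul_le_mul_right B.numEdges hn]
  obtain ⟨t, ht, hcur, hclock, hdelay, Ds, hnd, hmem, hlog⟩ :=
    runs_enumerate (s := State.init (n :: edgeWords L)) (lists_valPairs hL) hBn hW
      (by simp [State.init])
      (by
        rw [edgeWords_eq]
        exact holdsPairs_init n (valPairs L))
      (by
        simp [State.init, edgeWords_eq, length_pairWords]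
        omega)
      (fun a ha u => by simp [State.init, ha]) rfl rfl rfl
  have hadj : ∀ D ∈ Ds, ∀ x y, D.Adj x y → x < n ∧ y < n := fun D hD x y h =>
    hBn.lt x y (((hmem D).1 hD).adj h)
  -- With `L.length` at most twice the number of edges and `1 ≤ n`, the factor 6000 would already
  -- do.
  have hd : 3000 * (n + (valPairs L).length + 1) ≤ 10000 * (n + B.numEdges) := by omega
  refine ⟨t, ht, hcur, hclock.trans hd, fun o ho => (hdelay o ho).trans hd, Ds.map (comapVal n), ?_,
    fun D => ?_, ?_⟩
  · refine hnd.map_on fun D hD D' hD' h => ?_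
    rw [← mapVal_comapVal (hadj D hD), ← mapVal_comapVal (hadj D' hD'), h]
  · rw [List.mem_map]
    constructor
    · rintro ⟨E, hE, rfl⟩
      rw [← isAMO_mapVal, mapVal_comapVal (hadj E hE)]
      exact (hmem E).1 hE
    · exact fun hD => ⟨D.mapVal, (hmem _).2 (isAMO_mapVal.2 hD), comapVal_mapVal⟩
  · rw [List.forall₂_map_right_iff]
    refine hlog.imp ?_
    rintro o _ ⟨σ, rfl, ho⟩
    obtain ⟨M, hM, hM'⟩ := exists_edgeList_orient hL σ
    exact ⟨M, hM, ho.trans hM'⟩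

end RAM

/-- The polynomial bound on the words expresses that they have `O(log (n + m))` bits. -/
theorem mainTheorem5 :
    ∃ (p : RAM.Prog) (C c : ℕ), ∀ (n : ℕ) (B : Digraph (Fin n)), B.IsBucket →
      RAM.EnumeratesAMOs p (C * (n + B.numEdges) ^ c) (C * (n + B.numEdges)) B :=
  ⟨RAM.enumerate, 10000, 2, fun _ _ hB => RAM.enumeratesAMOs hB⟩
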